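/- Let $d>4$ be an integer, $r>4$, $M>0$ and $\alpha,\beta>0$. Let $\mathcal R=\mathcal R(d,r,M,\alpha,\beta)$ be the class of all triples $(P,Q,\varphi_0)$ such that - $P,Q$ are Borel probability measures on $\mathbb R^d$ with $\int\|x\|_2^r\,dP\le M^r$ and $\int\|x\|_2^r\,dQ\le M^r$, and $P$ has no atoms; - (A0) $\varphi_0:\mathbb R^d\to\mathbb R$ is strictly convex, differentiable and $P$-integrable, and it minimizes $\varphi\mapsto\int\varphi\,dP+\int\varphi^*\,dQ$ over all $P$-integrable $\varphi:\mathbb R^d\to\mathbb R$, where $\varphi^*(y)=\sup_{x\in\mathbb R^d}[\langle x,y\rangle-\varphi(x)]$; - (A1) $\varphi_0$ is convex and $C^1$, with $\varphi_0(y)\ge\varphi_0(x)+\langle\nabla\varphi_0(x),y-x\rangle+\frac{\alpha}{2}\|y-x\|_2^2$ for all $x,y\in\mathbb R^d$; - (A2) $\varphi_0$ is convex and $C^1$, with $\varphi_0(y)\le\varphi_0(x)+\langle\nabla\varphi_0(x),y-x\rangle+\frac{\beta}{2}\|y-x\|_2^2$ for all $x,y\in\mathbb R^d$. For such a triple put $T_0=\nabla\varphi_0$.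 For a random map $\widehat T$ put $R(\widehat T,T_0)=\mathbb E\int\|\widehat T(x)-T_0(x)\|_2^2\,dP(x)$. **Estimator.** Let $X_1,\dots,X_n$ be i.i.d. with law $P$ and $Y_1,\dots,Y_m$ i.i.d. with law $Q$, on a common probability space. Let $\widehat\pi$ be a (measurably chosen) minimizer of $\sum_{i,j}\pi_{ij}\|X_i-Y_j\|_2^2$ over all $n\times m$ matrices $\pi$ with nonnegative entries, with $\sum_j\pi_{ij}=1/n$ for all $i$ and $\sum_i\pi_{ij}=1/m$ for all $j$. Let $W_1,\dots,W_n$ be a (measurably chosen) Voronoi partition: $W_i\subseteq V_i:=\{x:\|x-X_i\|_2\le\|x-X_j\|_2\ \text{for all } j\}$, $P(W_i\cap W_j)=0$ for $i\ne j$, and $P\big(\mathbb R^d\setminus\bigcup_iW_i\big)=0$. (Thus ties may be broken in any way, and $W_i=V_i$ is allowed when ties are $P$-null.) The nearest-neighbor plugin estimator is $$\widehat T^{\mathrm{1NN}}_{nm}(x)=\sum_{i=1}^n\sum_{j=1}^m (n\widehat\pi_{ij})\,\mathbf 1(x\in W_i)\,Y_j .$$ **Upper bound.** There is a constant $C>0$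 depending only on $d,r,M,\alpha,\beta$ such that for all $n\ge2$, all $m\ge1$, all $(P,Q,\varphi_0)\in\mathcal R$ and every nearest-neighbor plugin estimator, $$R(\widehat T^{\mathrm{1NN}}_{nm},T_0)\le C\,\big(n^{-2/d}+m^{-2/d}\big)\log n .$$ **Minimax optimality up to a logarithmic factor.** If $\alpha<\beta$, there is a constant $c>0$ depending only on $d,r,M,\alpha,\beta$ such that for all $n,m\ge1$, $$\inf_{\widehat T}\ \sup_{(P,Q,\varphi_0)\in\mathcal R} R(\widehat T,T_0)\ \ge\ c\,\big(n^{-2/d}+m^{-2/d}\big),$$ where the samples $X_1,\dots,X_n\sim P$ and $Y_1,\dots,Y_m\sim Q$ are all independent, and the infimum is over all estimators $\widehat T=\widehat T(X_1,\dots,X_n,Y_1,\dots,Y_m;x)\in\mathbb R^d$ that are jointly measurable in the samples and in $x$. -/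

import Mathlib

open MeasureTheory ProbabilityTheory
open scoped ENNReal Gradient

noncomputable section

/-- `ℝᵈ` with the Euclidean norm. -/
abbrev Rd (d : ℕ) : Type := EuclideanSpace ℝ (Fin d)

/-- The Fenchel conjugate `φ*(y) = sup_x (⟨x, y⟩ - φ x)`, with values in the extended reals. -/
def fenchelConj {d : ℕ} (φ : Rd d → ℝ) (y : Rd d) : EReal :=
  ⨆ x : Rd d, ((inner ℝ x y - φ x : ℝ) : EReal)

/-- The integral `∫ f⁺ dμ - ∫ f⁻ dμ` of an extended-real function.
(For `f = φ*` the negative part is bounded, because `φ* ≥ -φ 0`, so that `∞ - ∞` does not occur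
for a finite measure.) -/
def extIntegral {d : ℕ} (μ : Measure (Rd d)) (f : Rd d → EReal) : EReal :=
  ((∫⁻ y, (f y).toENNReal ∂μ : ℝ≥0∞) : EReal) - ((∫⁻ y, (-f y).toENNReal ∂μ : ℝ≥0∞) : EReal)

/-- The semi-dual functional `S_{P,Q}(φ) = ∫ φ dP + ∫ φ* dQ`. -/
def semidual {d : ℕ} (P Q : Measure (Rd d)) (φ : Rd d → ℝ) : EReal :=
  ((∫ x, φ x ∂P : ℝ) : EReal) + extIntegral Q (fenchelConj φ)

/-- `φ` minimizes the semi-dual functional over `L¹(P)`. -/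
structure IsSemidualMinimizer {d : ℕ} (P Q : Measure (Rd d)) (φ : Rd d → ℝ) : Prop where
  integrable : Integrable φ P
  le : ∀ ψ : Rd d → ℝ, Integrable ψ P → semidual P Q φ ≤ semidual P Q ψ

/-- Condition A0: `φ` is a strictly convex and differentiable Brenier potential from `P` to `Q`. -/
structure CondA0 {d : ℕ} (P Q : Measure (Rd d)) (φ : Rd d → ℝ) : Prop where
  strictConvex : StrictConvexOn ℝ Set.univ φ
  differentiable : Differentiable ℝ φ
  minimizer : IsSemidualMinimizer P Q φ

/-- Condition A1(α): `φ` is convex, continuously differentiable and `α`-strongly convex. -/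
structure CondA1 {d : ℕ} (α : ℝ) (φ : Rd d → ℝ) : Prop where
  convex : ConvexOn ℝ Set.univ φ
  contDiff : ContDiff ℝ 1 φ
  lower : ∀ x y : Rd d, φ x + inner ℝ (∇ φ x) (y - x) + α / 2 * ‖y - x‖ ^ 2 ≤ φ y

/-- Condition A2(β): `φ` is convex, continuously differentiable and `β`-smooth. -/
structure CondA2 {d : ℕ} (β : ℝ) (φ : Rd d → ℝ) : Prop where
  convex : ConvexOn ℝ Set.univ φ
  contDiff : ContDiff ℝ 1 φ
  upper : ∀ x y : Rd d, φ y ≤ φ x + inner ℝ (∇ φ x) (y - x) + β / 2 * ‖y - x‖ ^ 2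

/-- The triples `(P, Q, φ)` under consideration: `P`, `Q` are probability measures on `ℝᵈ` with
`r`-th moments at most `M ^ r`, `P` has no atoms, and `φ` is a Brenier potential from `P` to `Q`
that satisfies A0, A1(α) and A2(β). -/
structure InModel {d : ℕ} (r M α β : ℝ) (P Q : Measure (Rd d)) (φ : Rd d → ℝ) : Prop where
  probP : IsProbabilityMeasure P
  probQ : IsProbabilityMeasure Q
  momentP : ∫⁻ x, ‖x‖ₑ ^ r ∂P ≤ ENNReal.ofReal (M ^ r)
  momentQ : ∫⁻ y, ‖y‖ₑ ^ r ∂Q ≤ ENNReal.ofReal (M ^ r)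
  nonatomic : ∀ x, P {x} = 0
  a0 : CondA0 P Q φ
  a1 : CondA1 α φ
  a2 : CondA2 β φ

/-- `X₁, …, Xₙ` are i.i.d. random vectors with law `P` on the probability space `(S, μ)`. -/
structure IsIIDSample {d n : ℕ} {S : Type*} [MeasurableSpace S] (μ : Measure S)
    (X : Fin n → S → Rd d) (P : Measure (Rd d)) : Prop where
  measurable : ∀ i, Measurable (X i)
  indep : iIndepFun X μ
  law : ∀ i, μ.map (X i) = P

/-- The risk `E ∫ ‖T x - T₀ x‖² dP(x)` of a random map `T`. -/
def risk {d : ℕ} {S : Type*} [MeasurableSpace S] (μ : Measure S) (P : Measure (Rd d))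
    (T : S → Rd d → Rd d) (T₀ : Rd d → Rd d) : ℝ≥0∞ :=
  ∫⁻ ω, ∫⁻ x, ‖T ω x - T₀ x‖ₑ ^ 2 ∂P ∂μ

/-- Matrices of couplings of the uniform weights on `n` and on `m` points. -/
structure IsCouplingMatrix {n m : ℕ} (p : Fin n → Fin m → ℝ) : Prop where
  nonneg : ∀ i j, 0 ≤ p i j
  row : ∀ i, ∑ j, p i j = 1 / (n : ℝ)
  col : ∀ j, ∑ i, p i j = 1 / (m : ℝ)

/-- The quadratic transport cost of a coupling matrix between the points `x i` and `y j`. -/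
def transportCost {d n m : ℕ} (x : Fin n → Rd d) (y : Fin m → Rd d)
    (p : Fin n → Fin m → ℝ) : ℝ :=
  ∑ i, ∑ j, p i j * ‖x i - y j‖ ^ 2

/-- `p` is an optimal coupling of the empirical measures of the points `x i` and `y j`. -/
structure IsOptimalCouplingMatrix {d n m : ℕ} (x : Fin n → Rd d) (y : Fin m → Rd d)
    (p : Fin n → Fin m → ℝ) : Prop where
  coupling : IsCouplingMatrix p
  optimal : ∀ q, IsCouplingMatrix q → transportCost x y p ≤ transportCost x y q

/-- The (closed) Voronoi cell of the `i`-th point. -/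
def voronoiCell {d n : ℕ} (x : Fin n → Rd d) (i : Fin n) : Set (Rd d) :=
  {z | ∀ j, ‖z - x i‖ ≤ ‖z - x j‖}

/-- `W` is a Voronoi partition for the points `x i`, up to `P`-null sets: each point of `W i` has
`x i` as a nearest neighbor, the sets do not overlap, and they cover the space. Ties between nearest
neighbors may be broken in any way; the closed Voronoi cells themselves are allowed if their
overlaps are `P`-null. -/
structure IsVoronoiPartition {d n : ℕ} (P : Measure (Rd d)) (x : Fin n → Rd d)
    (W : Fin n → Set (Rd d)) : Prop where
  subset : ∀ i, W i ⊆ voronoiCell x i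
  disjoint : ∀ i j, i ≠ j → P (W i ∩ W j) = 0
  cover : P (⋃ i, W i)ᶜ = 0

/-- The map `z ↦ ∑ i, ∑ j, (n p i j) 1(z ∈ W i) y j`. -/
def oneNNMap {d n m : ℕ} (p : Fin n → Fin m → ℝ) (W : Fin n → Set (Rd d)) (y : Fin m → Rd d)
    (z : Rd d) : Rd d :=
  ∑ i, ∑ j, (W i).indicator (fun _ => ((n : ℝ) * p i j) • y j) z

/-- The random map `T` is a one-nearest-neighbor plugin estimator for the samples `X`, `Y`: it comes
from a measurable choice of an optimal coupling of the two empirical measures and a measurable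
choice of a Voronoi partition. -/
def IsOneNNEstimator {d n m : ℕ} {S : Type*} [MeasurableSpace S] (μ : Measure S)
    (P : Measure (Rd d)) (X : Fin n → S → Rd d) (Y : Fin m → S → Rd d)
    (T : S → Rd d → Rd d) : Prop :=
  ∃ (p : S → Fin n → Fin m → ℝ) (W : S → Fin n → Set (Rd d)),
    Measurable p ∧
    (∀ i, MeasurableSet {q : S × Rd d | q.2 ∈ W q.1 i}) ∧
    (∀ᵐ ω ∂μ, IsOptimalCouplingMatrix (fun i => X i ω) (fun j => Y j ω) (p ω)) ∧
    (∀ᵐ ω ∂μ, IsVoronoiPartition P (fun i => X i ω) (W ω)) ∧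
    ∀ ω z, T ω z = oneNNMap (p ω) (W ω) (fun j => Y j ω) z

/-- The minimax risk for estimating `T₀ = ∇ φ` over the model, from independent samples of sizes
`n` from `P` and `m` from `Q`. The infimum is over all jointly measurable estimators. -/
def otMinimaxRisk (d n m : ℕ) (r M α β : ℝ) : ℝ≥0∞ :=
  ⨅ (T : (Fin n → Rd d) × (Fin m → Rd d) → Rd d → Rd d) (_ : Measurable (Function.uncurry T)),
    ⨆ (P : Measure (Rd d)) (Q : Measure (Rd d)) (φ : Rd d → ℝ) (_ : InModel r M α β P Q φ),
      risk ((Measure.pi fun _ : Fin n => P).prod (Measure.pi fun _ : Fin m => Q)) P T (∇ φ)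

/-- The rate `n^{-2/d} + m^{-2/d}`. -/
def otRate (d n m : ℕ) : ℝ :=
  (n : ℝ) ^ (-(2 : ℝ) / (d : ℝ)) + (m : ℝ) ^ (-(2 : ℝ) / (d : ℝ))

end

/-! Upper bound. Let `ψ` be the conjugate of `φ`. Strong convexity and smoothness squeeze the
Fenchel gap `φ u + ψ v - ⟨u, v⟩` between `‖∇φ u - v‖² / (2β)` and `‖∇φ u - v‖² / (2α)`. Over
couplings with fixed marginals the averaged gap is half the quadratic cost plus a constant, so an
optimal coupling also minimizes the gap. Hence its cost between the points `∇φ (X i)` and `Y j` is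
at most `β / α` times that of any other coupling (`stability_optimal_coupling`). Perturbing the
semi-dual problem shows that `∇φ` pushes `P` to `Q` (`InModel.map_gradient`). Both families of
points therefore have law `Q`, and it remains to couple two empirical measures of one law cheaply.
This is `exists_coupling_empirical`, by greedy matching through dyadic cubes inside dyadic shells;
`d > 4` makes the finest scale dominate and `r > 4` makes the shells summable.

The 1NN map carries the fit from the sample to `P`. On each cell the error splits into the error at
the sample point and `β` times the distance to that point (`lintegral_oneNNMap_le`). The first part
costs a factor `n` times the largest cell mass, which is `O(log n / n)` outside an event of
probability `O(n⁻⁴)` (`exists_voronoi_bound`); the logarithm in the rate comes from here. The second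
part is a nearest-neighbor distance, bounded by coupling the sample with an independent ghost sample
(`exists_nearestNeighbor_bound`).

Lower bound. Take `P` uniform on at least `2N` short separated segments, with one bit per segment
deciding whether `∇φ` adds a translation of order `N^{-1/d}` there. The potentials are a quadratic
plus disjoint bumps (`exists_segPotential`). The translation can be realized by moving only the
source segments or only the target segments, so that only one of the two samples depends on the
bits. With probability at least `1 / 2` that sample misses a given segment, and then its bit is
invisible. Assouad's argument (`assouad_bound`) gives `N^{-2/d}`, for `N = n` and for `N = m`. -/

/-! ### Convex analysis of the potential: Fenchel gap, stability, push-forward. -/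

section Convex

variable {d : ℕ} {α β : ℝ} {φ : Rd d → ℝ}

/-- Lower Fenchel–Young estimate: for a smooth function there is a competitor in the conjugate. -/
lemma CondA2.exists_conj_ge (h2 : CondA2 β φ) (hβ : 0 < β) (x y : Rd d) :
    ∃ z, ‖y - ∇ φ x‖ ^ 2 / (2 * β) ≤ φ x + (inner ℝ z y - φ z) - inner ℝ x y := by
  -- This point minimizes the quadratic upper model of `φ - ⟨·, y⟩` around `x`: a gradient step of
  -- length `1 / β`.
  refine ⟨x + β⁻¹ • (y - ∇ φ x), ?_⟩
  have h := h2.upper x (x + β⁻¹ • (y - ∇ φ x))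
  have e1 : x + β⁻¹ • (y - ∇ φ x) - x = β⁻¹ • (y - ∇ φ x) := by abel
  rw [e1, norm_smul, Real.norm_of_nonneg (by positivity), inner_smul_right] at h
  rw [inner_add_left, inner_smul_left]
  have e2 : ‖y - ∇ φ x‖ ^ 2 = inner ℝ (y - ∇ φ x) y - inner ℝ (∇ φ x) (y - ∇ φ x) := by
    rw [← real_inner_self_eq_norm_sq, real_inner_comm (y - ∇ φ x) (∇ φ x), ← inner_sub_right]
  have e3 : ‖y - ∇ φ x‖ ^ 2 / (2 * β) = β⁻¹ * ‖y - ∇ φ x‖ ^ 2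
      - β / 2 * (β⁻¹ * ‖y - ∇ φ x‖) ^ 2 := by
    field_simp; ring
  rw [e3]
  simp only [conj_trivial]
  have e4 : β⁻¹ * ‖y - ∇ φ x‖ ^ 2
      = β⁻¹ * inner ℝ (y - ∇ φ x) y - β⁻¹ * inner ℝ (∇ φ x) (y - ∇ φ x) := by rw [e2]; ring
  linarith

/-- After inserting the strongly convex minorant at `x`, only `⟨z - x, y - ∇φ x⟩ - α/2 ‖z - x‖²` is
left, and Young's inequality bounds it uniformly in `z`. -/
lemma CondA1.conj_le (h1 : CondA1 α φ) (hα : 0 < α) (x y z : Rd d) :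
    φ x + (inner ℝ z y - φ z) - inner ℝ x y ≤ ‖y - ∇ φ x‖ ^ 2 / (2 * α) := by
  have h := h1.lower x z
  have h3 : inner ℝ (z - x) (y - ∇ φ x) ≤ ‖z - x‖ * ‖y - ∇ φ x‖ := real_inner_le_norm _ _
  have e : inner ℝ (z - x) (y - ∇ φ x)
      = inner ℝ z y - inner ℝ x y - inner ℝ (∇ φ x) (z - x) := by
    rw [inner_sub_right, inner_sub_left, real_inner_comm (∇ φ x)]
  have h4 : ‖z - x‖ * ‖y - ∇ φ x‖ ≤ α / 2 * ‖z - x‖ ^ 2 + ‖y - ∇ φ x‖ ^ 2 / (2 * α) := by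
    have : α / 2 * ‖z - x‖ ^ 2 + ‖y - ∇ φ x‖ ^ 2 / (2 * α) - ‖z - x‖ * ‖y - ∇ φ x‖
      = (α * ‖z - x‖ - ‖y - ∇ φ x‖) ^ 2 / (2 * α) := by field_simp; ring
    have h5 : 0 ≤ (α * ‖z - x‖ - ‖y - ∇ φ x‖) ^ 2 / (2 * α) := by positivity
    linarith
  linarith

/-- Combining a gradient step at one point with convexity at the other gives co-coercivity; summing
both orders and using Cauchy–Schwarz gives the Lipschitz bound. -/
lemma CondA2.norm_gradient_sub_le (h2 : CondA2 β φ) (hβ : 0 < β) (h1 : CondA1 α φ) (hα : 0 < α)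
    (x y : Rd d) : ‖∇ φ x - ∇ φ y‖ ≤ β * ‖x - y‖ := by
  -- co-coercivity of the gradient
  have key : ∀ x y : Rd d, φ x + inner ℝ (∇ φ x) (y - x) + ‖∇ φ x - ∇ φ y‖ ^ 2 / (2 * β) ≤ φ y := by
    intro x y
    obtain ⟨z, hz⟩ := h2.exists_conj_ge hβ y (∇ φ x)
    have h := h1.lower x z
    have h' : 0 ≤ α / 2 * ‖z - x‖ ^ 2 := by positivity
    rw [real_inner_comm, real_inner_comm _ y] at hz
    rw [inner_sub_right] at h ⊢
    linarith
  have k1 := key x y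
  have k2 := key y x
  have e : inner ℝ (∇ φ x) (y - x) + inner ℝ (∇ φ y) (x - y) = - inner ℝ (∇ φ x - ∇ φ y) (x - y) := by
    simp only [inner_sub_left, inner_sub_right]; ring
  have h3 : inner ℝ (∇ φ x - ∇ φ y) (x - y) ≤ ‖∇ φ x - ∇ φ y‖ * ‖x - y‖ := real_inner_le_norm _ _
  rw [norm_sub_rev (∇ φ y)] at k2
  have h4 : ‖∇ φ x - ∇ φ y‖ ^ 2 / β ≤ ‖∇ φ x - ∇ φ y‖ * ‖x - y‖ := by
    have : ‖∇ φ x - ∇ φ y‖ ^ 2 / β = 2 * (‖∇ φ x - ∇ φ y‖ ^ 2 / (2 * β)) := by field_simp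
    linarith
  rw [div_le_iff₀ hβ] at h4
  by_contra! hc
  have hp : 0 < ‖∇ φ x - ∇ φ y‖ := lt_of_le_of_lt (by positivity) hc
  nlinarith [mul_lt_mul_of_pos_left hc hp]

/-- Strong monotonicity of the gradient plus Cauchy–Schwarz. It makes a right inverse of the
gradient `α⁻¹`-Lipschitz. -/
lemma CondA1.mul_norm_sub_le (h1 : CondA1 α φ) (x y : Rd d) :
    α * ‖x - y‖ ≤ ‖∇ φ x - ∇ φ y‖ := by
  have k1 := h1.lower x y
  have k2 := h1.lower y x
  have e : inner ℝ (∇ φ x) (y - x) + inner ℝ (∇ φ y) (x - y) = - inner ℝ (∇ φ x - ∇ φ y) (x - y) := by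
    simp only [inner_sub_left, inner_sub_right]; ring
  have h3 : inner ℝ (∇ φ x - ∇ φ y) (x - y) ≤ ‖∇ φ x - ∇ φ y‖ * ‖x - y‖ := real_inner_le_norm _ _
  rw [norm_sub_rev y] at k1
  by_contra! hc
  have hp : 0 < ‖x - y‖ := by
    by_contra! h0
    have : ‖x - y‖ = 0 := le_antisymm h0 (norm_nonneg _)
    rw [this, mul_zero] at hc
    exact absurd hc (not_lt.2 (norm_nonneg _))
  nlinarith [mul_lt_mul_of_pos_right hc hp]

/-- Strong convexity makes `φ - ⟨y, ·⟩` coercive, so it has a minimizer, and there the gradient of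
`φ` is `y`. -/
lemma CondA1.exists_rightInverse (h1 : CondA1 α φ) (hα : 0 < α) :
    ∃ S : Rd d → Rd d, ∀ y, ∇ φ (S y) = y := by
  suffices h : ∀ y, ∃ x, ∇ φ x = y by choose S hS using h; exact ⟨S, hS⟩
  intro y
  have hd : Differentiable ℝ φ := h1.contDiff.differentiable (by norm_num)
  set f : Rd d → ℝ := fun z => φ z - inner ℝ y z with hf
  have hfc : Continuous f := by
    have := hd.continuous
    fun_prop
  have hev : ∀ᶠ z in Filter.cocompact (Rd d), f 0 ≤ f z := by
    set R := 2 / α * ‖y - ∇ φ 0‖ with hR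
    have : ∀ᶠ z in Filter.cocompact (Rd d), z ∉ Metric.closedBall (0 : Rd d) R :=
      (isCompact_closedBall (0 : Rd d) R).compl_mem_cocompact
    filter_upwards [this] with z hz
    simp only [Metric.mem_closedBall, dist_zero_right, not_le] at hz
    have h := h1.lower 0 z
    simp only [sub_zero] at h
    have h3 : inner ℝ (y - ∇ φ 0) z ≤ ‖y - ∇ φ 0‖ * ‖z‖ := real_inner_le_norm _ _
    rw [inner_sub_left] at h3
    have h4 : ‖y - ∇ φ 0‖ ≤ α / 2 * ‖z‖ := by
      have : ‖y - ∇ φ 0‖ = α / 2 * R := by rw [hR]; field_simp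
      rw [this]; gcongr
    have h5 : ‖y - ∇ φ 0‖ * ‖z‖ ≤ α / 2 * ‖z‖ * ‖z‖ := by gcongr
    simp only [hf, inner_zero_right, sub_zero]
    nlinarith
  obtain ⟨x, hx⟩ := hfc.exists_forall_le' 0 hev
  refine ⟨x, ?_⟩
  have hg : HasFDerivAt f (fderiv ℝ φ x - innerSL ℝ y) x :=
    (hd x).hasFDerivAt.sub (innerSL ℝ y).hasFDerivAt
  have hmin : IsLocalMin f x := Filter.Eventually.of_forall hx
  have h0 := hmin.hasFDerivAt_eq_zero hg
  refine ext_inner_right ℝ fun v => ?_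
  rw [inner_gradient_left]
  have := congrArg (fun L => L v) h0
  simp at this
  linarith

/-- Stability of optimal couplings around a Brenier potential. -/
lemma stability_optimal_coupling {n m : ℕ} (h1 : CondA1 α φ) (h2 : CondA2 β φ) (hα : 0 < α)
    (hβ : 0 < β) (x : Fin n → Rd d) (y : Fin m → Rd d) {p q : Fin n → Fin m → ℝ}
    (hp : IsOptimalCouplingMatrix x y p) (hq : IsCouplingMatrix q) :
    transportCost (fun i => ∇ φ (x i)) y p ≤
      β / α * transportCost (fun i => ∇ φ (x i)) y q := by
  obtain ⟨S, hS⟩ := h1.exists_rightInverse hα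
  -- The conjugate in closed form: its supremum is attained at `S y`, where the gradient is `y`.
  set ψ : Rd d → ℝ := fun y => inner ℝ (S y) y - φ (S y) with hψ
  have hup : ∀ u v, φ u + ψ v - inner ℝ u v ≤ ‖∇ φ u - v‖ ^ 2 / (2 * α) := fun u v => by
    rw [norm_sub_rev]; exact h1.conj_le hα u v (S v)
  have hlo : ∀ u v, ‖∇ φ u - v‖ ^ 2 / (2 * β) ≤ φ u + ψ v - inner ℝ u v := fun u v => by
    obtain ⟨z, hz⟩ := h2.exists_conj_ge hβ u v
    have h3 := h1.lower (S v) z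
    rw [hS, inner_sub_right] at h3
    rw [norm_sub_rev]
    have h4 : 0 ≤ α / 2 * ‖z - S v‖ ^ 2 := by positivity
    simp only [hψ]
    rw [real_inner_comm] at hz
    rw [real_inner_comm _ (S v)]
    linarith
  -- the cost differs from the negative correlation by terms which only depend on the marginals
  have marg : ∀ (c : Fin n → ℝ) (e : Fin m → ℝ) {q : Fin n → Fin m → ℝ}, IsCouplingMatrix q →
      ∑ i, ∑ j, q i j * (c i + e j) = (∑ i, 1 / (n : ℝ) * c i) + ∑ j, 1 / (m : ℝ) * e j := by
    intro c e q hq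
    simp only [mul_add, Finset.sum_add_distrib]
    congr 1
    · exact Finset.sum_congr rfl fun i _ => by rw [← Finset.sum_mul, hq.row]
    · rw [Finset.sum_comm]
      exact Finset.sum_congr rfl fun i _ => by rw [← Finset.sum_mul, hq.col]
  -- The averaged Fenchel gap. By `marg` it is half the transport cost up to a constant, so
  -- optimality of `p` passes to `F`.
  set F : (Fin n → Fin m → ℝ) → ℝ := fun q =>
    ∑ i, ∑ j, q i j * (φ (x i) + ψ (y j) - inner ℝ (x i) (y j)) with hF
  have hFc : ∀ q, IsCouplingMatrix q → F q = 1 / 2 * transportCost x y q +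
      ((∑ i, 1 / (n : ℝ) * (φ (x i) - ‖x i‖ ^ 2 / 2)) +
        ∑ j, 1 / (m : ℝ) * (ψ (y j) - ‖y j‖ ^ 2 / 2)) := by
    intro q hq
    rw [← marg _ _ hq, transportCost, Finset.mul_sum, ← Finset.sum_add_distrib]
    refine Finset.sum_congr rfl fun i _ => ?_
    rw [Finset.mul_sum, ← Finset.sum_add_distrib]
    refine Finset.sum_congr rfl fun j _ => ?_
    rw [norm_sub_sq_real]; ring
  have hFle : F p ≤ F q := by
    rw [hFc p hp.coupling, hFc q hq]
    have := hp.optimal q hq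
    linarith
  have e1 : transportCost (fun i => ∇ φ (x i)) y p ≤ 2 * β * F p := by
    rw [transportCost, hF, Finset.mul_sum]
    refine Finset.sum_le_sum fun i _ => ?_
    rw [Finset.mul_sum]
    refine Finset.sum_le_sum fun j _ => ?_
    have h := hlo (x i) (y j)
    rw [div_le_iff₀ (by positivity)] at h
    have := mul_le_mul_of_nonneg_left h (hp.coupling.nonneg i j)
    linarith
  have e2 : 2 * α * F q ≤ transportCost (fun i => ∇ φ (x i)) y q := by
    rw [transportCost, hF, Finset.mul_sum]
    refine Finset.sum_le_sum fun i _ => ?_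
    rw [Finset.mul_sum]
    refine Finset.sum_le_sum fun j _ => ?_
    have h := hup (x i) (y j)
    rw [le_div_iff₀ (by positivity)] at h
    have := mul_le_mul_of_nonneg_left h (hq.nonneg i j)
    linarith
  calc _ ≤ 2 * β * F p := e1
    _ ≤ 2 * β * F q := by gcongr
    _ = β / α * (2 * α * F q) := by field_simp
    _ ≤ _ := by gcongr

/-- If the differences of integrals of Lipschitz functions are quadratically small, the measures
agree. -/
lemma probabilityMeasure_eq_of_integral_sub_le_sq {μ ν : Measure (Rd d)} [IsProbabilityMeasure μ]
    [IsProbabilityMeasure ν] (c : ℝ)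
    (h : ∀ (f : Rd d → ℝ) (L : NNReal), (∃ C, ∀ x y, dist (f x) (f y) ≤ C) → LipschitzWith L f →
      ∫ x, f x ∂μ - ∫ x, f x ∂ν ≤ c * L ^ 2) : μ = ν := by
  have key : ∀ (f : Rd d → ℝ), (∃ C, ∀ x y, dist (f x) (f y) ≤ C) → (∃ L, LipschitzWith L f) →
      ∫ x, f x ∂μ ≤ ∫ x, f x ∂ν := by
    rintro f ⟨C, hC⟩ ⟨L, hL⟩
    -- Apply the hypothesis to `ε * f`: the left side scales like `ε`, the right side like `ε²`.
    -- Divide by `ε` and let it tend to zero.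
    have h1 : ∀ ε : ℝ, 0 < ε → ∫ x, f x ∂μ - ∫ x, f x ∂ν ≤ ε * (c * L ^ 2) := by
      intro ε hε
      have h2 := h (fun x => ε * f x) (Real.toNNReal ε * L) ⟨ε * C, fun x y => by
        rw [Real.dist_eq, ← mul_sub, abs_mul, abs_of_pos hε, ← Real.dist_eq]
        exact mul_le_mul_of_nonneg_left (hC x y) hε.le⟩ (by
          refine LipschitzWith.of_dist_le_mul fun x y => ?_
          rw [Real.dist_eq, ← mul_sub, abs_mul, abs_of_pos hε, ← Real.dist_eq]
          have := mul_le_mul_of_nonneg_left (hL.dist_le_mul x y) hε.le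
          rw [NNReal.coe_mul, Real.coe_toNNReal _ hε.le]
          linarith)
      rw [integral_const_mul, integral_const_mul, ← mul_sub] at h2
      have h3 : c * ((Real.toNNReal ε * L : NNReal) : ℝ) ^ 2 = ε * (ε * (c * L ^ 2)) := by
        rw [NNReal.coe_mul, Real.coe_toNNReal _ hε.le]; ring
      rw [h3] at h2
      exact le_of_mul_le_mul_left h2 hε
    have hlim : Filter.Tendsto (fun ε : ℝ => ε * (c * L ^ 2)) (nhdsWithin 0 (Set.Ioi 0))
        (nhds (0 * (c * L ^ 2))) :=
      ((continuous_id.mul continuous_const).tendsto 0).mono_left nhdsWithin_le_nhds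
    have := ge_of_tendsto hlim (eventually_nhdsWithin_of_forall fun ε hε => h1 ε hε)
    linarith
  let μ' : ProbabilityMeasure (Rd d) := ⟨μ, ‹_›⟩
  let ν' : ProbabilityMeasure (Rd d) := ⟨ν, ‹_›⟩
  have e : μ' = ν' := by
    refine tendsto_nhds_unique (f := fun _ : ℕ => μ') (l := Filter.atTop) tendsto_const_nhds ?_
    rw [tendsto_iff_forall_lipschitz_integral_tendsto]
    rintro f ⟨C, hC⟩ ⟨L, hL⟩
    have : ∫ x, f x ∂μ = ∫ x, f x ∂ν := by
      refine le_antisymm (key f ⟨C, hC⟩ ⟨L, hL⟩) ?_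
      have := key (fun x => -f x) ⟨C, fun x y => by rw [dist_neg_neg]; exact hC x y⟩ ⟨L, hL.neg⟩
      rw [integral_neg, integral_neg] at this
      linarith
    change Filter.Tendsto (fun _ : ℕ => ∫ x, f x ∂μ) Filter.atTop (nhds (∫ x, f x ∂ν))
    rw [this]
    exact tendsto_const_nhds
  exact congrArg Subtype.val e

lemma extIntegral_mono {μ : Measure (Rd d)} {f g : Rd d → EReal} (h : ∀ x, f x ≤ g x) :
    extIntegral μ f ≤ extIntegral μ g := by
  refine EReal.sub_le_sub ?_ ?_
  · exact EReal.coe_ennreal_le_coe_ennreal_iff.2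
      (lintegral_mono fun x => EReal.toENNReal_le_toENNReal (h x))
  · exact EReal.coe_ennreal_le_coe_ennreal_iff.2
      (lintegral_mono fun x => EReal.toENNReal_le_toENNReal (EReal.neg_le_neg_iff.2 (h x)))

lemma extIntegral_coe {μ : Measure (Rd d)} {f : Rd d → ℝ} (hf : Integrable f μ) :
    extIntegral μ (fun x => (f x : EReal)) = ((∫ x, f x ∂μ : ℝ) : EReal) := by
  have e1 : ∀ x, ((f x : ℝ) : EReal).toENNReal = ENNReal.ofReal (f x) := fun x => by
    simp [EReal.toENNReal_of_ne_top]
  have e2 : ∀ x, (-((f x : ℝ) : EReal)).toENNReal = ENNReal.ofReal (-f x) := fun x => by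
    rw [← EReal.coe_neg]; simp [EReal.toENNReal_of_ne_top]
  rw [extIntegral, integral_eq_lintegral_pos_part_sub_lintegral_neg_part hf]
  simp only [e1, e2]
  have h1 : ∫⁻ x, ENNReal.ofReal (f x) ∂μ ≠ ⊤ :=
    (lt_of_le_of_lt (lintegral_mono fun x => Real.ofReal_le_enorm _) hf.2).ne
  have h2 : ∫⁻ x, ENNReal.ofReal (-f x) ∂μ ≠ ⊤ :=
    (lt_of_le_of_lt (lintegral_mono fun x => Real.ofReal_le_enorm _) hf.neg.2).ne
  rw [EReal.coe_sub, EReal.coe_ennreal_toReal h1, EReal.coe_ennreal_toReal h2]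

end Convex

lemma lintegral_enorm_rpow_le {d : ℕ} {P : Measure (Rd d)} [IsProbabilityMeasure P] {r s M : ℝ}
    (hs : 0 ≤ s) (hsr : s ≤ r) (hm : ∫⁻ x, ‖x‖ₑ ^ r ∂P ≤ ENNReal.ofReal (M ^ r)) :
    ∫⁻ x, ‖x‖ₑ ^ s ∂P ≤ 1 + ENNReal.ofReal (M ^ r) := by
  calc ∫⁻ x, ‖x‖ₑ ^ s ∂P ≤ ∫⁻ x, (1 + ‖x‖ₑ ^ r) ∂P := by
        refine lintegral_mono fun x => ?_
        rcases le_total ‖x‖ₑ 1 with h | h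
        · exact (ENNReal.rpow_le_one h hs).trans le_self_add
        · exact (ENNReal.rpow_le_rpow_of_exponent_le h hsr).trans le_add_self
    _ = 1 + ∫⁻ x, ‖x‖ₑ ^ r ∂P := by
        rw [lintegral_add_left measurable_const]; simp
    _ ≤ _ := by gcongr

/-- The gradient of a Brenier potential pushes `P` forward to `Q`. -/
lemma InModel.map_gradient {d : ℕ} {r M α β : ℝ} {P Q : Measure (Rd d)} {φ : Rd d → ℝ}
    (h : InModel r M α β P Q φ) (hr : 4 < r) (hα : 0 < α) (hβ : 0 < β) :
    P.map (∇ φ) = Q := by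
  have := h.probP
  have := h.probQ
  obtain ⟨S, hS⟩ := h.a1.exists_rightInverse hα
  have hlip : LipschitzWith (Real.toNNReal β) (∇ φ) := LipschitzWith.of_dist_le_mul fun x y => by
    rw [dist_eq_norm, dist_eq_norm, Real.coe_toNNReal _ hβ.le]
    exact h.a2.norm_gradient_sub_le hβ h.a1 hα x y
  have hSlip : LipschitzWith (Real.toNNReal α⁻¹) S := LipschitzWith.of_dist_le_mul fun x y => by
    rw [dist_eq_norm, dist_eq_norm, Real.coe_toNNReal _ (by positivity)]
    have := h.a1.mul_norm_sub_le (S x) (S y)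
    rw [hS, hS] at this
    rwa [inv_mul_eq_div, le_div_iff₀' hα]
  have hφc : Continuous φ := h.a1.contDiff.continuous
  set ψ : Rd d → ℝ := fun y => inner ℝ (S y) y - φ (S y) with hψ
  have hψc : Continuous ψ := by
    have := hSlip.continuous
    fun_prop
  have hquad : ∀ z y, inner ℝ z y - φ z ≤ ψ y - α / 2 * ‖z - S y‖ ^ 2 := fun z y => by
    have h3 := h.a1.lower (S y) z
    rw [hS, inner_sub_right] at h3
    simp only [hψ]
    rw [real_inner_comm _ (S y), real_inner_comm _ z]
    linarith
  have hconj : ∀ y, fenchelConj φ y = (ψ y : EReal) := fun y => by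
    refine le_antisymm (iSup_le fun z => ?_) (le_iSup_of_le (S y) le_rfl)
    refine EReal.coe_le_coe_iff.2 ((hquad z y).trans ?_)
    have : 0 ≤ α / 2 * ‖z - S y‖ ^ 2 := by positivity
    linarith
  have hint2 : Integrable (fun y : Rd d => ‖y‖ ^ 2) Q := by
    refine ⟨by fun_prop, ?_⟩
    have := lintegral_enorm_rpow_le (s := 2) (by norm_num) (by linarith) h.momentQ
    refine lt_of_le_of_lt ?_ (lt_of_le_of_lt this (by simp))
    refine lintegral_mono fun x => ?_
    simp
  have hψi : Integrable ψ Q := by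
    refine Integrable.mono' (g := fun y => |φ 0| + (‖y‖ ^ 2 + ‖∇ φ 0‖ ^ 2) / α) ?_
      hψc.aestronglyMeasurable (Filter.Eventually.of_forall fun y => ?_)
    · exact (integrable_const _).add ((hint2.add (integrable_const _)).div_const _)
    · have h1 := h.a1.conj_le hα 0 y (S y)
      have h2 := hquad 0 y
      have h3 : 0 ≤ α / 2 * ‖0 - S y‖ ^ 2 := by positivity
      simp only [inner_zero_left, sub_zero, zero_sub] at h1 h2 h3
      have h4 : ‖y - ∇ φ 0‖ ^ 2 / (2 * α) ≤ (‖y‖ ^ 2 + ‖∇ φ 0‖ ^ 2) / α := by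
        rw [div_le_div_iff₀ (by positivity) hα]
        have h5 : ‖y - ∇ φ 0‖ ≤ ‖y‖ + ‖∇ φ 0‖ := norm_sub_le _ _
        have h6 : ‖y - ∇ φ 0‖ ^ 2 ≤ (‖y‖ + ‖∇ φ 0‖) ^ 2 := by gcongr
        have : ‖y - ∇ φ 0‖ ^ 2 ≤ 2 * (‖y‖ ^ 2 + ‖∇ φ 0‖ ^ 2) := by
          nlinarith [sq_nonneg (‖y‖ - ‖∇ φ 0‖)]
        nlinarith
      have h7 : 0 ≤ (‖y‖ ^ 2 + ‖∇ φ 0‖ ^ 2) / α := by positivity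
      rw [Real.norm_eq_abs, abs_le]
      constructor <;> cases abs_cases (φ 0) <;> simp only [hψ] at * <;> linarith
  -- First-order optimality with a quantitative remainder. Adding an `L`-Lipschitz `f` to `φ`
  -- changes the conjugate at `y` by at most `-f (S y) + L² / (2α)`, since strong convexity keeps
  -- competitors near `S y`. Minimality then bounds `∫ f ∘ S dQ - ∫ f dP` by `L² / (2α)`.
  have hmap : Q.map S = P := by
    have : IsProbabilityMeasure (Q.map S) := Measure.isProbabilityMeasure_map hSlip.continuous.aemeasurable
    refine probabilityMeasure_eq_of_integral_sub_le_sq (1 / (2 * α)) ?_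
    rintro f L ⟨C, hC⟩ hL
    have hfc := hL.continuous
    have hbd : ∀ x, ‖f x‖ ≤ ‖f 0‖ + C := fun x => by
      have := hC x 0
      rw [dist_eq_norm] at this
      have h2 := norm_sub_norm_le (f x) (f 0)
      linarith
    have hfP : Integrable f P :=
      Integrable.of_bound hfc.aestronglyMeasurable (‖f 0‖ + C) (Filter.Eventually.of_forall hbd)
    have hfQ : Integrable (fun y => f (S y)) Q :=
      Integrable.of_bound (hfc.comp hSlip.continuous).aestronglyMeasurable (‖f 0‖ + C)
        (Filter.Eventually.of_forall fun y => hbd _)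
    have hle := h.a0.minimizer.le (fun x => φ x + f x) (h.a0.minimizer.integrable.add hfP)
    have hc2 : ∀ y, fenchelConj (fun x => φ x + f x) y ≤
        ((ψ y - f (S y) + 1 / (2 * α) * L ^ 2 : ℝ) : EReal) := fun y => by
      refine iSup_le fun z => EReal.coe_le_coe_iff.2 ?_
      have h1 := hquad z y
      have h2 := hL.dist_le_mul (S y) z
      rw [Real.dist_eq, dist_eq_norm, norm_sub_rev] at h2
      have h3 := le_abs_self (f (S y) - f z)
      have h4 : L * ‖z - S y‖ ≤ α / 2 * ‖z - S y‖ ^ 2 + 1 / (2 * α) * L ^ 2 := by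
        have : α / 2 * ‖z - S y‖ ^ 2 + 1 / (2 * α) * L ^ 2 - L * ‖z - S y‖
          = (α * ‖z - S y‖ - L) ^ 2 / (2 * α) := by field_simp; ring
        have h5 : 0 ≤ (α * ‖z - S y‖ - L) ^ 2 / (2 * α) := by positivity
        linarith
      linarith
    have hint : Integrable (fun y => ψ y - f (S y) + 1 / (2 * α) * (L : ℝ) ^ 2) Q :=
      (hψi.sub hfQ).add (integrable_const _)
    have hle2 := hle.trans (add_le_add_right (extIntegral_mono hc2) _)
    rw [extIntegral_coe hint, semidual, show fenchelConj φ = fun y => (ψ y : EReal) from funext hconj,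
      extIntegral_coe hψi, ← EReal.coe_add, ← EReal.coe_add, EReal.coe_le_coe_iff,
      integral_add h.a0.minimizer.integrable hfP,
      integral_add (f := fun y => ψ y - f (S y)) (hψi.sub hfQ) (integrable_const _),
      integral_sub hψi hfQ] at hle2
    rw [integral_map hSlip.continuous.aemeasurable hfc.aestronglyMeasurable]
    simp only [integral_const, probReal_univ, one_smul] at hle2
    linarith
  rw [← hmap, Measure.map_map hlip.continuous.measurable hSlip.continuous.measurable,
    show ∇ φ ∘ S = id from funext hS, Measure.map_id]

/-! ### Greedy multi-scale matching of finite measures. -/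

section Matching

variable {ι κ Λ : Type*} [Fintype ι] [Fintype κ] [DecidableEq Λ]

/-- Matching as much mass as possible between points with the same label. -/
lemma exists_matching_step (a : ι → ℝ) (b : κ → ℝ) (ha : ∀ i, 0 ≤ a i) (hb : ∀ j, 0 ≤ b j)
    (l : ι → Λ) (l' : κ → Λ) :
    ∃ γ : ι → κ → ℝ, (∀ i j, 0 ≤ γ i j) ∧ (∀ i j, l i ≠ l' j → γ i j = 0) ∧
      (∀ i, ∑ j, γ i j ≤ a i) ∧ (∀ j, ∑ i, γ i j ≤ b j) ∧
      (∀ A, ∑ i with l i = A, (a i - ∑ j, γ i j) =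
        max 0 (∑ i with l i = A, a i - ∑ j with l' j = A, b j)) ∧
      (∀ A, ∑ j with l' j = A, (b j - ∑ i, γ i j) =
        max 0 (∑ j with l' j = A, b j - ∑ i with l i = A, a i)) := by
  set p : Λ → ℝ := fun A => ∑ i with l i = A, a i with hp
  set q : Λ → ℝ := fun A => ∑ j with l' j = A, b j with hq
  have hp0 : ∀ A, 0 ≤ p A := fun A => Finset.sum_nonneg fun i _ => ha i
  have hq0 : ∀ A, 0 ≤ q A := fun A => Finset.sum_nonneg fun i _ => hb i
  have hrow : ∀ i, ∑ j, (if l i = l' j then a i * b j / max (p (l i)) (q (l i)) else 0)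
      = a i * (q (l i) / max (p (l i)) (q (l i))) := fun i => by
    rw [← Finset.sum_filter, ← Finset.sum_div, ← Finset.mul_sum, mul_div_assoc]
    simp only [hq, eq_comm]
  have hcol : ∀ j, ∑ i, (if l i = l' j then a i * b j / max (p (l i)) (q (l i)) else 0)
      = b j * (p (l' j) / max (p (l' j)) (q (l' j))) := fun j => by
    rw [← Finset.sum_filter]
    rw [Finset.sum_congr rfl (g := fun i => b j * (a i / max (p (l' j)) (q (l' j)))) fun i hi => by
      rw [(Finset.mem_filter.1 hi).2]; ring, ← Finset.mul_sum, ← Finset.sum_div]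
  have hle : ∀ A, q A / max (p A) (q A) ≤ 1 := fun A =>
    div_le_one_of_le₀ (le_max_right _ _) (le_max_of_le_left (hp0 A))
  have hle' : ∀ A, p A / max (p A) (q A) ≤ 1 := fun A =>
    div_le_one_of_le₀ (le_max_left _ _) (le_max_of_le_left (hp0 A))
  have aux : ∀ x y : ℝ, 0 ≤ x → 0 ≤ y → x - x * (y / max x y) = max 0 (x - y) := by
    intro x y hx hy
    rcases le_total x y with h | h
    · rw [max_eq_right h, max_eq_left (by linarith)]
      rcases hy.eq_or_lt with h0 | h0
      · have : x = 0 := le_antisymm (h0 ▸ h) hx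
        simp [this]
      · field_simp; ring
    · rw [max_eq_left h, max_eq_right (by linarith)]
      rcases hx.eq_or_lt with h0 | h0
      · have : y = 0 := le_antisymm (h0 ▸ h) hy
        simp [this]
      · field_simp
  -- Inside each label, a product measure normalized by the larger of the two masses; it exhausts
  -- the lighter side. If both masses vanish, division by zero gives the correct value `0`.
  refine ⟨fun i j => if l i = l' j then a i * b j / max (p (l i)) (q (l i)) else 0,
    fun i j => ?_, fun i j h => if_neg h, fun i => ?_, fun j => ?_, fun A => ?_, fun A => ?_⟩
  · dsimp only
    split_ifs
    · exact div_nonneg (mul_nonneg (ha i) (hb j)) (le_max_of_le_left (hp0 _))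
    · exact le_rfl
  · dsimp only; rw [hrow]; exact mul_le_of_le_one_right (ha i) (hle _)
  · dsimp only; rw [hcol]; exact mul_le_of_le_one_right (hb j) (hle' _)
  · rw [← aux _ _ (hp0 A) (hq0 A), Finset.sum_sub_distrib]
    congr 1
    rw [hp, Finset.sum_mul]
    exact Finset.sum_congr rfl fun i hi => by rw [hrow, (Finset.mem_filter.1 hi).2]
  · rw [← aux _ _ (hq0 A) (hp0 A), Finset.sum_sub_distrib]
    congr 1
    rw [hq, Finset.sum_mul]
    exact Finset.sum_congr rfl fun i hi => by rw [hcol, (Finset.mem_filter.1 hi).2, max_comm]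

/-- Greedy matching from the finest to the `K`-th level of a nested family of labels. -/
lemma exists_multiscale_matching (a : ι → ℝ) (b : κ → ℝ) (ha : ∀ i, 0 ≤ a i) (hb : ∀ j, 0 ≤ b j)
    (c : ℕ → ι → Λ) (c' : ℕ → κ → Λ) (g : ℕ → Λ → Λ) (hc : ∀ k i, c (k + 1) i = g k (c k i))
    (hc' : ∀ k i, c' (k + 1) i = g k (c' k i)) (W : Λ → ℝ) (hW0 : ∀ A, 0 ≤ W A)
    (hW : ∀ k A, W (g k A) = W A) (D : ℕ → ℝ) (hD : ∀ k, 0 ≤ D k) (cost : ι → κ → ℝ)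
    (hcost : ∀ k i j, c k i = c' k j → cost i j ≤ W (c k i) * D k) (𝒜 : ℕ → Finset Λ)
    (h𝒜 : ∀ k i, c k i ∈ 𝒜 k) (K : ℕ) :
    ∃ γ : ι → κ → ℝ, (∀ i j, 0 ≤ γ i j) ∧ (∀ i j, c K i ≠ c' K j → γ i j = 0) ∧
      (∀ i, ∑ j, γ i j ≤ a i) ∧ (∀ j, ∑ i, γ i j ≤ b j) ∧
      (∀ A, ∑ i with c K i = A, (a i - ∑ j, γ i j) =
        max 0 (∑ i with c K i = A, a i - ∑ j with c' K j = A, b j)) ∧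
      (∀ A, ∑ j with c' K j = A, (b j - ∑ i, γ i j) =
        max 0 (∑ j with c' K j = A, b j - ∑ i with c K i = A, a i)) ∧
      ∑ i, ∑ j, γ i j * cost i j ≤ D 0 * ∑ i, W (c 0 i) * a i +
        ∑ k ∈ Finset.range K, D (k + 1) * ∑ A ∈ 𝒜 k,
          W A * |∑ i with c k i = A, a i - ∑ j with c' k j = A, b j| := by
  have stepcost : ∀ (k : ℕ) (a' : ι → ℝ) (δ : ι → κ → ℝ), (∀ i j, 0 ≤ δ i j) →
      (∀ i j, c k i ≠ c' k j → δ i j = 0) → (∀ i, ∑ j, δ i j ≤ a' i) →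
      ∑ i, ∑ j, δ i j * cost i j ≤ D k * ∑ i, W (c k i) * a' i := by
    intro k a' δ hδ0 hδ hδa
    rw [Finset.mul_sum]
    refine Finset.sum_le_sum fun i _ => ?_
    calc ∑ j, δ i j * cost i j ≤ ∑ j, δ i j * (W (c k i) * D k) := by
          refine Finset.sum_le_sum fun j _ => ?_
          by_cases h : c k i = c' k j
          · exact mul_le_mul_of_nonneg_left (hcost k i j h) (hδ0 i j)
          · rw [hδ i j h]; simp
      _ = (∑ j, δ i j) * (W (c k i) * D k) := by rw [Finset.sum_mul]
      _ ≤ a' i * (W (c k i) * D k) := by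
          exact mul_le_mul_of_nonneg_right (hδa i) (mul_nonneg (hW0 _) (hD _))
      _ = _ := by ring
  induction K with
  | zero =>
    obtain ⟨γ, h0, h1, h2, h3, h4, h5⟩ := exists_matching_step a b ha hb (c 0) (c' 0)
    exact ⟨γ, h0, h1, h2, h3, h4, h5, by simpa using stepcost 0 a γ h0 h1 h2⟩
  | succ K ih =>
    obtain ⟨γ, h0, h1, h2, h3, h4, h5, h6⟩ := ih
    obtain ⟨δ, e0, e1, e2, e3, e4, e5⟩ := exists_matching_step (fun i => a i - ∑ j, γ i j)
      (fun j => b j - ∑ i, γ i j) (fun i => sub_nonneg.2 (h2 i)) (fun j => sub_nonneg.2 (h3 j))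
      (c (K + 1)) (c' (K + 1))
    have hnest : ∀ i j, c (K + 1) i ≠ c' (K + 1) j → γ i j = 0 := fun i j h =>
      h1 i j fun h' => h (by rw [hc, hc', h'])
    -- Labels are nested, so earlier matches stay inside coarse cells and remove equal mass from
    -- both sides. The imbalance of the leftovers in a coarse cell is therefore the original
    -- imbalance.
    have hbal : ∀ A, ∑ i with c (K + 1) i = A, ∑ j, γ i j =
        ∑ j with c' (K + 1) j = A, ∑ i, γ i j := by
      intro A
      rw [Finset.sum_comm]
      simp only [Finset.sum_filter]
      refine Finset.sum_congr rfl fun j _ => ?_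
      rw [← Finset.sum_filter]
      split_ifs with hj
      · rw [Finset.sum_filter]
        refine Finset.sum_congr rfl fun i _ => ?_
        split_ifs with hi
        · rfl
        · exact (hnest i j fun h => hi (h.trans hj)).symm
      · refine Finset.sum_eq_zero fun i hi => hnest i j fun h => hj ?_
        rw [← h]; exact (Finset.mem_filter.1 hi).2
    refine ⟨fun i j => γ i j + δ i j, fun i j => add_nonneg (h0 i j) (e0 i j), fun i j h => ?_,
      fun i => ?_, fun j => ?_, fun A => ?_, fun A => ?_, ?_⟩
    · dsimp only; rw [hnest i j h, e1 i j h, add_zero]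
    · rw [Finset.sum_add_distrib]; linarith [e2 i]
    · rw [Finset.sum_add_distrib]; linarith [e3 j]
    · have := e4 A
      simp only [Finset.sum_add_distrib, ← sub_sub]
      rw [this, Finset.sum_sub_distrib, Finset.sum_sub_distrib, hbal]
      congr 1; ring
    · have := e5 A
      simp only [Finset.sum_add_distrib, ← sub_sub]
      rw [this, Finset.sum_sub_distrib, Finset.sum_sub_distrib, hbal]
      congr 1; ring
    · have hs := stepcost (K + 1) _ δ e0 e1 e2
      -- What is moved at level `K + 1` is at most what level `K` left over, the positive part of
      -- the imbalance in its cells. This is why `D (k + 1)` is paired with level `k`.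
      have hs2 : ∑ i, W (c (K + 1) i) * (a i - ∑ j, γ i j) ≤ ∑ A ∈ 𝒜 K,
          W A * |∑ i with c K i = A, a i - ∑ j with c' K j = A, b j| := by
        rw [← Finset.sum_fiberwise_of_maps_to (t := 𝒜 K) (g := c K) (fun i _ => h𝒜 K i)]
        refine Finset.sum_le_sum fun A _ => ?_
        rw [Finset.sum_congr rfl (g := fun i => W A * (a i - ∑ j, γ i j)) fun i hi => by
          rw [hc, hW, (Finset.mem_filter.1 hi).2], ← Finset.mul_sum, h4]
        exact mul_le_mul_of_nonneg_left (max_le (abs_nonneg _) (le_abs_self _)) (hW0 A)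
      have hs3 := mul_le_mul_of_nonneg_left hs2 (hD (K + 1))
      rw [Finset.sum_range_succ]
      simp only [add_mul, Finset.sum_add_distrib]
      linarith

/-- Multi-scale upper bound for the cost of transport between two finite measures of equal mass. -/
lemma exists_multiscale_coupling (a : ι → ℝ) (b : κ → ℝ) (ha : ∀ i, 0 ≤ a i) (hb : ∀ j, 0 ≤ b j)
    (hab : ∑ i, a i = ∑ j, b j)
    (c : ℕ → ι → Λ) (c' : ℕ → κ → Λ) (g : ℕ → Λ → Λ) (hc : ∀ k i, c (k + 1) i = g k (c k i))
    (hc' : ∀ k i, c' (k + 1) i = g k (c' k i)) (W : Λ → ℝ) (hW0 : ∀ A, 0 ≤ W A)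
    (hW : ∀ k A, W (g k A) = W A) (D : ℕ → ℝ) (hD : ∀ k, 0 ≤ D k) (cost : ι → κ → ℝ)
    (hcost : ∀ k i j, c k i = c' k j → cost i j ≤ W (c k i) * D k) (𝒜 : ℕ → Finset Λ)
    (h𝒜 : ∀ k i, c k i ∈ 𝒜 k) (h𝒜' : ∀ k j, c' k j ∈ 𝒜 k) (K : ℕ)
    (hcostK : ∀ i j, cost i j ≤ D (K + 1) * (W (c K i) + W (c' K j))) :
    ∃ γ : ι → κ → ℝ, (∀ i j, 0 ≤ γ i j) ∧ (∀ i, ∑ j, γ i j = a i) ∧ (∀ j, ∑ i, γ i j = b j) ∧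
      ∑ i, ∑ j, γ i j * cost i j ≤ D 0 * ∑ i, W (c 0 i) * a i +
        ∑ k ∈ Finset.range (K + 1), D (k + 1) * ∑ A ∈ 𝒜 k,
          W A * |∑ i with c k i = A, a i - ∑ j with c' k j = A, b j| := by
  obtain ⟨γ, h0, -, h2, h3, h4, h5, h6⟩ :=
    exists_multiscale_matching a b ha hb c c' g hc hc' W hW0 hW D hD cost hcost 𝒜 h𝒜 K
  set a' : ι → ℝ := fun i => a i - ∑ j, γ i j with ha'
  set b' : κ → ℝ := fun j => b j - ∑ i, γ i j with hb'
  have ha0 : ∀ i, 0 ≤ a' i := fun i => sub_nonneg.2 (h2 i)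
  have hb0 : ∀ j, 0 ≤ b' j := fun j => sub_nonneg.2 (h3 j)
  -- A final step with a single label matches all leftovers; equal total masses ensure that nothing
  -- remains.
  obtain ⟨δ, e0, -, e2, e3, e4, e5⟩ := exists_matching_step a' b' ha0 hb0
    (fun _ => ()) (fun _ => ())
  have htot : ∑ i, a' i = ∑ j, b' j := by
    simp only [ha', hb', Finset.sum_sub_distrib, hab]
    rw [Finset.sum_comm]
  have hrow : ∀ i, ∑ j, δ i j = a' i := by
    have := e4 ()
    simp only [Finset.filter_true, htot, sub_self, max_self] at this
    rw [Finset.sum_eq_zero_iff_of_nonneg fun i _ => sub_nonneg.2 (e2 i)] at this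
    intro i; linarith [this i (Finset.mem_univ i)]
  have hcol : ∀ j, ∑ i, δ i j = b' j := by
    have := e5 ()
    simp only [Finset.filter_true, htot, sub_self, max_self] at this
    rw [Finset.sum_eq_zero_iff_of_nonneg fun i _ => sub_nonneg.2 (e3 i)] at this
    intro i; linarith [this i (Finset.mem_univ i)]
  refine ⟨fun i j => γ i j + δ i j, fun i j => add_nonneg (h0 i j) (e0 i j), fun i => ?_,
    fun j => ?_, ?_⟩
  · rw [Finset.sum_add_distrib, hrow]; simp [ha']
  · rw [Finset.sum_add_distrib, hcol]; simp [hb']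
  · have hδ : ∑ i, ∑ j, δ i j * cost i j ≤ D (K + 1) * ∑ A ∈ 𝒜 K,
          W A * |∑ i with c K i = A, a i - ∑ j with c' K j = A, b j| := by
      calc ∑ i, ∑ j, δ i j * cost i j
          ≤ ∑ i, ∑ j, (D (K + 1) * W (c K i) * δ i j + D (K + 1) * W (c' K j) * δ i j) := by
            refine Finset.sum_le_sum fun i _ => Finset.sum_le_sum fun j _ => ?_
            have := mul_le_mul_of_nonneg_left (hcostK i j) (e0 i j)
            linarith
        _ = D (K + 1) * (∑ i, W (c K i) * a' i + ∑ j, W (c' K j) * b' j) := by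
            simp only [Finset.sum_add_distrib]
            rw [Finset.sum_comm (f := fun i j => D (K + 1) * W (c' K j) * δ i j)]
            simp only [← Finset.mul_sum, hrow, hcol]
            simp only [mul_assoc, ← Finset.mul_sum, mul_add]
        _ = D (K + 1) * ∑ A ∈ 𝒜 K,
          W A * |∑ i with c K i = A, a i - ∑ j with c' K j = A, b j| := by
            congr 1
            rw [← Finset.sum_fiberwise_of_maps_to (t := 𝒜 K) (g := c K) (fun i _ => h𝒜 K i),
              ← Finset.sum_fiberwise_of_maps_to (t := 𝒜 K) (g := c' K) (fun i _ => h𝒜' K i),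
              ← Finset.sum_add_distrib]
            refine Finset.sum_congr rfl fun A _ => ?_
            rw [Finset.sum_congr rfl (g := fun i => W A * a' i) fun i hi => by
                rw [(Finset.mem_filter.1 hi).2],
              Finset.sum_congr rfl (g := fun i => W A * b' i) fun i hi => by
                rw [(Finset.mem_filter.1 hi).2], ← Finset.mul_sum, ← Finset.mul_sum, h4, h5,
              ← mul_add]
            congr 1
            set x := ∑ i with c K i = A, a i
            set y := ∑ j with c' K j = A, b j
            rcases le_total x y with h | h
            · rw [max_eq_left (by linarith), max_eq_right (by linarith),
                abs_of_nonpos (by linarith)]; ring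
            · rw [max_eq_right (by linarith), max_eq_left (by linarith),
                abs_of_nonneg (by linarith)]; ring
    rw [Finset.sum_range_succ]
    simp only [add_mul, Finset.sum_add_distrib]
    linarith

end Matching

/-! ### Dyadic shells and cubes, and the resulting Wasserstein bound. -/

section Dyadic

variable {d : ℕ}

/-- The index `s` of the dyadic shell `2 ^ (s - 1) < ‖x‖ ≤ 2 ^ s`. -/
noncomputable def dyadicShell (x : Rd d) : ℕ := Nat.clog 2 ⌈‖x‖⌉₊

/-- The shell of `x` together with its cube of side `2 ^ (-ℓ)` relative to the shell. -/
noncomputable def dyadicLabel (ℓ : ℤ) (x : Rd d) : ℕ × (Fin d → ℤ) :=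
  (dyadicShell x, fun k => ⌊(2 : ℝ) ^ ℓ * (x k / 2 ^ dyadicShell x)⌋)

/-- The range of the cube labels at level `ℓ`. -/
noncomputable def dyadicIndex (d ℓ : ℕ) : Finset (Fin d → ℤ) :=
  Fintype.piFinset fun _ => Finset.Icc (-(2 ^ ℓ : ℤ)) (2 ^ ℓ)

/-- The mass that the empirical measure of the points `x i` gives to `E`. -/
noncomputable def empMass {n : ℕ} (x : Fin n → Rd d) (E : Set (Rd d)) : ℝ :=
  ∑ i, E.indicator (fun _ => 1 / (n : ℝ)) (x i)

lemma norm_le_two_pow_dyadicShell (x : Rd d) : ‖x‖ ≤ 2 ^ dyadicShell x := by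
  have h : (⌈‖x‖⌉₊ : ℝ) ≤ ((2 ^ dyadicShell x : ℕ) : ℝ) :=
    Nat.cast_le.2 (Nat.le_pow_clog one_lt_two _)
  push_cast at h
  exact (Nat.le_ceil _).trans h

lemma two_pow_lt_norm {s : ℕ} {x : Rd d} (h : dyadicShell x = s + 1) : 2 ^ s < ‖x‖ := by
  have h1 : 1 < ⌈‖x‖⌉₊ := by
    by_contra! hc
    rw [dyadicShell, Nat.clog_of_right_le_one hc] at h
    omega
  have h2 := Nat.pow_pred_clog_lt_self one_lt_two h1
  rw [dyadicShell] at h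
  rw [h, Nat.pred_succ, Nat.lt_ceil] at h2
  exact_mod_cast h2

lemma measurable_dyadicShell : Measurable (dyadicShell : Rd d → ℕ) :=
  (measurable_from_top (f := Nat.clog 2)).comp (Nat.measurable_ceil.comp measurable_norm)

lemma measurable_dyadicLabel (ℓ : ℤ) : Measurable (dyadicLabel ℓ : Rd d → ℕ × (Fin d → ℤ)) := by
  refine measurable_dyadicShell.prodMk (measurable_pi_lambda _ fun k => Int.measurable_floor.comp ?_)
  have h1 : Measurable fun x : Rd d => (2 : ℝ) ^ dyadicShell x :=
    (measurable_from_top (f := fun s : ℕ => (2 : ℝ) ^ s)).comp measurable_dyadicShell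
  have h2 : Measurable fun x : Rd d => x k := by fun_prop
  exact (h2.div h1).const_mul _

/-- Nesting of the labels: halving before taking the floor equals integer division of the floor by
two. -/
lemma dyadicLabel_sub_one (ℓ : ℤ) (x : Rd d) : dyadicLabel (ℓ - 1) x =
    ((dyadicLabel ℓ x).1, fun k => (dyadicLabel ℓ x).2 k / 2) := by
  refine Prod.ext rfl (funext fun k => ?_)
  have h := Int.floor_div_natCast ((2 : ℝ) ^ ℓ * (x k / 2 ^ dyadicShell x)) 2
  simp only [dyadicLabel]
  rw [zpow_sub_one₀ two_ne_zero]
  push_cast at h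
  rw [← h]
  congr 1; ring

/-- Equal floors force each rescaled coordinate to agree up to `1`, that is, up to `2^(s - ℓ)` in
shell `s`; sum the squares over `d` coordinates. -/
lemma norm_sub_sq_le_of_dyadicLabel_eq {ℓ : ℤ} {x y : Rd d} (h : dyadicLabel ℓ x = dyadicLabel ℓ y) :
    ‖x - y‖ ^ 2 ≤ 4 ^ dyadicShell x * (d * (4 : ℝ) ^ (-ℓ)) := by
  have hs : dyadicShell x = dyadicShell y := congrArg Prod.fst h
  have hc : ∀ k, ‖(x - y) k‖ ^ 2 ≤ 4 ^ dyadicShell x * (4 : ℝ) ^ (-ℓ) := by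
    intro k
    have h1 : ⌊(2 : ℝ) ^ ℓ * (x k / 2 ^ dyadicShell x)⌋ = ⌊(2 : ℝ) ^ ℓ * (y k / 2 ^ dyadicShell x)⌋ := by
      have := congrFun (congrArg Prod.snd h) k
      simp only [dyadicLabel] at this
      rw [this, hs]
    have h2 := Int.abs_sub_lt_one_of_floor_eq_floor h1
    have h3 : (2 : ℝ) ^ ℓ * (x k / 2 ^ dyadicShell x) - (2 : ℝ) ^ ℓ * (y k / 2 ^ dyadicShell x) =
        (x - y) k * ((2 : ℝ) ^ ℓ / 2 ^ dyadicShell x) := by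
      simp only [PiLp.sub_apply]; ring
    have hp : 0 < (2 : ℝ) ^ ℓ / 2 ^ dyadicShell x := by positivity
    rw [h3, abs_mul, abs_of_pos hp, ← lt_div_iff₀ hp] at h2
    have h4 : ‖(x - y) k‖ ^ 2 ≤ (1 / ((2 : ℝ) ^ ℓ / 2 ^ dyadicShell x)) ^ 2 := by
      gcongr; exact h2.le
    refine h4.trans (le_of_eq ?_)
    rw [zpow_neg, show (4 : ℝ) = 2 ^ 2 by norm_num, ← pow_mul, mul_comm 2, pow_mul,
      ← zpow_natCast (2 : ℝ) 2, ← zpow_mul, mul_comm _ ℓ, zpow_mul, zpow_natCast]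
    field_simp
  rw [EuclideanSpace.norm_sq_eq]
  calc ∑ k, ‖(x - y) k‖ ^ 2 ≤ ∑ _k : Fin d, 4 ^ dyadicShell x * (4 : ℝ) ^ (-ℓ) :=
        Finset.sum_le_sum fun k _ => hc k
    _ = _ := by simp; ring

/-- Relative coordinates lie in `[-1, 1]`. The level is an integer while the index set uses
truncated subtraction; for `k > K` the label range at level `0` still suffices. -/
lemma dyadicLabel_mem (K k : ℕ) (x : Rd d) :
    (dyadicLabel ((K : ℤ) - k) x).2 ∈ dyadicIndex d (K - k) := by
  rw [dyadicIndex, Fintype.mem_piFinset]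
  intro i
  have h1 : |x i / 2 ^ dyadicShell x| ≤ 1 := by
    rw [abs_div, abs_of_pos (show (0 : ℝ) < 2 ^ dyadicShell x by positivity)]
    refine div_le_one_of_le₀ ?_ (by positivity)
    exact (PiLp.norm_apply_le x i).trans (norm_le_two_pow_dyadicShell x)
  have h2 : (2 : ℝ) ^ ((K : ℤ) - k) ≤ (2 : ℝ) ^ (K - k) := by
    rw [← zpow_natCast]
    exact zpow_le_zpow_right₀ one_le_two (by omega)
  have h3 : |(2 : ℝ) ^ ((K : ℤ) - k) * (x i / 2 ^ dyadicShell x)| ≤ (2 : ℝ) ^ (K - k) := by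
    rw [abs_mul, abs_of_pos (show (0 : ℝ) < 2 ^ ((K : ℤ) - k) by positivity)]
    calc _ ≤ (2 : ℝ) ^ ((K : ℤ) - k) * 1 := by gcongr
      _ ≤ _ := by linarith
  rw [abs_le] at h3
  rw [Finset.mem_Icc]
  constructor
  · rw [dyadicLabel, Int.le_floor]; push_cast; exact h3.1
  · have := (Int.floor_le ((2 : ℝ) ^ ((K : ℤ) - k) * (x i / 2 ^ dyadicShell x))).trans h3.2
    have h5 : ⌊(2 : ℝ) ^ ((K : ℤ) - k) * (x i / 2 ^ dyadicShell x)⌋ ≤ 2 ^ (K - k) := by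
      rify; exact this
    exact h5

lemma card_dyadicIndex_le (d ℓ : ℕ) : ((dyadicIndex d ℓ).card : ℝ) ≤ 3 ^ d * (2 ^ ℓ) ^ d := by
  rw [dyadicIndex, Fintype.card_piFinset]
  simp only [Finset.prod_const, Finset.card_univ, Fintype.card_fin, Int.card_Icc]
  push_cast
  rw [← mul_pow]
  gcongr
  have h : ((2 ^ ℓ + 1 - -2 ^ ℓ : ℤ).toNat : ℝ) = 2 ^ ℓ + 1 + 2 ^ ℓ := by
    have h0 : (0 : ℤ) ≤ 2 ^ ℓ + 1 - -2 ^ ℓ := by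
      have : (0 : ℤ) < 2 ^ ℓ := by positivity
      linarith
    have : (((2 ^ ℓ + 1 - -2 ^ ℓ : ℤ).toNat : ℤ) : ℝ) = ((2 ^ ℓ + 1 - -2 ^ ℓ : ℤ) : ℝ) := by
      rw [Int.toNat_of_nonneg h0]
    push_cast at this
    linarith
  have h1 : (1 : ℝ) ≤ 2 ^ ℓ := one_le_pow₀ one_le_two
  rw [h]; linarith

lemma empMass_preimage_singleton {Λ : Type*} [DecidableEq Λ] {n : ℕ} (x : Fin n → Rd d)
    (l : Rd d → Λ) (A : Λ) :
    empMass x (l ⁻¹' {A}) = ∑ i with l (x i) = A, 1 / (n : ℝ) := by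
  rw [empMass, Finset.sum_filter]
  refine Finset.sum_congr rfl fun i _ => ?_
  by_cases h : l (x i) = A <;> simp [h]

/-- The multi-scale upper bound for the squared Wasserstein distance of two empirical measures. -/
noncomputable def dyadicBound {n m : ℕ} (K : ℕ) (x : Fin n → Rd d) (y : Fin m → Rd d) : ℝ≥0∞ :=
  ENNReal.ofReal (d * (4 : ℝ) ^ (-(K : ℤ))) *
      ∑ i, ENNReal.ofReal (1 / n) * ENNReal.ofReal (4 ^ dyadicShell (x i)) +
    ∑ k ∈ Finset.range (K + 1), ENNReal.ofReal (4 * d * (4 : ℝ) ^ (-((K - k : ℕ) : ℤ))) *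
      ∑' s : ℕ, ENNReal.ofReal (4 ^ s) * ∑ v ∈ dyadicIndex d (K - k),
        ‖empMass x (dyadicLabel ((K - k : ℕ) : ℤ) ⁻¹' {(s, v)}) -
          empMass y (dyadicLabel ((K - k : ℕ) : ℤ) ⁻¹' {(s, v)})‖ₑ

/-- Greedy matching with label index `k` standing for cube level `K - k`, weight `4^s` on shell `s`,
and `D k = d * 4^(k - K)`. -/
lemma exists_coupling_le_dyadicBound (hd : 0 < d) {n m : ℕ} (hn : 0 < n) (hm : 0 < m) (K : ℕ)
    (x : Fin n → Rd d) (y : Fin m → Rd d) :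
    ∃ γ, IsCouplingMatrix γ ∧ ENNReal.ofReal (transportCost x y γ) ≤ dyadicBound K x y := by
  have hd1 : (1 : ℝ) ≤ d := by exact_mod_cast hd
  -- The matching needs finite label sets, hence a shell bound for these points; at the end the sum
  -- is enlarged to all shells, so the bound no longer depends on `B`.
  set B : ℕ := (Finset.univ.sup fun i => dyadicShell (x i)) + Finset.univ.sup fun j => dyadicShell (y j)
    with hB
  have hBx : ∀ i, dyadicShell (x i) ≤ B := fun i =>
    (Finset.le_sup (f := fun i => dyadicShell (x i)) (Finset.mem_univ i)).trans (Nat.le_add_right _ _)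
  have hBy : ∀ i, dyadicShell (y i) ≤ B := fun i =>
    (Finset.le_sup (f := fun i => dyadicShell (y i)) (Finset.mem_univ i)).trans (Nat.le_add_left _ _)
  have hcost : ∀ (z w : Rd d), ‖z - w‖ ^ 2 ≤ 2 * (4 ^ dyadicShell z + 4 ^ dyadicShell w) := by
    intro z w
    have h4 : ∀ z : Rd d, ‖z‖ ^ 2 ≤ 4 ^ dyadicShell z := fun z => by
      rw [show (4 : ℝ) = 2 ^ 2 by norm_num, ← pow_mul, mul_comm, pow_mul]
      exact pow_le_pow_left₀ (norm_nonneg _) (norm_le_two_pow_dyadicShell z) 2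
    have h5 : ‖z - w‖ ^ 2 ≤ (‖z‖ + ‖w‖) ^ 2 := by gcongr; exact norm_sub_le _ _
    nlinarith [h4 z, h4 w, sq_nonneg (‖z‖ - ‖w‖)]
  obtain ⟨γ, g0, g1, g2, g3⟩ := exists_multiscale_coupling (Λ := ℕ × (Fin d → ℤ))
    (fun _ : Fin n => 1 / (n : ℝ)) (fun _ : Fin m => 1 / (m : ℝ)) (fun _ => by positivity)
    (fun _ => by positivity) (by simp [hn.ne', hm.ne'])
    (fun k i => dyadicLabel ((K : ℤ) - k) (x i)) (fun k j => dyadicLabel ((K : ℤ) - k) (y j))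
    (fun _ A => (A.1, fun i => A.2 i / 2))
    (fun k i => by rw [← dyadicLabel_sub_one]; congr 1; push_cast; ring)
    (fun k i => by rw [← dyadicLabel_sub_one]; congr 1; push_cast; ring)
    (fun A => 4 ^ A.1) (fun A => by positivity) (fun k A => rfl)
    (fun k => d * (4 : ℝ) ^ (-((K : ℤ) - k))) (fun k => by positivity)
    (fun i j => ‖x i - y j‖ ^ 2) (fun k i j h => norm_sub_sq_le_of_dyadicLabel_eq h)
    (fun k => Finset.range (B + 1) ×ˢ dyadicIndex d (K - k))
    (fun k i => Finset.mem_product.2 ⟨Finset.mem_range.2 (Nat.lt_succ_of_le (hBx i)),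
      dyadicLabel_mem K k _⟩)
    (fun k i => Finset.mem_product.2 ⟨Finset.mem_range.2 (Nat.lt_succ_of_le (hBy i)),
      dyadicLabel_mem K k _⟩) K
    (fun i j => by
      refine (hcost (x i) (y j)).trans ?_
      -- The last weight is `4 * d`, enough for pairs in different shells, whose squared distance is
      -- at most `2 * (4^s + 4^s')`.
      have : (2 : ℝ) ≤ d * 4 ^ (-((K : ℤ) - ((K + 1 : ℕ) : ℤ))) := by
        rw [show -((K : ℤ) - ((K + 1 : ℕ) : ℤ)) = 1 by push_cast; ring, zpow_one]; linarith
      exact mul_le_mul_of_nonneg_right this (by positivity))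
  refine ⟨γ, ⟨g0, g1, g2⟩, (ENNReal.ofReal_le_ofReal g3).trans ?_⟩
  rw [ENNReal.ofReal_add (by positivity) (Finset.sum_nonneg fun k _ => mul_nonneg (by positivity)
    (Finset.sum_nonneg fun A _ => by positivity)), dyadicBound]
  refine add_le_add (le_of_eq ?_) ?_
  · rw [ENNReal.ofReal_mul (by positivity), ENNReal.ofReal_sum_of_nonneg fun i _ => by positivity]
    simp only [Nat.cast_zero, sub_zero]
    congr 1
    refine Finset.sum_congr rfl fun i _ => ?_
    rw [← ENNReal.ofReal_mul (by positivity), mul_comm]; rfl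
  · rw [ENNReal.ofReal_sum_of_nonneg fun k _ => mul_nonneg (by positivity)
      (Finset.sum_nonneg fun A _ => by positivity)]
    refine Finset.sum_le_sum fun k hk => ?_
    have hk' : k ≤ K := Nat.lt_succ_iff.1 (Finset.mem_range.1 hk)
    have hKk : ((K : ℤ) - k) = ((K - k : ℕ) : ℤ) := by omega
    rw [ENNReal.ofReal_mul (by positivity)]
    refine mul_le_mul' (le_of_eq ?_) ?_
    · congr 1
      rw [show -((K : ℤ) - ((k + 1 : ℕ) : ℤ)) = -((K - k : ℕ) : ℤ) + 1 by push_cast; omega,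
        zpow_add_one₀ (by norm_num)]
      ring
    · rw [ENNReal.ofReal_sum_of_nonneg fun A _ => by positivity, Finset.sum_product]
      refine le_trans (le_of_eq ?_) (ENNReal.sum_le_tsum (Finset.range (B + 1)))
      refine Finset.sum_congr rfl fun s _ => ?_
      rw [Finset.mul_sum]
      refine Finset.sum_congr rfl fun v _ => ?_
      rw [ENNReal.ofReal_mul (by positivity), hKk, ← empMass_preimage_singleton x,
        ← empMass_preimage_singleton y, Real.enorm_eq_ofReal_abs]

lemma measurable_empMass {S : Type*} [MeasurableSpace S] {n : ℕ} {X : Fin n → S → Rd d}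
    (hX : ∀ i, Measurable (X i)) {E : Set (Rd d)} (hE : MeasurableSet E) :
    Measurable fun ω => empMass (fun i => X i ω) E :=
  Finset.measurable_sum _ fun i _ => (measurable_const.indicator hE).comp (hX i)

lemma measurable_dyadicBound {S : Type*} [MeasurableSpace S] {n m : ℕ} {X : Fin n → S → Rd d}
    (hX : ∀ i, Measurable (X i)) {Y : Fin m → S → Rd d} (hY : ∀ i, Measurable (Y i)) (K : ℕ) :
    Measurable fun ω => dyadicBound K (fun i => X i ω) (fun j => Y j ω) := by
  have hl : ∀ (ℓ : ℤ) A, MeasurableSet (dyadicLabel (d := d) ℓ ⁻¹' {A}) := fun ℓ A =>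
    measurable_dyadicLabel ℓ (measurableSet_singleton A)
  refine Measurable.add (Measurable.const_mul (Finset.measurable_sum _ fun i _ =>
    Measurable.const_mul ?_ _) _) (Finset.measurable_sum _ fun k _ => Measurable.const_mul
      (Measurable.tsum fun s => Measurable.const_mul (Finset.measurable_sum _ fun v _ => ?_) _) _)
  · exact (measurable_from_top (f := fun s : ℕ => ENNReal.ofReal (4 ^ s))).comp
      (measurable_dyadicShell.comp (hX i))
  · exact ((measurable_empMass hX (hl _ _)).sub (measurable_empMass hY (hl _ _))).enorm

end Dyadic

/-! ### Expected size of the dyadic bound for i.i.d. samples. -/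

section EmpiricalRate

variable {d : ℕ} {S : Type*} [MeasurableSpace S] {μ : Measure S} [IsProbabilityMeasure μ]
  {P : Measure (Rd d)}

/-- The empirical mass has mean `P E` and variance at most `P E / n`; the mean absolute deviation is
at most the standard deviation. -/
lemma lintegral_enorm_empMass_sub_le {n : ℕ} {X : Fin n → S → Rd d} (hX : IsIIDSample μ X P)
    (hn : 0 < n) {E : Set (Rd d)} (hE : MeasurableSet E) :
    ∫⁻ ω, ‖empMass (fun i => X i ω) E - P.real E‖ₑ ∂μ ≤ ENNReal.ofReal √(P.real E / n) := by
  have hn' : (0 : ℝ) < n := Nat.cast_pos.2 hn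
  set f : Rd d → ℝ := E.indicator fun _ => 1 / (n : ℝ) with hf
  have hfm : Measurable f := measurable_const.indicator hE
  have hfb : ∀ x, ‖f x‖ ≤ 1 / (n : ℝ) := fun x => by
    rw [hf]
    refine (norm_indicator_le_norm_self _ _).trans ?_
    rw [Real.norm_of_nonneg (by positivity)]
  have hL : ∀ i, MemLp (fun ω => f (X i ω)) 2 μ := fun i =>
    MemLp.of_bound (hfm.comp (hX.measurable i)).aestronglyMeasurable (1 / n)
      (Filter.Eventually.of_forall fun ω => hfb _)
  set g : S → ℝ := fun ω => empMass (fun i => X i ω) E with hg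
  have hgsum : g = ∑ i, fun ω => f (X i ω) := by
    ext ω; simp [hg, empMass, hf]
  have hPE : ∀ i, μ.real (X i ⁻¹' E) = P.real E := fun i => by
    rw [← hX.law i, map_measureReal_apply (hX.measurable i) hE]
  have hgL : MemLp g 2 μ := by
    rw [hgsum]; exact memLp_finsetSum' _ fun i _ => hL i
  have hint : ∀ i, ∫ ω, f (X i ω) ∂μ = P.real E * (1 / n) := fun i => by
    have : (fun ω => f (X i ω)) = (X i ⁻¹' E).indicator fun _ => 1 / (n : ℝ) := by
      ext ω; by_cases h : X i ω ∈ E <;> simp [hf, h]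
    rw [this, integral_indicator_const _ (hX.measurable i hE), hPE, smul_eq_mul]
  have hmean : ∫ ω, g ω ∂μ = P.real E := by
    rw [hgsum]
    simp only [Finset.sum_apply]
    rw [integral_finsetSum _ fun i _ => (hL i).integrable (by norm_num)]
    simp only [hint, Finset.sum_const, Finset.card_univ, Fintype.card_fin, nsmul_eq_mul]
    field_simp
  have hvar : Var[g; μ] ≤ P.real E / n := by
    rw [hgsum, IndepFun.variance_sum (fun i _ => hL i) fun i _ j _ hij =>
      (hX.indep.indepFun hij).comp hfm hfm]
    have : ∀ i, Var[fun ω => f (X i ω); μ] ≤ P.real E * (1 / n) ^ 2 := fun i => by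
      refine (variance_le_expectation_sq (hL i).1).trans (le_of_eq ?_)
      have : ((fun ω => f (X i ω)) ^ 2 : S → ℝ) =
          (X i ⁻¹' E).indicator fun _ => (1 / (n : ℝ)) ^ 2 := by
        ext ω; by_cases h : X i ω ∈ E <;> simp [hf, h]
      rw [this, integral_indicator_const _ (hX.measurable i hE), hPE, smul_eq_mul]
    refine (Finset.sum_le_sum fun i _ => this i).trans (le_of_eq ?_)
    simp only [Finset.sum_const, Finset.card_univ, Fintype.card_fin, nsmul_eq_mul]
    field_simp
  have hcL : MemLp (fun ω => |g ω - P.real E|) 2 μ := (hgL.sub (memLp_const _)).abs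
  -- Nonnegativity of this variance is Jensen's inequality `(E|g - P E|)² ≤ Var g`.
  have h0 := variance_nonneg (fun ω => |g ω - P.real E|) μ
  rw [variance_eq_sub hcL] at h0
  rw [variance_eq_integral hgL.1.aemeasurable, hmean] at hvar
  simp only [Pi.pow_apply, sq_abs] at h0
  have h1 : ∫ ω, |g ω - P.real E| ∂μ ≤ √(P.real E / n) := Real.le_sqrt_of_sq_le (by linarith)
  have h2 := ofReal_integral_norm_eq_lintegral_enorm (f := fun ω => g ω - P.real E)
    ((hgL.sub (memLp_const _)).integrable (by norm_num))
  rw [← h2]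
  exact ENNReal.ofReal_le_ofReal h1

/-- Markov's inequality for `‖x‖ ^ r`. The inner radius of shell `s + 1` is `2^s`, hence the factor
`2 ^ r`; the summand `1` takes care of shell zero. -/
lemma measureReal_dyadicShell_le [IsProbabilityMeasure P] {r M : ℝ} (hr : 0 < r) (hM : 0 < M)
    (hm : ∫⁻ x, ‖x‖ₑ ^ r ∂P ≤ ENNReal.ofReal (M ^ r)) (s : ℕ) :
    P.real (dyadicShell ⁻¹' {s}) ≤ (1 + M ^ r * 2 ^ r) * ((2 : ℝ) ^ (-r)) ^ s := by
  have hMr : 0 < M ^ r := by positivity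
  cases s with
  | zero =>
    rw [pow_zero, mul_one]
    have : 0 < M ^ r * 2 ^ r := by positivity
    linarith [measureReal_le_one (μ := P) (s := dyadicShell ⁻¹' {0})]
  | succ s =>
    have h1 := mul_meas_ge_le_lintegral (μ := P) (f := fun x : Rd d => ‖x‖ₑ ^ r)
      (by fun_prop) (ENNReal.ofReal ((2 ^ s) ^ r))
    have h2 : dyadicShell (d := d) ⁻¹' {s + 1} ⊆ {x | ENNReal.ofReal ((2 ^ s) ^ r) ≤ ‖x‖ₑ ^ r} := by
      intro x hx
      have := two_pow_lt_norm hx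
      simp only [Set.mem_ofPred_eq]
      rw [← ofReal_norm, ENNReal.ofReal_rpow_of_nonneg (norm_nonneg _) hr.le]
      exact ENNReal.ofReal_le_ofReal (Real.rpow_le_rpow (by positivity) this.le hr.le)
    have h3 : ENNReal.ofReal ((2 ^ s) ^ r) * P (dyadicShell ⁻¹' {s + 1}) ≤ ENNReal.ofReal (M ^ r) :=
      (mul_le_mul_right (measure_mono h2) _).trans (h1.trans hm)
    have h4 := ENNReal.toReal_mono ENNReal.ofReal_ne_top h3
    rw [ENNReal.toReal_mul, ENNReal.toReal_ofReal (by positivity), ENNReal.toReal_ofReal hMr.le] at h4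
    change _ * P.real _ ≤ _ at h4
    rw [← le_div_iff₀' (by positivity)] at h4
    have e : ((2 : ℝ) ^ (-r)) ^ (s + 1) = (2 ^ r)⁻¹ * ((2 ^ s) ^ r)⁻¹ := by
      rw [Real.rpow_neg two_pos.le, pow_succ', inv_pow]
      congr 2
      rw [← Real.rpow_natCast, ← Real.rpow_natCast, ← Real.rpow_mul two_pos.le,
        ← Real.rpow_mul two_pos.le, mul_comm]
    rw [e]
    have e2 : (1 + M ^ r * 2 ^ r) * (((2 : ℝ) ^ r)⁻¹ * ((2 ^ s) ^ r)⁻¹) =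
        (2 ^ r)⁻¹ * ((2 ^ s) ^ r)⁻¹ + M ^ r / (2 ^ s) ^ r := by field_simp
    rw [e2]
    have : (0 : ℝ) ≤ (2 ^ r)⁻¹ * ((2 ^ s) ^ r)⁻¹ := by positivity
    linarith

lemma lintegral_four_pow_dyadicShell_le [IsProbabilityMeasure P] {r M : ℝ} (hr : 4 < r)
    (hm : ∫⁻ x, ‖x‖ₑ ^ r ∂P ≤ ENNReal.ofReal (M ^ r)) :
    ∫⁻ x, ENNReal.ofReal (4 ^ dyadicShell x) ∂P ≤ 5 + 4 * ENNReal.ofReal (M ^ r) := by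
  have h2 := lintegral_enorm_rpow_le (s := 2) (by norm_num) (by linarith) hm
  calc ∫⁻ x, ENNReal.ofReal (4 ^ dyadicShell x) ∂P ≤ ∫⁻ x, (1 + 4 * ‖x‖ₑ ^ (2 : ℝ)) ∂P := by
        refine lintegral_mono fun x => ?_
        have h : (4 : ℝ) ^ dyadicShell x ≤ 1 + 4 * ‖x‖ ^ 2 := by
          rcases hs : dyadicShell x with _ | s
          · simp
          · have := two_pow_lt_norm hs
            have h5 : ((2 : ℝ) ^ s) ^ 2 ≤ ‖x‖ ^ 2 := by gcongr
            rw [pow_succ, show (4 : ℝ) ^ s = (2 ^ s) ^ 2 by rw [← pow_mul, mul_comm, pow_mul]; norm_num]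
            linarith
        refine (ENNReal.ofReal_le_ofReal h).trans (le_of_eq ?_)
        rw [ENNReal.ofReal_add zero_le_one (by positivity), ENNReal.ofReal_mul (by norm_num),
          ENNReal.ofReal_pow (norm_nonneg _), ofReal_norm]
        norm_num
    _ = 1 + 4 * ∫⁻ x, ‖x‖ₑ ^ (2 : ℝ) ∂P := by
        rw [lintegral_add_left measurable_const, lintegral_const_mul _ (by fun_prop)]; simp
    _ ≤ 1 + 4 * (1 + ENNReal.ofReal (M ^ r)) := by gcongr
    _ = _ := by ring

lemma sum_sqrt_le {ι : Type*} (s : Finset ι) (f : ι → ℝ) (hf : ∀ i ∈ s, 0 ≤ f i) :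
    ∑ i ∈ s, √(f i) ≤ √(s.card * ∑ i ∈ s, f i) := by
  refine Real.le_sqrt_of_sq_le ?_
  have := sq_sum_le_card_mul_sum_sq (s := s) (f := fun i => √(f i))
  rwa [Finset.sum_congr rfl fun i hi => Real.sq_sqrt (hf i hi)] at this

/-- Both empirical masses are compared with the true mass, so no independence between the samples is
needed. Cauchy–Schwarz over the cells then replaces the cell masses by the number of cells and the
mass of the shell. -/
lemma sum_lintegral_cell_le [IsProbabilityMeasure P] {n m N : ℕ} {X : Fin n → S → Rd d} {Y : Fin m → S → Rd d}
    (hX : IsIIDSample μ X P) (hY : IsIIDSample μ Y P) (hN : 0 < N) (hn : N ≤ n) (hm : N ≤ m)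
    (ℓ : ℤ) (V : Finset (Fin d → ℤ)) (s : ℕ) :
    ∫⁻ ω, ∑ v ∈ V, ‖empMass (fun i => X i ω) (dyadicLabel ℓ ⁻¹' {(s, v)}) -
        empMass (fun j => Y j ω) (dyadicLabel ℓ ⁻¹' {(s, v)})‖ₑ ∂μ ≤
      ENNReal.ofReal (2 * √(V.card * (P.real (dyadicShell ⁻¹' {s}) / N))) := by
  have hl : ∀ A, MeasurableSet (dyadicLabel (d := d) ℓ ⁻¹' {A}) := fun A =>
    measurable_dyadicLabel ℓ (measurableSet_singleton A)
  have hN' : (0 : ℝ) < N := Nat.cast_pos.2 hN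
  have h1 : ∀ v, ∫⁻ ω, ‖empMass (fun i => X i ω) (dyadicLabel ℓ ⁻¹' {(s, v)}) -
        empMass (fun j => Y j ω) (dyadicLabel ℓ ⁻¹' {(s, v)})‖ₑ ∂μ ≤
      ENNReal.ofReal (2 * √(P.real (dyadicLabel ℓ ⁻¹' {(s, v)}) / N)) := by
    intro v
    set E := dyadicLabel (d := d) ℓ ⁻¹' {(s, v)}
    have hsq : ∀ k : ℕ, N ≤ k → ENNReal.ofReal √(P.real E / k) ≤ ENNReal.ofReal √(P.real E / N) := by
      intro k hk
      gcongr
    calc _ ≤ ∫⁻ ω, (‖empMass (fun i => X i ω) E - P.real E‖ₑ +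
            ‖empMass (fun j => Y j ω) E - P.real E‖ₑ) ∂μ := by
          refine lintegral_mono fun ω => ?_
          have : empMass (fun i => X i ω) E - empMass (fun j => Y j ω) E =
            (empMass (fun i => X i ω) E - P.real E) - (empMass (fun j => Y j ω) E - P.real E) := by ring
          rw [this]
          exact enorm_sub_le
      _ = _ := lintegral_add_left ((measurable_empMass hX.measurable (hl _)).sub_const _).enorm _
      _ ≤ ENNReal.ofReal √(P.real E / N) + ENNReal.ofReal √(P.real E / N) :=
          add_le_add ((lintegral_enorm_empMass_sub_le hX (hN.trans_le hn) (hl _)).trans (hsq n hn))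
            ((lintegral_enorm_empMass_sub_le hY (hN.trans_le hm) (hl _)).trans (hsq m hm))
      _ = _ := by rw [← ENNReal.ofReal_add (by positivity) (by positivity), two_mul]
  have hmeas : ∀ v, Measurable fun ω => ‖empMass (fun i => X i ω) (dyadicLabel ℓ ⁻¹' {(s, v)}) -
      empMass (fun j => Y j ω) (dyadicLabel ℓ ⁻¹' {(s, v)})‖ₑ := fun v =>
    ((measurable_empMass hX.measurable (hl _)).sub (measurable_empMass hY.measurable (hl _))).enorm
  rw [lintegral_finsetSum _ fun v _ => hmeas v]
  refine (Finset.sum_le_sum fun v _ => h1 v).trans ?_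
  rw [← ENNReal.ofReal_sum_of_nonneg fun v _ => by positivity, ← Finset.mul_sum]
  refine ENNReal.ofReal_le_ofReal (mul_le_mul_of_nonneg_left ?_ two_pos.le)
  refine (sum_sqrt_le V _ fun v _ => by positivity).trans (Real.sqrt_le_sqrt ?_)
  rw [← Finset.sum_div]
  refine mul_le_mul_of_nonneg_left ?_ (by positivity)
  gcongr
  rw [← measureReal_biUnion_finset _ fun v _ => hl _]
  · refine measureReal_mono fun x hx => ?_
    simp only [Set.mem_iUnion, Set.mem_preimage, Set.mem_singleton_iff] at hx ⊢
    obtain ⟨v, -, h⟩ := hx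
    exact congrArg Prod.fst h
  · intro v _ w _ hvw
    refine Set.disjoint_left.2 fun x hx hx' => hvw ?_
    simp only [Set.mem_preimage, Set.mem_singleton_iff] at hx hx'
    exact congrArg Prod.snd (hx.symm.trans hx')

/-- Shell `s` contributes `4^s` times the root of its mass, of order `2^(-rs/2)`: a geometric series
with ratio `2^(2 - r/2)`, below `1` because `r > 4`. -/
lemma lintegral_level_le [IsProbabilityMeasure P] {r M : ℝ} (hr : 4 < r) (hM : 0 < M)
    (hmom : ∫⁻ x, ‖x‖ₑ ^ r ∂P ≤ ENNReal.ofReal (M ^ r)) {n m N : ℕ}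
    {X : Fin n → S → Rd d} {Y : Fin m → S → Rd d}
    (hX : IsIIDSample μ X P) (hY : IsIIDSample μ Y P) (hN : 0 < N) (hn : N ≤ n) (hm : N ≤ m)
    (ℓ : ℤ) (V : Finset (Fin d → ℤ)) :
    ∫⁻ ω, ∑' s : ℕ, ENNReal.ofReal (4 ^ s) * ∑ v ∈ V,
        ‖empMass (fun i => X i ω) (dyadicLabel ℓ ⁻¹' {(s, v)}) -
        empMass (fun j => Y j ω) (dyadicLabel ℓ ⁻¹' {(s, v)})‖ₑ ∂μ ≤
      ENNReal.ofReal (2 * √(V.card / N) * (√(1 + M ^ r * 2 ^ r) * (1 - 2 ^ (2 - r / 2))⁻¹)) := by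
  have hl : ∀ A, MeasurableSet (dyadicLabel (d := d) ℓ ⁻¹' {A}) := fun A =>
    measurable_dyadicLabel ℓ (measurableSet_singleton A)
  have hmeas : ∀ s, Measurable fun ω => ∑ v ∈ V,
        ‖empMass (fun i => X i ω) (dyadicLabel ℓ ⁻¹' {(s, v)}) -
        empMass (fun j => Y j ω) (dyadicLabel ℓ ⁻¹' {(s, v)})‖ₑ := fun s =>
    Finset.measurable_sum _ fun v _ => ((measurable_empMass hX.measurable (hl _)).sub
      (measurable_empMass hY.measurable (hl _))).enorm
  have hρ : (2 : ℝ) ^ (2 - r / 2) < 1 := Real.rpow_lt_one_of_one_lt_of_neg one_lt_two (by linarith)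
  have hρ0 : (0 : ℝ) < 2 ^ (2 - r / 2) := by positivity
  rw [lintegral_tsum fun s => ((hmeas s).const_mul _).aemeasurable]
  have h1 : ∀ s : ℕ, ∫⁻ ω, ENNReal.ofReal (4 ^ s) * ∑ v ∈ V,
        ‖empMass (fun i => X i ω) (dyadicLabel ℓ ⁻¹' {(s, v)}) -
        empMass (fun j => Y j ω) (dyadicLabel ℓ ⁻¹' {(s, v)})‖ₑ ∂μ ≤
      ENNReal.ofReal (2 * √(V.card / N) * √(1 + M ^ r * 2 ^ r)) *
        ENNReal.ofReal (2 ^ (2 - r / 2)) ^ s := by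
    intro s
    rw [lintegral_const_mul _ (hmeas s)]
    refine (mul_le_mul_right (sum_lintegral_cell_le hX hY hN hn hm ℓ V s) _).trans ?_
    rw [← ENNReal.ofReal_mul (by positivity), ← ENNReal.ofReal_pow hρ0.le,
      ← ENNReal.ofReal_mul (by positivity)]
    refine ENNReal.ofReal_le_ofReal ?_
    have h2 := measureReal_dyadicShell_le (by linarith) hM hmom s
    have h3 : √(V.card * (P.real (dyadicShell ⁻¹' {s}) / N)) ≤
        √(V.card / N) * √(1 + M ^ r * 2 ^ r) * ((2 : ℝ) ^ (-r / 2)) ^ s := by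
      have e : √(((2 : ℝ) ^ (-r)) ^ s) = ((2 : ℝ) ^ (-r / 2)) ^ s := by
        rw [Real.sqrt_eq_iff_mul_self_eq (by positivity) (by positivity), ← mul_pow,
          ← Real.rpow_add two_pos]
        congr 2; ring
      rw [← e, mul_assoc, ← Real.sqrt_mul (by positivity), ← Real.sqrt_mul (by positivity)]
      refine Real.sqrt_le_sqrt ?_
      calc _ = (V.card : ℝ) / N * P.real (dyadicShell ⁻¹' {s}) := by ring
        _ ≤ _ := by gcongr
    have e4 : ((2 : ℝ) ^ (2 - r / 2)) ^ s = 4 ^ s * ((2 : ℝ) ^ (-r / 2)) ^ s := by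
      rw [← mul_pow, sub_eq_add_neg, Real.rpow_add two_pos, neg_div]
      norm_num
    rw [e4]
    have := mul_le_mul_of_nonneg_left h3 (show (0 : ℝ) ≤ 4 ^ s * 2 by positivity)
    linarith
  refine (ENNReal.tsum_le_tsum h1).trans (le_of_eq ?_)
  rw [ENNReal.tsum_mul_left, ENNReal.tsum_geometric, ← ENNReal.ofReal_one,
    ← ENNReal.ofReal_sub _ hρ0.le, ← ENNReal.ofReal_inv_of_pos (by linarith),
    ← ENNReal.ofReal_mul (by positivity), mul_assoc]

/-- The choice of the finest scale. -/
lemma exists_scale (hd : 4 < d) {N : ℕ} (hN : 0 < N) :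
    ∃ K : ℕ, (4 : ℝ) ^ (-(K : ℤ)) ≤ 4 * (N : ℝ) ^ (-(2 : ℝ) / d) ∧
      ∑ ℓ ∈ Finset.range (K + 1), (4 : ℝ) ^ (-(ℓ : ℤ)) * √((2 ^ ℓ) ^ d / N) ≤
        2 ^ ((d : ℝ) / 2 - 2) / (2 ^ ((d : ℝ) / 2 - 2) - 1) * (N : ℝ) ^ (-(2 : ℝ) / d) := by
  have hd' : (4 : ℝ) < d := by exact_mod_cast hd
  have hd0 : (0 : ℝ) < d := by linarith
  have hN' : (1 : ℝ) ≤ N := by exact_mod_cast hN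
  have hN0 : (0 : ℝ) < N := by linarith
  -- The finest cubes have relative side of order `N^(-1/d)`: `2^K ≤ N^(1/d) < 2^(K+1)`.
  obtain ⟨K, hK1, hK2⟩ := exists_nat_pow_near
    (Real.one_le_rpow hN' (by positivity : (0 : ℝ) ≤ 1 / d)) one_lt_two
  refine ⟨K, ?_, ?_⟩
  · have h1 : (N : ℝ) ^ (-(2 : ℝ) / d) = (((N : ℝ) ^ (1 / (d : ℝ))) ^ 2)⁻¹ := by
      rw [← Real.rpow_natCast, ← Real.rpow_mul hN0.le, ← Real.rpow_neg hN0.le]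
      congr 1; push_cast; ring
    rw [h1, zpow_neg, zpow_natCast, ← div_eq_mul_inv, le_div_iff₀ (by positivity),
      inv_mul_le_iff₀ (by positivity)]
    have h2 : ((N : ℝ) ^ (1 / (d : ℝ))) ^ 2 ≤ (2 ^ (K + 1)) ^ 2 := by gcongr
    refine h2.trans (le_of_eq ?_)
    rw [← pow_mul, mul_comm, pow_mul, pow_succ]; norm_num
  -- Level `ℓ` contributes `θ^ℓ / √N`, and `θ > 1` because `d > 4`. The sum is thus comparable to
  -- its last term, and `θ^K ≤ N^(1/2 - 2/d)`.
  · set θ : ℝ := 2 ^ ((d : ℝ) / 2 - 2) with hθ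
    have hθ1 : 1 < θ := Real.one_lt_rpow one_lt_two (by linarith)
    have hterm : ∀ ℓ : ℕ, (4 : ℝ) ^ (-(ℓ : ℤ)) * √((2 ^ ℓ) ^ d / N) = θ ^ ℓ * (√N)⁻¹ := by
      intro ℓ
      rw [Real.sqrt_div (by positivity), div_eq_mul_inv, ← mul_assoc]
      congr 1
      have e1 : √(((2 : ℝ) ^ ℓ) ^ d) = ((2 : ℝ) ^ ((d : ℝ) / 2)) ^ ℓ := by
        rw [Real.sqrt_eq_iff_mul_self_eq (by positivity) (by positivity), ← mul_pow,
          ← Real.rpow_add two_pos, add_halves, Real.rpow_natCast, ← pow_mul, ← pow_mul, mul_comm]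
      rw [e1, zpow_neg, zpow_natCast, ← inv_pow, ← mul_pow, hθ, Real.rpow_sub two_pos]
      congr 1; norm_num; ring
    rw [Finset.sum_congr rfl fun ℓ _ => hterm ℓ, ← Finset.sum_mul, geom_sum_eq hθ1.ne']
    have hθK : θ ^ K ≤ (N : ℝ) ^ (1 / 2 - 2 / (d : ℝ)) := by
      have e1 : θ ^ K = ((2 : ℝ) ^ K) ^ ((d : ℝ) / 2 - 2) := by
        rw [hθ, ← Real.rpow_natCast, ← Real.rpow_mul two_pos.le, ← Real.rpow_natCast,
          ← Real.rpow_mul two_pos.le, mul_comm]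
      have e2 : (N : ℝ) ^ (1 / 2 - 2 / (d : ℝ)) = ((N : ℝ) ^ (1 / (d : ℝ))) ^ ((d : ℝ) / 2 - 2) := by
        rw [← Real.rpow_mul hN0.le]
        congr 1; field_simp
      rw [e1, e2]
      exact Real.rpow_le_rpow (by positivity) hK1 (by linarith)
    have hNs : (N : ℝ) ^ (1 / 2 - 2 / (d : ℝ)) * (√N)⁻¹ = (N : ℝ) ^ (-(2 : ℝ) / d) := by
      rw [Real.sqrt_eq_rpow, ← Real.rpow_neg hN0.le, ← Real.rpow_add hN0]
      congr 1; ring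
    rw [← hNs, ← mul_assoc]
    refine mul_le_mul_of_nonneg_right ?_ (by positivity)
    rw [div_mul_eq_mul_div]
    have : θ ^ (K + 1) ≤ θ * (N : ℝ) ^ (1 / 2 - 2 / (d : ℝ)) := by
      rw [pow_succ']; gcongr
    refine div_le_div_of_nonneg_right ?_ (by linarith)
    linarith

end EmpiricalRate

/-- Two empirical measures of the same distribution are at squared Wasserstein distance of order
`n ^ (-2 / d) + m ^ (-2 / d)`. The samples need not be independent of each other. -/
theorem exists_coupling_empirical {d : ℕ} (hd : 4 < d) {r M : ℝ} (hr : 4 < r) (hM : 0 < M) :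
    ∃ C : ℝ, 0 < C ∧ ∀ n m : ℕ, 0 < n → 0 < m → ∀ (P : Measure (Rd d)) [IsProbabilityMeasure P],
      ∫⁻ x, ‖x‖ₑ ^ r ∂P ≤ ENNReal.ofReal (M ^ r) →
      ∀ (S : Type*) [MeasurableSpace S] (μ : Measure S) [IsProbabilityMeasure μ]
        (X : Fin n → S → Rd d) (Y : Fin m → S → Rd d),
        IsIIDSample μ X P → IsIIDSample μ Y P →
        ∃ B : S → ℝ≥0∞, Measurable B ∧ ∫⁻ ω, B ω ∂μ ≤ ENNReal.ofReal (C * otRate d n m) ∧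
          ∀ ω, ∃ γ, IsCouplingMatrix γ ∧
            ENNReal.ofReal (transportCost (fun i => X i ω) (fun j => Y j ω) γ) ≤ B ω := by
  have hd' : (4 : ℝ) < d := by exact_mod_cast hd
  have hd0 : (0 : ℝ) < d := by linarith
  set A : ℝ := √(1 + M ^ r * 2 ^ r) * (1 - 2 ^ (2 - r / 2))⁻¹ with hA
  have hρ : (2 : ℝ) ^ (2 - r / 2) < 1 := Real.rpow_lt_one_of_one_lt_of_neg one_lt_two (by linarith)
  have hA0 : 0 ≤ A := mul_nonneg (Real.sqrt_nonneg _) (inv_nonneg.2 (by linarith))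
  set θ : ℝ := 2 ^ ((d : ℝ) / 2 - 2) with hθ
  have hθ1 : 1 < θ := Real.one_lt_rpow one_lt_two (by linarith)
  have hθ0 : 0 ≤ θ / (θ - 1) := div_nonneg (by linarith) (by linarith)
  set C : ℝ := d * 4 * (5 + 4 * M ^ r) + 4 * d * (2 * √(3 ^ d) * A) * (θ / (θ - 1)) with hC
  have hC0 : 0 < C := by positivity
  refine ⟨C, hC0, fun n m hn hm P _ hmom S _ μ _ X Y hX hY => ?_⟩
  set N := min n m with hN
  have hN0 : 0 < N := lt_min hn hm
  have hNn : N ≤ n := min_le_left _ _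
  have hNm : N ≤ m := min_le_right _ _
  obtain ⟨K, hK1, hK2⟩ := exists_scale hd hN0
  refine ⟨fun ω => dyadicBound K (fun i => X i ω) (fun j => Y j ω),
    measurable_dyadicBound hX.measurable hY.measurable K, ?_,
    fun ω => exists_coupling_le_dyadicBound (by omega) hn hm K _ _⟩
  have hl : ∀ (ℓ : ℤ) A, MeasurableSet (dyadicLabel (d := d) ℓ ⁻¹' {A}) := fun ℓ A =>
    measurable_dyadicLabel ℓ (measurableSet_singleton A)
  have hm4 : Measurable fun x : Rd d => ENNReal.ofReal (4 ^ dyadicShell x) :=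
    (measurable_from_top (f := fun s : ℕ => ENNReal.ofReal (4 ^ s))).comp measurable_dyadicShell
  have hmeas4 : ∀ i, Measurable fun ω => ENNReal.ofReal (4 ^ dyadicShell (X i ω)) := fun i =>
    hm4.comp (hX.measurable i)
  have hmeasL : ∀ k : ℕ, Measurable fun ω => ∑' s : ℕ, ENNReal.ofReal (4 ^ s) *
      ∑ v ∈ dyadicIndex d (K - k),
        ‖empMass (fun i => X i ω) (dyadicLabel ((K - k : ℕ) : ℤ) ⁻¹' {(s, v)}) -
          empMass (fun j => Y j ω) (dyadicLabel ((K - k : ℕ) : ℤ) ⁻¹' {(s, v)})‖ₑ := fun k =>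
    Measurable.tsum fun s => Measurable.const_mul (Finset.measurable_sum _ fun v _ =>
      ((measurable_empMass hX.measurable (hl _ _)).sub
        (measurable_empMass hY.measurable (hl _ _))).enorm) _
  have hrate : (N : ℝ) ^ (-(2 : ℝ) / d) ≤ otRate d n m := by
    have h1 : (0 : ℝ) ≤ (n : ℝ) ^ (-(2 : ℝ) / d) := by positivity
    have h2 : (0 : ℝ) ≤ (m : ℝ) ^ (-(2 : ℝ) / d) := by positivity
    rw [otRate]
    rcases min_choice n m with h | h <;> rw [hN, h] <;> linarith
  have hI1 : ∫⁻ ω, ∑ i, ENNReal.ofReal (1 / n) * ENNReal.ofReal (4 ^ dyadicShell (X i ω)) ∂μ ≤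
      ENNReal.ofReal (5 + 4 * M ^ r) := by
    rw [lintegral_finsetSum _ fun i _ => (hmeas4 i).const_mul _]
    calc _ ≤ ∑ i : Fin n, ENNReal.ofReal (1 / n) * (5 + 4 * ENNReal.ofReal (M ^ r)) := by
          refine Finset.sum_le_sum fun i _ => ?_
          rw [lintegral_const_mul _ (hmeas4 i)]
          gcongr
          rw [← lintegral_map hm4 (hX.measurable i), hX.law i]
          exact lintegral_four_pow_dyadicShell_le hr hmom
      _ = ENNReal.ofReal (5 + 4 * M ^ r) := by
          rw [← Finset.sum_mul]
          have h1 : ∑ i : Fin n, ENNReal.ofReal (1 / (n : ℝ)) = 1 := by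
            rw [← ENNReal.ofReal_sum_of_nonneg fun i _ => by positivity]
            simp [hn.ne']
          rw [h1, one_mul, ENNReal.ofReal_add (by positivity) (by positivity),
            ENNReal.ofReal_mul (by norm_num)]
          norm_num
  have hI2 : ∀ k : ℕ, ∫⁻ ω, ∑' s : ℕ, ENNReal.ofReal (4 ^ s) *
      ∑ v ∈ dyadicIndex d (K - k),
        ‖empMass (fun i => X i ω) (dyadicLabel ((K - k : ℕ) : ℤ) ⁻¹' {(s, v)}) -
          empMass (fun j => Y j ω) (dyadicLabel ((K - k : ℕ) : ℤ) ⁻¹' {(s, v)})‖ₑ ∂μ ≤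
      ENNReal.ofReal (√((2 ^ (K - k)) ^ d / N) * (2 * √(3 ^ d) * A)) := by
    intro k
    refine (lintegral_level_le hr hM hmom hX hY hN0 hNn hNm _ _).trans
      (ENNReal.ofReal_le_ofReal ?_)
    have h1 : √((dyadicIndex d (K - k)).card / N) ≤ √((2 ^ (K - k)) ^ d / N) * √(3 ^ d) := by
      rw [← Real.sqrt_mul (by positivity)]
      refine Real.sqrt_le_sqrt ?_
      rw [div_mul_eq_mul_div]
      gcongr
      rw [mul_comm]
      exact card_dyadicIndex_le d (K - k)
    calc _ = √((dyadicIndex d (K - k)).card / N) * (2 * A) := by rw [hA]; ring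
      _ ≤ (√((2 ^ (K - k)) ^ d / N) * √(3 ^ d)) * (2 * A) := by gcongr
      _ = _ := by ring
  simp only [dyadicBound]
  rw [lintegral_add_left (Measurable.const_mul (Finset.measurable_sum _ fun i _ =>
    (hmeas4 i).const_mul _) _), lintegral_const_mul _ (Finset.measurable_sum _ fun i _ =>
    (hmeas4 i).const_mul _), lintegral_finsetSum _ fun k _ => (hmeasL k).const_mul _]
  calc _ ≤ ENNReal.ofReal (d * (4 : ℝ) ^ (-(K : ℤ))) * ENNReal.ofReal (5 + 4 * M ^ r) +
        ∑ k ∈ Finset.range (K + 1), ENNReal.ofReal (4 * d * (4 : ℝ) ^ (-((K - k : ℕ) : ℤ))) *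
          ENNReal.ofReal (√((2 ^ (K - k)) ^ d / N) * (2 * √(3 ^ d) * A)) := by
        refine add_le_add (mul_le_mul_right hI1 _) (Finset.sum_le_sum fun k _ => ?_)
        rw [lintegral_const_mul _ (hmeasL k)]
        exact mul_le_mul_right (hI2 k) _
    _ = ENNReal.ofReal (d * (4 : ℝ) ^ (-(K : ℤ)) * (5 + 4 * M ^ r) +
        ∑ k ∈ Finset.range (K + 1), 4 * d * (4 : ℝ) ^ (-((K - k : ℕ) : ℤ)) *
          (√((2 ^ (K - k)) ^ d / N) * (2 * √(3 ^ d) * A))) := by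
        rw [ENNReal.ofReal_add (by positivity) (Finset.sum_nonneg fun k _ => by positivity),
          ENNReal.ofReal_mul (q := 5 + 4 * M ^ r) (by positivity),
          ENNReal.ofReal_sum_of_nonneg fun k _ => by positivity]
        congr 1
        exact Finset.sum_congr rfl fun k _ => (ENNReal.ofReal_mul (by positivity)).symm
    _ ≤ ENNReal.ofReal (C * otRate d n m) := by
        refine ENNReal.ofReal_le_ofReal ?_
        have e := Finset.sum_range_reflect (fun ℓ => 4 * d * (4 : ℝ) ^ (-(ℓ : ℤ)) *
          (√((2 ^ ℓ) ^ d / N) * (2 * √(3 ^ d) * A))) (K + 1)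
        simp only [Nat.add_sub_cancel] at e
        rw [e]
        have e2 : ∑ ℓ ∈ Finset.range (K + 1), 4 * d * (4 : ℝ) ^ (-(ℓ : ℤ)) *
          (√((2 ^ ℓ) ^ d / N) * (2 * √(3 ^ d) * A)) = 4 * d * (2 * √(3 ^ d) * A) *
            ∑ ℓ ∈ Finset.range (K + 1), (4 : ℝ) ^ (-(ℓ : ℤ)) * √((2 ^ ℓ) ^ d / N) := by
          rw [Finset.mul_sum]
          exact Finset.sum_congr rfl fun ℓ _ => by ring
        rw [e2]
        calc _ ≤ d * (4 * (N : ℝ) ^ (-(2 : ℝ) / d)) * (5 + 4 * M ^ r) +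
              4 * d * (2 * √(3 ^ d) * A) * (θ / (θ - 1) * (N : ℝ) ^ (-(2 : ℝ) / d)) := by gcongr
          _ = C * (N : ℝ) ^ (-(2 : ℝ) / d) := by rw [hC]; ring
          _ ≤ _ := by gcongr

/-! ### Masses of Voronoi cells. -/

section Voronoi

/-- The distribution function evaluated below its `τ`-quantile. -/
lemma le_measure_setOf_measure_Iio_le (ν : Measure ℝ) [IsFiniteMeasure ν] {τ : ℝ≥0∞}
    (hτ : τ ≤ ν Set.univ) : τ ≤ ν {t | ν (Set.Iio t) ≤ τ} := by
  set U : Set ℝ := {t | τ < ν (Set.Iio t)} with hU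
  have hUG : {t | ν (Set.Iio t) ≤ τ} = Uᶜ := by ext t; simp [hU]
  rw [hUG]
  -- `t ↦ ν (Iio t)` is left-continuous, so `U` contains a rational below each of its points. The
  -- complement of `U` then contains a countable monotone intersection of half-lines, each of mass
  -- above `τ`.
  have hleft : ∀ s ∈ U, ∃ q : ℚ, (q : ℝ) < s ∧ (q : ℝ) ∈ U := by
    intro s hs
    by_contra! hc
    have h1 : Set.Iio s = ⋃ q : {q : ℚ // (q : ℝ) < s}, Set.Iio (q.1 : ℝ) := by
      ext t
      simp only [Set.mem_Iio, Set.mem_iUnion, Subtype.exists, exists_prop]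
      refine ⟨fun h => ?_, fun ⟨q, hq, hq'⟩ => hq'.trans hq⟩
      obtain ⟨q, hq1, hq2⟩ := exists_rat_btwn h
      exact ⟨q, hq2, hq1⟩
    have h2 : ν (Set.Iio s) ≤ τ := by
      rw [h1, Monotone.measure_iUnion]
      · exact iSup_le fun q => by simpa [hU] using hc q.1 q.2
      · exact fun a b hab => Set.Iio_subset_Iio (by exact_mod_cast hab)
    exact absurd hs (not_lt.2 h2)
  rcases U.eq_empty_or_nonempty with h0 | ⟨t0, ht0⟩
  · rwa [h0, Set.compl_empty]
  · obtain ⟨q0, -, hq0⟩ := hleft t0 ht0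
    have : Nonempty {q : ℚ // (q : ℝ) ∈ U} := ⟨⟨q0, hq0⟩⟩
    have hsub : (⋂ q : {q : ℚ // (q : ℝ) ∈ U}, Set.Iio (q.1 : ℝ)) ⊆ Uᶜ := by
      intro s hs hsU
      obtain ⟨q, hq, hqU⟩ := hleft s hsU
      exact absurd (Set.mem_iInter.1 hs ⟨q, hqU⟩) (not_lt.2 hq.le)
    refine le_trans ?_ (measure_mono hsub)
    rw [Monotone.measure_iInter (fun a b hab => Set.Iio_subset_Iio (by exact_mod_cast hab))
      (fun q => measurableSet_Iio.nullMeasurableSet) ⟨⟨q0, hq0⟩, measure_ne_top _ _⟩]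
    exact le_iInf fun q => q.2.le

variable {d : ℕ}

/-- The cone of directions at distance less than `1 / 2` from `u`, without its apex. -/
def dirCone (u : Rd d) : Set (Rd d) := {v | v ≠ 0 ∧ ‖‖v‖⁻¹ • v - u‖ < 1 / 2}

lemma measurableSet_dirCone (u : Rd d) : MeasurableSet (dirCone u) := by
  have h : MeasurableSet {v : Rd d | ‖‖v‖⁻¹ • v - u‖ < 1 / 2} :=
    measurableSet_lt (by fun_prop) measurable_const
  exact (measurableSet_singleton (0 : Rd d)).compl.inter h

lemma exists_dirCone_cover (d : ℕ) : ∃ t : Finset (Rd d), ∀ v : Rd d, v ≠ 0 → ∃ u ∈ t, v ∈ dirCone u := by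
  obtain ⟨t, -, ht, hcov⟩ := finite_cover_balls_of_compact (isCompact_sphere (0 : Rd d) 1)
    (show (0 : ℝ) < 1 / 2 by norm_num)
  refine ⟨ht.toFinset, fun v hv => ?_⟩
  have hmem : ‖v‖⁻¹ • v ∈ Metric.sphere (0 : Rd d) 1 := by
    simp [norm_smul, norm_ne_zero_iff.2 hv]
  obtain ⟨u, hu, hvu⟩ := Set.mem_iUnion₂.1 (hcov hmem)
  exact ⟨u, ht.mem_toFinset.2 hu, hv, by rwa [Metric.mem_ball, dist_eq_norm] at hvu⟩

/-- Unit directions at distance below `1` make an angle below 60 degrees, so `2⟨v, w⟩ > ‖v‖‖w‖ ≥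
‖w‖²`: seen from `v`, the point `w` is closer than the apex. -/
lemma norm_sub_lt_of_mem_dirCone {u v w : Rd d} (hv : v ∈ dirCone u) (hw : w ∈ dirCone u)
    (h : ‖w‖ ≤ ‖v‖) : ‖v - w‖ < ‖v‖ := by
  have hv0 : 0 < ‖v‖ := norm_pos_iff.2 hv.1
  have hw0 : 0 < ‖w‖ := norm_pos_iff.2 hw.1
  have h1 : ‖‖v‖⁻¹ • v - ‖w‖⁻¹ • w‖ < 1 := by
    have e : ‖v‖⁻¹ • v - ‖w‖⁻¹ • w = (‖v‖⁻¹ • v - u) - (‖w‖⁻¹ • w - u) := by abel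
    rw [e]
    have := norm_sub_le (‖v‖⁻¹ • v - u) (‖w‖⁻¹ • w - u)
    linarith [hv.2, hw.2]
  have h2 : ‖‖v‖⁻¹ • v - ‖w‖⁻¹ • w‖ ^ 2 < 1 := by
    have := norm_nonneg (‖v‖⁻¹ • v - ‖w‖⁻¹ • w)
    nlinarith
  rw [norm_sub_sq_real, norm_smul, norm_smul, inner_smul_left, inner_smul_right] at h2
  simp only [norm_inv, norm_norm, inv_mul_cancel₀ hv0.ne', inv_mul_cancel₀ hw0.ne', conj_trivial] at h2
  have h3 : ‖v‖ * ‖w‖ < 2 * inner ℝ v w := by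
    have h4 : 1 < 2 * (‖v‖⁻¹ * (‖w‖⁻¹ * inner ℝ v w)) := by linarith
    have h5 := mul_lt_mul_of_pos_left h4 (mul_pos hv0 hw0)
    field_simp at h5
    linarith
  refine lt_of_pow_lt_pow_left₀ 2 hv0.le ?_
  rw [norm_sub_sq_real]
  nlinarith

/-- The points of the cone with apex `a` below the `τ`-quantile of the distance to `a`. -/
def coneQuantile (P : Measure (Rd d)) (τ : ℝ≥0∞) (u a : Rd d) : Set (Rd d) :=
  {z | z - a ∈ dirCone u ∧ P {w | w - a ∈ dirCone u ∧ ‖w - a‖ < ‖z - a‖} ≤ τ}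

lemma measurableSet_coneQuantile (P : Measure (Rd d)) [IsProbabilityMeasure P] (τ : ℝ≥0∞) (u : Rd d) :
    MeasurableSet {q : Rd d × Rd d | q.2 ∈ coneQuantile P τ u q.1} := by
  have h1 : MeasurableSet {q : Rd d × Rd d | q.2 - q.1 ∈ dirCone u} :=
    (measurable_snd.sub measurable_fst) (measurableSet_dirCone u)
  have h3 : MeasurableSet {q : (Rd d × Rd d) × Rd d | q.2 - q.1.1 ∈ dirCone u} :=
    (measurable_snd.sub (measurable_fst.comp measurable_fst)) (measurableSet_dirCone u)
  have h4 : MeasurableSet {q : (Rd d × Rd d) × Rd d | ‖q.2 - q.1.1‖ < ‖q.1.2 - q.1.1‖} :=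
    measurableSet_lt (by fun_prop) (by fun_prop)
  have h2 := measurable_measure_prodMk_left (ν := P) (h3.inter h4)
  exact h1.inter (measurableSet_le h2 measurable_const)

lemma measurableSet_coneQuantile_section (P : Measure (Rd d)) [IsProbabilityMeasure P] (τ : ℝ≥0∞)
    (u a : Rd d) : MeasurableSet (coneQuantile P τ u a) :=
  measurable_prodMk_left (measurableSet_coneQuantile P τ u)

lemma measurable_measure_cone (P : Measure (Rd d)) [IsProbabilityMeasure P] (u : Rd d) :
    Measurable fun a => P {w | w - a ∈ dirCone u} :=
  measurable_measure_prodMk_left (s := {q : Rd d × Rd d | q.2 - q.1 ∈ dirCone u})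
    ((measurable_snd.sub measurable_fst) (measurableSet_dirCone u))

/-- The one-dimensional quantile bound for the law of the distance to the apex, restricted to the
cone. Spheres may have positive mass. -/
lemma le_measure_coneQuantile (P : Measure (Rd d)) [IsProbabilityMeasure P] {τ : ℝ≥0∞} {u a : Rd d}
    (h : τ ≤ P {w | w - a ∈ dirCone u}) : τ ≤ P (coneQuantile P τ u a) := by
  have hm : Measurable fun w : Rd d => ‖w - a‖ := by fun_prop
  have hc : MeasurableSet {w : Rd d | w - a ∈ dirCone u} :=
    (measurable_id.sub_const a) (measurableSet_dirCone u)
  set ν : Measure ℝ := (P.restrict {w | w - a ∈ dirCone u}).map fun w => ‖w - a‖ with hν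
  have hIio : ∀ t, ν (Set.Iio t) = P {w | w - a ∈ dirCone u ∧ ‖w - a‖ < t} := fun t => by
    rw [hν, Measure.map_apply hm measurableSet_Iio, Measure.restrict_apply (hm measurableSet_Iio)]
    congr 1; ext w; exact and_comm
  have hG : MeasurableSet {t | ν (Set.Iio t) ≤ τ} := by
    have : Monotone fun t => ν (Set.Iio t) := fun a b hab => measure_mono (Set.Iio_subset_Iio hab)
    exact measurableSet_le this.measurable measurable_const
  have h1 := le_measure_setOf_measure_Iio_le ν (τ := τ) (by
    rw [hν, Measure.map_apply hm MeasurableSet.univ]; simpa using h)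
  refine h1.trans (le_of_eq ?_)
  conv_lhs => rw [hν]
  rw [Measure.map_apply hm hG, Measure.restrict_apply (hm hG)]
  congr 1
  ext w
  simp only [coneQuantile, ← hIio]
  exact and_comm

/-- If a Voronoi cell has a large mass in a cone, then the other points avoid a set of large mass. -/
lemma notMem_coneQuantile {n : ℕ} {P : Measure (Rd d)} {τ : ℝ≥0∞} {u : Rd d} {x : Fin n → Rd d}
    {i j : Fin n} (h : τ < P (voronoiCell x i ∩ {w | w - x i ∈ dirCone u})) :
    x j ∉ coneQuantile P τ u (x i) := by
  rintro ⟨h1, h2⟩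
  -- A sample point in the cone is nearer than the apex to all cone points at least as far out. The
  -- cell's part of the cone thus lies strictly inside the radius of `x j`, where the mass is at
  -- most `τ`.
  refine absurd (h.trans_le (measure_mono ?_)) (not_lt.2 h2)
  rintro w ⟨hw1, hw2⟩
  refine ⟨hw2, ?_⟩
  by_contra! hc
  have h3 := norm_sub_lt_of_mem_dirCone hw2 h1 hc
  rw [sub_sub_sub_cancel_right] at h3
  exact absurd (hw1 j) (not_le.2 h3)

lemma map_sample_eq_pi {n : ℕ} {S : Type*} [MeasurableSpace S] {μ : Measure S}
    [IsProbabilityMeasure μ] {P : Measure (Rd d)} {X : Fin n → S → Rd d} (hX : IsIIDSample μ X P) :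
    μ.map (fun ω i => X i ω) = Measure.pi fun _ => P := by
  rw [(iIndepFun_iff_map_fun_eq_pi_map fun i => (hX.measurable i).aemeasurable).1 hX.indep]
  simp only [hX.law]

/-- The event that the points `x j`, `j ≠ i`, avoid the set of `coneQuantile` with apex `x i`. -/
def avoidEvent (P : Measure (Rd d)) (τ : ℝ≥0∞) (u : Rd d) {n : ℕ} (i : Fin n) : Set (Fin n → Rd d) :=
  {x | τ ≤ P {w | w - x i ∈ dirCone u} ∧ ∀ j, j ≠ i → x j ∉ coneQuantile P τ u (x i)}

lemma measurableSet_avoidEvent (P : Measure (Rd d)) [IsProbabilityMeasure P] (τ : ℝ≥0∞) (u : Rd d)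
    {n : ℕ} (i : Fin n) : MeasurableSet (avoidEvent P τ u i) := by
  have h1 : MeasurableSet {x : Fin n → Rd d | τ ≤ P {w | w - x i ∈ dirCone u}} :=
    measurableSet_le measurable_const ((measurable_measure_cone P u).comp (measurable_pi_apply i))
  have h2 : {x : Fin n → Rd d | ∀ j, j ≠ i → x j ∉ coneQuantile P τ u (x i)} =
      ⋂ j, ⋂ (_ : j ≠ i), {x | x j ∉ coneQuantile P τ u (x i)} := by ext; simp
  suffices h3 : MeasurableSet {x : Fin n → Rd d | ∀ j, j ≠ i → x j ∉ coneQuantile P τ u (x i)} from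
    h1.inter h3
  rw [h2]
  refine MeasurableSet.iInter fun j => MeasurableSet.iInter fun _ => ?_
  have h4 : Measurable fun x : Fin n → Rd d => (x i, x j) :=
    (measurable_pi_apply i).prodMk (measurable_pi_apply j)
  exact (h4 (measurableSet_coneQuantile P τ u)).compl

/-- Condition on the `i`-th point: the other `n` points are independent, and each avoids a set of
mass at least `τ`. -/
lemma pi_avoidEvent_le (P : Measure (Rd d)) [IsProbabilityMeasure P] (τ : ℝ≥0∞) (u : Rd d)
    {n : ℕ} (i : Fin (n + 1)) :
    (Measure.pi fun _ => P) (avoidEvent P τ u i) ≤ (1 - τ) ^ n := by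
  set H : Set (Rd d × (Fin n → Rd d)) :=
    {q | τ ≤ P {w | w - q.1 ∈ dirCone u} ∧ ∀ j, q.2 j ∉ coneQuantile P τ u q.1} with hH
  have hHm : MeasurableSet H := by
    have h1 : MeasurableSet {q : Rd d × (Fin n → Rd d) | τ ≤ P {w | w - q.1 ∈ dirCone u}} :=
      measurableSet_le measurable_const ((measurable_measure_cone P u).comp measurable_fst)
    have h2 : {q : Rd d × (Fin n → Rd d) | ∀ j, q.2 j ∉ coneQuantile P τ u q.1} =
      ⋂ j, {q | q.2 j ∉ coneQuantile P τ u q.1} := by ext; simp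
    suffices h3 : MeasurableSet {q : Rd d × (Fin n → Rd d) | ∀ j, q.2 j ∉ coneQuantile P τ u q.1} from
      h1.inter h3
    rw [h2]
    refine MeasurableSet.iInter fun j => ?_
    have h4 : Measurable fun q : Rd d × (Fin n → Rd d) => (q.1, q.2 j) :=
      measurable_fst.prodMk ((measurable_pi_apply j).comp measurable_snd)
    exact (h4 (measurableSet_coneQuantile P τ u)).compl
  have hmp := measurePreserving_piFinSuccAbove (fun _ : Fin (n + 1) => P) i
  have hpre : avoidEvent P τ u i = MeasurableEquiv.piFinSuccAbove (fun _ => Rd d) i ⁻¹' H := by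
    ext x
    simp only [avoidEvent, hH, Set.mem_preimage, Set.mem_ofPred_eq,
      MeasurableEquiv.piFinSuccAbove_apply, Fin.insertNthEquiv_symm_apply]
    refine and_congr_right fun _ => ⟨fun h j => h _ (Fin.succAbove_ne i j), fun h j hj => ?_⟩
    obtain ⟨k, rfl⟩ := Fin.exists_succAbove_eq hj
    exact h k
  rw [hpre, hmp.measure_preimage hHm.nullMeasurableSet, Measure.prod_apply hHm]
  calc ∫⁻ a, (Measure.pi fun _ : Fin n => P) (Prod.mk a ⁻¹' H) ∂P ≤ ∫⁻ _a, (1 - τ) ^ n ∂P := by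
        refine lintegral_mono fun a => ?_
        by_cases ha : τ ≤ P {w | w - a ∈ dirCone u}
        · have : Prod.mk a ⁻¹' H = Set.univ.pi fun _ => (coneQuantile P τ u a)ᶜ := by
            ext b; simp [hH, ha]
          rw [this, Measure.pi_pi]
          simp only [Finset.prod_const, Finset.card_univ, Fintype.card_fin]
          refine pow_le_pow_left' ?_ n
          rw [prob_compl_eq_one_sub (measurableSet_coneQuantile_section P τ u a)]
          exact tsub_le_tsub_left (le_measure_coneQuantile P ha) 1
        · have : Prod.mk a ⁻¹' H = ∅ := by ext b; simp [hH, ha]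
          simp [this]
    _ = _ := by simp

/-- With high probability, all Voronoi cells of a sample have mass of order `log n / n`. -/
lemma exists_voronoi_bound (d : ℕ) : ∃ k : ℕ, ∀ n : ℕ, 2 ≤ n →
    ∀ (P : Measure (Rd d)) [IsProbabilityMeasure P], (∀ x, P {x} = 0) →
    ∀ (S : Type*) [MeasurableSpace S] (μ : Measure S) [IsProbabilityMeasure μ]
      (X : Fin n → S → Rd d), IsIIDSample μ X P →
      ∃ E : Set S, MeasurableSet E ∧ μ E ≤ ENNReal.ofReal (k * ((n : ℝ) ^ 4)⁻¹) ∧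
        ∀ ω ∉ E, ∀ i, P (voronoiCell (fun j => X j ω) i) ≤
          ENNReal.ofReal (k * (10 * Real.log n / n)) := by
  obtain ⟨t, ht⟩ := exists_dirCone_cover d
  refine ⟨t.card, fun n hn P _ hna S _ μ _ X hX => ?_⟩
  have hn2 : (2 : ℝ) ≤ n := by exact_mod_cast hn
  have hn0 : (0 : ℝ) < n := by linarith
  have hlog : 0 ≤ Real.log n := Real.log_nonneg (by linarith)
  -- Since `n - 1 ≥ n / 2`, the constant `10` gives `(1 - τ)^(n-1) ≤ n⁻⁵`; the union over `n` points
  -- leaves `n⁻⁴`.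
  set τ : ℝ≥0∞ := ENNReal.ofReal (10 * Real.log n / n) with hτ
  have hXm : Measurable fun ω i => X i ω := measurable_pi_lambda _ hX.measurable
  refine ⟨⋃ i, ⋃ u ∈ t, (fun ω i => X i ω) ⁻¹' avoidEvent P τ u i, ?_, ?_, ?_⟩
  · exact MeasurableSet.iUnion fun i => Finset.measurableSet_biUnion _ fun u _ =>
      hXm (measurableSet_avoidEvent P τ u i)
  · have h1 : ∀ (i : Fin n) u, μ ((fun ω i => X i ω) ⁻¹' avoidEvent P τ u i) ≤
        ENNReal.ofReal (((n : ℝ) ^ 5)⁻¹) := by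
      intro i u
      rw [← Measure.map_apply hXm (measurableSet_avoidEvent P τ u i), map_sample_eq_pi hX]
      obtain ⟨k, rfl⟩ : ∃ k, n = k + 1 := ⟨n - 1, by omega⟩
      refine (pi_avoidEvent_le P τ u i).trans ?_
      have h2 : 1 - τ ≤ ENNReal.ofReal (Real.exp (-(10 * Real.log ↑(k + 1) / ↑(k + 1)))) := by
        rw [hτ, ← ENNReal.ofReal_one, ← ENNReal.ofReal_sub _ (by positivity)]
        refine ENNReal.ofReal_le_ofReal ?_
        linarith [Real.add_one_le_exp (-(10 * Real.log ↑(k + 1) / ↑(k + 1)))]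
      refine (pow_le_pow_left' h2 k).trans ?_
      rw [← ENNReal.ofReal_pow (Real.exp_pos _).le, ← Real.exp_nat_mul]
      refine ENNReal.ofReal_le_ofReal ?_
      have h3 : ((((k + 1 : ℕ) : ℝ)) ^ 5)⁻¹ = Real.exp (-(5 * Real.log ↑(k + 1))) := by
        rw [Real.exp_neg, show 5 * Real.log ↑(k + 1) = ((5 : ℕ) : ℝ) * Real.log ↑(k + 1) by norm_num,
          Real.exp_nat_mul, Real.exp_log hn0]
      rw [h3]
      refine Real.exp_le_exp.2 ?_
      rw [mul_neg, neg_le_neg_iff, ← mul_div_assoc, le_div_iff₀ hn0]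
      push_cast at hn2 hlog ⊢
      nlinarith
    calc μ (⋃ i, ⋃ u ∈ t, (fun ω i => X i ω) ⁻¹' avoidEvent P τ u i)
        ≤ ∑ i, ∑ u ∈ t, μ ((fun ω i => X i ω) ⁻¹' avoidEvent P τ u i) :=
          (measure_iUnion_fintype_le _ _).trans (Finset.sum_le_sum fun i _ =>
            measure_biUnion_finset_le _ _)
      _ ≤ ∑ _i : Fin n, ∑ _u ∈ t, ENNReal.ofReal (((n : ℝ) ^ 5)⁻¹) :=
          Finset.sum_le_sum fun i _ => Finset.sum_le_sum fun u _ => h1 i u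
      _ = ENNReal.ofReal (∑ _i : Fin n, ∑ _u ∈ t, (((n : ℝ) ^ 5)⁻¹)) := by
          rw [ENNReal.ofReal_sum_of_nonneg fun i _ => by positivity]
          exact Finset.sum_congr rfl fun i _ =>
            (ENNReal.ofReal_sum_of_nonneg fun u _ => by positivity).symm
      _ ≤ _ := by
          refine ENNReal.ofReal_le_ofReal (le_of_eq ?_)
          simp only [Finset.sum_const, Finset.card_univ, Fintype.card_fin, nsmul_eq_mul]
          field_simp
  · intro ω hω i
    simp only [Set.mem_iUnion, not_exists] at hω
    have h1 : ∀ u ∈ t, P (voronoiCell (fun j => X j ω) i ∩ {w | w - X i ω ∈ dirCone u}) ≤ τ := by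
      intro u hu
      by_contra! hc
      refine hω i u hu ⟨hc.le.trans (measure_mono Set.inter_subset_right), fun j _ => ?_⟩
      exact notMem_coneQuantile (x := fun j => X j ω) hc
    -- The cones cover everything but the apex, which is null because `P` has no atoms.
    have hsub : voronoiCell (fun j => X j ω) i ⊆ {X i ω} ∪
        ⋃ u ∈ t, (voronoiCell (fun j => X j ω) i ∩ {w | w - X i ω ∈ dirCone u}) := by
      intro w hw
      by_cases h : w = X i ω
      · exact Or.inl h
      · obtain ⟨u, hu, hwu⟩ := ht (w - X i ω) (sub_ne_zero.2 h)
        exact Or.inr (Set.mem_iUnion₂.2 ⟨u, hu, hw, hwu⟩)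
    calc _ ≤ P {X i ω} + ∑ u ∈ t, P (voronoiCell (fun j => X j ω) i ∩ {w | w - X i ω ∈ dirCone u}) :=
          (measure_mono hsub).trans ((measure_union_le _ _).trans
            (add_le_add_right (measure_biUnion_finset_le _ _) _))
      _ ≤ 0 + ∑ _u ∈ t, τ := add_le_add (hna _).le (Finset.sum_le_sum h1)
      _ = _ := by
          rw [zero_add, Finset.sum_const, nsmul_eq_mul, hτ, ENNReal.ofReal_mul (by positivity)]
          simp

end Voronoi

/-! ### Nearest-neighbor distance and the loss of the 1NN map. -/

section NearestNeighbor

variable {d : ℕ}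

lemma isIIDSample_of_map_eq_pi {n : ℕ} {S : Type*} [MeasurableSpace S] {μ : Measure S}
    [IsProbabilityMeasure μ] {P : Measure (Rd d)} [IsProbabilityMeasure P] {X : Fin n → S → Rd d}
    (hX : ∀ i, Measurable (X i)) (h : μ.map (fun ω i => X i ω) = Measure.pi fun _ => P) :
    IsIIDSample μ X P := by
  have hlaw : ∀ i, μ.map (X i) = P := fun i => by
    rw [← (measurePreserving_eval (fun _ : Fin n => P) i).map_eq, ← h,
      Measure.map_map (measurable_pi_apply i) (measurable_pi_lambda _ hX)]
    rfl
  refine ⟨hX, ?_, hlaw⟩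
  rw [iIndepFun_iff_map_fun_eq_pi_map fun i => (hX i).aemeasurable, h]
  simp only [hlaw]

lemma IsIIDSample.map {n : ℕ} {S : Type*} [MeasurableSpace S] {μ : Measure S}
    {P : Measure (Rd d)} {X : Fin n → S → Rd d} (hX : IsIIDSample μ X P) {f : Rd d → Rd d}
    (hf : Measurable f) : IsIIDSample μ (fun i ω => f (X i ω)) (P.map f) :=
  ⟨fun i => hf.comp (hX.measurable i), hX.indep.comp (fun _ => f) fun _ => hf, fun i => by
    rw [← hX.law i, Measure.map_map hf (hX.measurable i)]; rfl⟩

lemma ofReal_transportCost {n m : ℕ} {x : Fin n → Rd d} {y : Fin m → Rd d} {γ : Fin n → Fin m → ℝ}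
    (hγ : IsCouplingMatrix γ) : ENNReal.ofReal (transportCost x y γ) =
      ∑ i, ∑ j, ENNReal.ofReal (γ i j) * ‖x i - y j‖ₑ ^ 2 := by
  have h0 : ∀ i j, 0 ≤ γ i j * ‖x i - y j‖ ^ 2 := fun i j => mul_nonneg (hγ.nonneg i j) (by positivity)
  rw [transportCost, ENNReal.ofReal_sum_of_nonneg fun i _ => Finset.sum_nonneg fun j _ => h0 i j]
  refine Finset.sum_congr rfl fun i _ => ?_
  rw [ENNReal.ofReal_sum_of_nonneg fun j _ => h0 i j]
  refine Finset.sum_congr rfl fun j _ => ?_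
  rw [ENNReal.ofReal_mul (hγ.nonneg i j), ENNReal.ofReal_pow (norm_nonneg _), ofReal_norm]

/-- The mean squared distance to the nearest sample point is of order `n ^ (-2 / d)`. -/
lemma exists_nearestNeighbor_bound (hd : 4 < d) {r M : ℝ} (hr : 4 < r) (hM : 0 < M) :
    ∃ C : ℝ, 0 < C ∧ ∀ n : ℕ, 0 < n → ∀ (P : Measure (Rd d)) [IsProbabilityMeasure P],
      ∫⁻ x, ‖x‖ₑ ^ r ∂P ≤ ENNReal.ofReal (M ^ r) →
      ∀ (S : Type*) [MeasurableSpace S] (μ : Measure S) [IsProbabilityMeasure μ]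
        (X : Fin n → S → Rd d), IsIIDSample μ X P →
        ∫⁻ ω, ∫⁻ z, ⨅ i, ‖z - X i ω‖ₑ ^ 2 ∂P ∂μ ≤
          ENNReal.ofReal (C * (n : ℝ) ^ (-(2 : ℝ) / d)) := by
  obtain ⟨C, hC, h⟩ := exists_coupling_empirical hd hr hM
  refine ⟨2 * C, by positivity, fun n hn P _ hmom S _ μ _ X hX => ?_⟩
  -- Adjoin an independent ghost sample. In any coupling with the original sample, each ghost point
  -- pays at least its squared nearest-neighbor distance, whose expectation is the required
  -- integral.
  set ν : Measure (S × (Fin n → Rd d)) := μ.prod (Measure.pi fun _ => P) with hν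
  have hX1 : IsIIDSample ν (fun i q => X i q.1) P := by
    refine isIIDSample_of_map_eq_pi (fun i => (hX.measurable i).comp measurable_fst) ?_
    have hXm : Measurable fun ω i => X i ω := measurable_pi_lambda _ hX.measurable
    rw [← map_sample_eq_pi hX]
    conv_rhs => rw [← (measurePreserving_fst (μ := μ) (ν := Measure.pi fun _ : Fin n => P)).map_eq]
    rw [Measure.map_map hXm measurable_fst]; rfl
  have hX2 : IsIIDSample ν (fun i q => q.2 i) P := by
    refine isIIDSample_of_map_eq_pi (fun i => (measurable_pi_apply i).comp measurable_snd) ?_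
    exact (measurePreserving_snd (μ := μ) (ν := Measure.pi fun _ : Fin n => P)).map_eq
  obtain ⟨B, hB, hBi, hBc⟩ := h n n hn hn P hmom _ ν _ _ hX2 hX1
  set g : S → Rd d → ℝ≥0∞ := fun ω z => ⨅ i, ‖z - X i ω‖ₑ ^ 2 with hg
  have hgm : Measurable (Function.uncurry g) := by
    refine Measurable.iInf fun i => ?_
    have h1 : Measurable fun q : S × Rd d => X i q.1 := (hX.measurable i).comp measurable_fst
    have h2 : Measurable fun q : S × Rd d => q.2 - X i q.1 := measurable_snd.sub h1
    exact h2.enorm.pow_const 2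
  have hgi : ∀ ω z i, g ω z ≤ ‖z - X i ω‖ₑ ^ 2 := fun ω z i => iInf_le _ i
  change ∫⁻ ω, ∫⁻ z, g ω z ∂P ∂μ ≤ ENNReal.ofReal (2 * C * (n : ℝ) ^ (-(2 : ℝ) / d))
  clear_value g
  have hle : ∀ q : S × (Fin n → Rd d), ∑ k, ENNReal.ofReal (1 / n) * g q.1 (q.2 k) ≤ B q := by
    intro q
    obtain ⟨γ, hγ, hγB⟩ := hBc q
    refine le_trans ?_ hγB
    rw [ofReal_transportCost hγ]
    refine Finset.sum_le_sum fun k _ => ?_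
    rw [← hγ.row k, ENNReal.ofReal_sum_of_nonneg fun j _ => hγ.nonneg k j, Finset.sum_mul]
    exact Finset.sum_le_sum fun i _ => mul_le_mul_right (hgi _ _ i) _
  have hgk : ∀ k, Measurable fun q : S × (Fin n → Rd d) => g q.1 (q.2 k) := fun k => by
    have h3 : Measurable fun q : S × (Fin n → Rd d) => (q.1, q.2 k) :=
      measurable_fst.prodMk ((measurable_pi_apply k).comp measurable_snd)
    exact hgm.comp h3
  have hint : ∀ k, ∫⁻ q, g q.1 (q.2 k) ∂ν = ∫⁻ ω, ∫⁻ z, g ω z ∂P ∂μ := by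
    intro k
    rw [hν, lintegral_prod _ (hgk k).aemeasurable]
    refine lintegral_congr fun ω => ?_
    exact (measurePreserving_eval (fun _ : Fin n => P) k).lintegral_comp
      (hgm.comp measurable_prodMk_left)
  have hsum : ∑ _k : Fin n, ENNReal.ofReal (1 / (n : ℝ)) = 1 := by
    rw [← ENNReal.ofReal_sum_of_nonneg fun i _ => by positivity]
    simp [hn.ne']
  calc ∫⁻ ω, ∫⁻ z, g ω z ∂P ∂μ = ∫⁻ q, ∑ k, ENNReal.ofReal (1 / n) * g q.1 (q.2 k) ∂ν := by
        rw [lintegral_finsetSum _ fun k _ => (hgk k).const_mul _]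
        simp only [lintegral_const_mul _ (hgk _), hint]
        rw [← Finset.sum_mul, hsum, one_mul]
    _ ≤ ∫⁻ q, B q ∂ν := lintegral_mono hle
    _ ≤ _ := hBi
    _ = ENNReal.ofReal (2 * C * (n : ℝ) ^ (-(2 : ℝ) / d)) := by rw [otRate]; congr 1; ring

lemma norm_sq_sum_smul_le {ι : Type*} (s : Finset ι) (w : ι → ℝ) (v : ι → Rd d)
    (hw : ∀ i ∈ s, 0 ≤ w i) (hw1 : ∑ i ∈ s, w i = 1) :
    ‖∑ i ∈ s, w i • v i‖ ^ 2 ≤ ∑ i ∈ s, w i * ‖v i‖ ^ 2 := by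
  have hc : ConvexOn ℝ Set.univ fun v : Rd d => ‖v‖ ^ 2 :=
    (convexOn_norm convex_univ).pow (fun _ _ => norm_nonneg _) 2
  simpa using hc.map_sum_le hw hw1 fun _ _ => Set.mem_univ _

/-- The loss of a nearest-neighbor map, in terms of the transport cost and of the distance to the
nearest neighbor. -/
lemma lintegral_oneNNMap_le {n m : ℕ} (hn : 0 < n) {P : Measure (Rd d)} {x : Fin n → Rd d}
    {y : Fin m → Rd d} {p : Fin n → Fin m → ℝ} (hp : IsCouplingMatrix p) {W : Fin n → Set (Rd d)}
    (hWm : ∀ i, MeasurableSet (W i)) (hW : IsVoronoiPartition P x W) {T₀ : Rd d → Rd d} {β : ℝ}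
    (hT : ∀ u v, ‖T₀ u - T₀ v‖ ≤ β * ‖u - v‖) {κ : ℝ} (hκ : 0 ≤ κ)
    (hPW : ∀ i, P (W i) ≤ ENNReal.ofReal κ) :
    ∫⁻ z, ‖oneNNMap p W y z - T₀ z‖ₑ ^ 2 ∂P ≤
      ENNReal.ofReal (2 * (κ * n) * transportCost (fun i => T₀ (x i)) y p) +
        ENNReal.ofReal (2 * β ^ 2) * ∫⁻ z, ⨅ i, ‖z - x i‖ₑ ^ 2 ∂P := by
  have hn' : (0 : ℝ) < n := Nat.cast_pos.2 hn
  -- The barycentric projection of the coupling, which is the a.e. value of the map on `W i`.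
  set t : Fin n → Rd d := fun i => ∑ j, ((n : ℝ) * p i j) • y j with ht
  set g : Rd d → ℝ≥0∞ := fun z => ⨅ i, ‖z - x i‖ₑ ^ 2 with hg
  have hgm : Measurable g := Measurable.iInf fun i => by fun_prop
  have hval : ∀ i, ∀ᵐ z ∂(P.restrict (W i)), oneNNMap p W y z = t i := by
    intro i
    rw [ae_restrict_iff' (hWm i)]
    have h1 : ∀ᵐ z ∂P, ∀ j, j ≠ i → z ∉ W i ∩ W j := by
      rw [ae_all_iff]
      intro j
      by_cases h : j = i
      · simp [h]
      · filter_upwards [measure_eq_zero_iff_ae_notMem.1 (hW.disjoint i j (Ne.symm h))] with z hz _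
        exact hz
    filter_upwards [h1] with z hz hzi
    rw [oneNNMap, Finset.sum_eq_single i]
    · simp [ht, hzi]
    · intro j _ hj
      have : z ∉ W j := fun hzj => hz j hj ⟨hzi, hzj⟩
      simp [this]
    · simp
  have hpt : ∀ i, ∀ z ∈ W i, ‖t i - T₀ z‖ₑ ^ 2 ≤
      ENNReal.ofReal (2 * ‖t i - T₀ (x i)‖ ^ 2) + ENNReal.ofReal (2 * β ^ 2) * g z := by
    intro i z hz
    have h1 : g z = ENNReal.ofReal (‖z - x i‖ ^ 2) := by
      rw [ENNReal.ofReal_pow (norm_nonneg _), ofReal_norm]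
      refine le_antisymm (iInf_le _ i) (le_iInf fun j => ?_)
      rw [← ofReal_norm, ← ofReal_norm]
      gcongr
      exact hW.subset i hz j
    rw [h1, ← ENNReal.ofReal_mul (by positivity), ← ENNReal.ofReal_add (by positivity) (by positivity),
      ← ofReal_norm, ← ENNReal.ofReal_pow (norm_nonneg _)]
    refine ENNReal.ofReal_le_ofReal ?_
    have h2 : ‖t i - T₀ z‖ ≤ ‖t i - T₀ (x i)‖ + β * ‖z - x i‖ := by
      have e : t i - T₀ z = (t i - T₀ (x i)) - (T₀ z - T₀ (x i)) := by abel
      rw [e]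
      exact (norm_sub_le _ _).trans (add_le_add_right (hT _ _) _)
    have h3 : ‖t i - T₀ z‖ ^ 2 ≤ (‖t i - T₀ (x i)‖ + β * ‖z - x i‖) ^ 2 := by gcongr
    nlinarith [sq_nonneg (‖t i - T₀ (x i)‖ - β * ‖z - x i‖)]
  -- Jensen's inequality: the weights `n * p i j` sum to one over `j`.
  have hjensen : ∀ i, ‖t i - T₀ (x i)‖ ^ 2 ≤ n * ∑ j, p i j * ‖T₀ (x i) - y j‖ ^ 2 := by
    intro i
    have hw1 : ∑ j, (n : ℝ) * p i j = 1 := by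
      rw [← Finset.mul_sum, hp.row]; field_simp
    have e : t i - T₀ (x i) = ∑ j, ((n : ℝ) * p i j) • (y j - T₀ (x i)) := by
      simp only [smul_sub, Finset.sum_sub_distrib, ← Finset.sum_smul, hw1, one_smul, ht]
    rw [e]
    refine (norm_sq_sum_smul_le _ _ _ (fun j _ => mul_nonneg hn'.le (hp.nonneg i j)) hw1).trans
      (le_of_eq ?_)
    rw [Finset.mul_sum]
    exact Finset.sum_congr rfl fun j _ => by rw [norm_sub_rev]; ring
  have hcov : ∫⁻ z, ‖oneNNMap p W y z - T₀ z‖ₑ ^ 2 ∂P =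
      ∫⁻ z in ⋃ i, W i, ‖oneNNMap p W y z - T₀ z‖ₑ ^ 2 ∂P := by
    rw [Measure.restrict_eq_self_of_ae_mem]
    filter_upwards [measure_eq_zero_iff_ae_notMem.1 hW.cover] with z hz
    simpa using hz
  have hcell : ∀ i, ∫⁻ z in W i, ‖oneNNMap p W y z - T₀ z‖ₑ ^ 2 ∂P ≤
      ENNReal.ofReal (2 * (κ * n) * ∑ j, p i j * ‖T₀ (x i) - y j‖ ^ 2) +
        ENNReal.ofReal (2 * β ^ 2) * ∫⁻ z in W i, g z ∂P := by
    intro i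
    calc ∫⁻ z in W i, ‖oneNNMap p W y z - T₀ z‖ₑ ^ 2 ∂P
        ≤ ∫⁻ z in W i, (ENNReal.ofReal (2 * ‖t i - T₀ (x i)‖ ^ 2) +
            ENNReal.ofReal (2 * β ^ 2) * g z) ∂P := by
          refine lintegral_mono_ae ?_
          filter_upwards [hval i, ae_restrict_mem (hWm i)] with z hz hzi
          rw [hz]; exact hpt i z hzi
      _ = ENNReal.ofReal (2 * ‖t i - T₀ (x i)‖ ^ 2) * P (W i) +
          ENNReal.ofReal (2 * β ^ 2) * ∫⁻ z in W i, g z ∂P := by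
          rw [lintegral_add_left measurable_const, lintegral_const_mul _ hgm, lintegral_const,
            Measure.restrict_apply_univ]
      _ ≤ _ := by
          gcongr
          refine (mul_le_mul_right (hPW i) _).trans ?_
          rw [← ENNReal.ofReal_mul (by positivity)]
          refine ENNReal.ofReal_le_ofReal ?_
          have := mul_le_mul_of_nonneg_left (hjensen i) (show 0 ≤ 2 * κ by positivity)
          linarith
  have hsum0 : ∀ i, 0 ≤ 2 * (κ * n) * ∑ j, p i j * ‖T₀ (x i) - y j‖ ^ 2 := fun i =>
    mul_nonneg (by positivity) (Finset.sum_nonneg fun j _ => mul_nonneg (hp.nonneg i j) (by positivity))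
  calc _ ≤ ∑ i, ∫⁻ z in W i, ‖oneNNMap p W y z - T₀ z‖ₑ ^ 2 ∂P := by
        rw [hcov, ← tsum_fintype (L := .unconditional _)]; exact lintegral_iUnion_le _ _
    _ ≤ _ := Finset.sum_le_sum fun i _ => hcell i
    _ = ENNReal.ofReal (2 * (κ * n) * transportCost (fun i => T₀ (x i)) y p) +
          ENNReal.ofReal (2 * β ^ 2) * ∫⁻ z in ⋃ i, W i, g z ∂P := by
        rw [Finset.sum_add_distrib, transportCost, Finset.mul_sum Finset.univ _ (2 * (κ * n)),
          ENNReal.ofReal_sum_of_nonneg fun i _ => hsum0 i, ← Finset.mul_sum]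
        congr 2
        rw [lintegral_iUnion₀ (fun i => (hWm i).nullMeasurableSet) (fun i j hij => hW.disjoint i j hij),
          tsum_fintype]
    _ ≤ _ := by gcongr; exact Measure.restrict_le_self

end NearestNeighbor

/-! ### Assembly of the upper bound. -/

section UpperBound

variable {d : ℕ}

/-- The mean fourth moments of two families of points. -/
noncomputable def meanFourth {n m : ℕ} (x : Fin n → Rd d) (y : Fin m → Rd d) : ℝ :=
  ∑ i, ∑ j, 1 / ((n : ℝ) * m) * (‖x i‖ ^ 4 + ‖y j‖ ^ 4)

lemma meanFourth_nonneg {n m : ℕ} (x : Fin n → Rd d) (y : Fin m → Rd d) : 0 ≤ meanFourth x y :=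
  Finset.sum_nonneg fun i _ => Finset.sum_nonneg fun j _ => by positivity

lemma isCouplingMatrix_uniform {n m : ℕ} (hn : 0 < n) (hm : 0 < m) :
    IsCouplingMatrix fun (_ : Fin n) (_ : Fin m) => 1 / ((n : ℝ) * m) := by
  have hn' : (n : ℝ) ≠ 0 := by positivity
  have hm' : (m : ℝ) ≠ 0 := by positivity
  refine ⟨fun _ _ => by positivity, fun _ => ?_, fun _ => ?_⟩ <;>
  · simp only [Finset.sum_const, Finset.card_univ, Fintype.card_fin, nsmul_eq_mul]
    field_simp

/-- For the event of probability `O(n⁻⁴)` with large cells. Splitting `n T ≤ n³ + T² / n` leaves a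
deterministic term, which the event turns into `O(1/n)`, and a moment term that is `O(1/n)` without
using the event. -/
lemma mul_transportCost_uniform_le {n m : ℕ} (hn : 0 < n) (hm : 0 < m) (x : Fin n → Rd d)
    (y : Fin m → Rd d) : n * transportCost x y (fun _ _ => 1 / ((n : ℝ) * m)) ≤
      (n : ℝ) ^ 3 + 8 / n * meanFourth x y := by
  have hn' : (0 : ℝ) < n := Nat.cast_pos.2 hn
  have hm' : (0 : ℝ) < m := Nat.cast_pos.2 hm
  have hpt : ∀ i j, n * ‖x i - y j‖ ^ 2 ≤ (n : ℝ) ^ 3 + 8 / n * (‖x i‖ ^ 4 + ‖y j‖ ^ 4) := by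
    intro i j
    have h1 : ‖x i - y j‖ ≤ ‖x i‖ + ‖y j‖ := norm_sub_le _ _
    have h2 : ‖x i - y j‖ ^ 2 ≤ 2 * (‖x i‖ ^ 2 + ‖y j‖ ^ 2) := by
      have : ‖x i - y j‖ ^ 2 ≤ (‖x i‖ + ‖y j‖) ^ 2 := by gcongr
      nlinarith [sq_nonneg (‖x i‖ - ‖y j‖)]
    have h3 : (‖x i - y j‖ ^ 2) ^ 2 ≤ 8 * (‖x i‖ ^ 4 + ‖y j‖ ^ 4) := by
      have : (‖x i - y j‖ ^ 2) ^ 2 ≤ (2 * (‖x i‖ ^ 2 + ‖y j‖ ^ 2)) ^ 2 := by gcongr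
      nlinarith [sq_nonneg (‖x i‖ ^ 2 - ‖y j‖ ^ 2)]
    set T := ‖x i - y j‖ ^ 2 with hT
    have h4 : n * T ≤ (n : ℝ) ^ 3 + T ^ 2 / n := by
      rw [← sub_nonneg]
      have : (n : ℝ) ^ 3 + T ^ 2 / n - n * T = ((n ^ 2 - T) ^ 2 + n ^ 2 * T) / n := by
        field_simp; ring
      rw [this]; positivity
    have h5 : T ^ 2 / n ≤ 8 / n * (‖x i‖ ^ 4 + ‖y j‖ ^ 4) := by
      rw [div_mul_eq_mul_div]; gcongr
    linarith
  have hone : ∑ _i : Fin n, ∑ _j : Fin m, 1 / ((n : ℝ) * m) * (n : ℝ) ^ 3 = (n : ℝ) ^ 3 := by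
    simp only [Finset.sum_const, Finset.card_univ, Fintype.card_fin, nsmul_eq_mul]
    field_simp
  calc _ = ∑ i, ∑ j, 1 / ((n : ℝ) * m) * (n * ‖x i - y j‖ ^ 2) := by
        rw [transportCost, Finset.mul_sum]
        refine Finset.sum_congr rfl fun i _ => ?_
        rw [Finset.mul_sum]
        exact Finset.sum_congr rfl fun j _ => by ring
    _ ≤ ∑ i, ∑ j, (1 / ((n : ℝ) * m) * (n : ℝ) ^ 3 +
          8 / n * (1 / ((n : ℝ) * m) * (‖x i‖ ^ 4 + ‖y j‖ ^ 4))) := by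
        refine Finset.sum_le_sum fun i _ => Finset.sum_le_sum fun j _ => ?_
        have := mul_le_mul_of_nonneg_left (hpt i j) (show 0 ≤ 1 / ((n : ℝ) * m) by positivity)
        linarith
    _ = _ := by
        simp only [Finset.sum_add_distrib, ← Finset.mul_sum]
        rw [meanFourth]
        simp only [Finset.sum_add_distrib, ← Finset.mul_sum] at hone ⊢
        rw [hone]

lemma lintegral_meanFourth_le {S : Type*} [MeasurableSpace S] {μ : Measure S} {n m : ℕ}
    (hn : 0 < n) (hm : 0 < m) {Q : Measure (Rd d)} [IsProbabilityMeasure Q] {r M : ℝ} (hr : 4 < r)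
    (hM : 0 < M) (hmom : ∫⁻ x, ‖x‖ₑ ^ r ∂Q ≤ ENNReal.ofReal (M ^ r)) {X : Fin n → S → Rd d}
    {Y : Fin m → S → Rd d} (hX : IsIIDSample μ X Q) (hY : IsIIDSample μ Y Q) :
    ∫⁻ ω, ENNReal.ofReal (meanFourth (fun i => X i ω) (fun j => Y j ω)) ∂μ ≤
      ENNReal.ofReal (2 * (1 + M ^ r)) := by
  have h4 : ∫⁻ x, ENNReal.ofReal (‖x‖ ^ 4) ∂Q ≤ ENNReal.ofReal (1 + M ^ r) := by
    rw [ENNReal.ofReal_add zero_le_one (by positivity), ENNReal.ofReal_one]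
    refine le_trans (le_of_eq (lintegral_congr fun x => ?_))
      (lintegral_enorm_rpow_le (s := 4) (by norm_num) hr.le hmom)
    rw [ENNReal.ofReal_pow (norm_nonneg _), ofReal_norm, ← ENNReal.rpow_natCast]; norm_num
  have hm4 : Measurable fun x : Rd d => ENNReal.ofReal (‖x‖ ^ 4) := by fun_prop
  have hmX : ∀ i, Measurable fun ω => ENNReal.ofReal (‖X i ω‖ ^ 4) := fun i =>
    hm4.comp (hX.measurable i)
  have hmY : ∀ j, Measurable fun ω => ENNReal.ofReal (‖Y j ω‖ ^ 4) := fun j =>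
    hm4.comp (hY.measurable j)
  have hX4 : ∀ i, ∫⁻ ω, ENNReal.ofReal (‖X i ω‖ ^ 4) ∂μ ≤ ENNReal.ofReal (1 + M ^ r) := fun i => by
    rw [← lintegral_map hm4 (hX.measurable i), hX.law i]; exact h4
  have hY4 : ∀ j, ∫⁻ ω, ENNReal.ofReal (‖Y j ω‖ ^ 4) ∂μ ≤ ENNReal.ofReal (1 + M ^ r) := fun j => by
    rw [← lintegral_map hm4 (hY.measurable j), hY.law j]; exact h4
  have e : ∀ ω, ENNReal.ofReal (meanFourth (fun i => X i ω) (fun j => Y j ω)) =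
      ∑ i, ∑ j, ENNReal.ofReal (1 / ((n : ℝ) * m)) *
        (ENNReal.ofReal (‖X i ω‖ ^ 4) + ENNReal.ofReal (‖Y j ω‖ ^ 4)) := by
    intro ω
    rw [meanFourth, ENNReal.ofReal_sum_of_nonneg fun i _ =>
      Finset.sum_nonneg fun j _ => by positivity]
    refine Finset.sum_congr rfl fun i _ => ?_
    rw [ENNReal.ofReal_sum_of_nonneg fun j _ => by positivity]
    refine Finset.sum_congr rfl fun j _ => ?_
    rw [ENNReal.ofReal_mul (by positivity), ENNReal.ofReal_add (by positivity) (by positivity)]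
  have hmij : ∀ i j, Measurable fun ω => ENNReal.ofReal (1 / ((n : ℝ) * m)) *
        (ENNReal.ofReal (‖X i ω‖ ^ 4) + ENNReal.ofReal (‖Y j ω‖ ^ 4)) := fun i j =>
    ((hmX i).add (hmY j)).const_mul _
  have hm' : (m : ℝ) ≠ 0 := by positivity
  simp only [e]
  rw [lintegral_finsetSum _ fun i _ => Finset.measurable_sum _ fun j _ => hmij i j]
  calc _ ≤ ∑ _i : Fin n, ∑ _j : Fin m, ENNReal.ofReal (1 / ((n : ℝ) * m) * (2 * (1 + M ^ r))) := by
        refine Finset.sum_le_sum fun i _ => ?_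
        rw [lintegral_finsetSum _ fun j _ => hmij i j]
        refine Finset.sum_le_sum fun j _ => ?_
        have hij : Measurable fun ω =>
          ENNReal.ofReal (‖X i ω‖ ^ 4) + ENNReal.ofReal (‖Y j ω‖ ^ 4) := (hmX i).add (hmY j)
        rw [lintegral_const_mul _ hij, lintegral_add_left (hmX i),
          ENNReal.ofReal_mul (by positivity), two_mul, ENNReal.ofReal_add (by positivity) (by positivity)]
        exact mul_le_mul_right (add_le_add (hX4 i) (hY4 j)) _
    _ = _ := by
        simp only [Finset.sum_const, Finset.card_univ, Fintype.card_fin, nsmul_eq_mul]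
        rw [← ENNReal.ofReal_natCast n, ← ENNReal.ofReal_natCast m,
          ← ENNReal.ofReal_mul (by positivity), ← ENNReal.ofReal_mul (by positivity)]
        congr 1
        field_simp

/-- Only the good event produces the logarithm, through the cell masses; the other terms are
`O(n^(-2/d))` and are absorbed with `log n ≥ log 2`. -/
theorem oneNN_risk_le (hd : 4 < d) {r M α β : ℝ} (hr : 4 < r) (hM : 0 < M) (hα : 0 < α)
    (hβ : 0 < β) :
    ∃ C : ℝ, 0 < C ∧ ∀ n m : ℕ, 2 ≤ n → 1 ≤ m →
      ∀ (P Q : Measure (Rd d)) (φ : Rd d → ℝ), InModel r M α β P Q φ →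
      ∀ (S : Type*) [MeasurableSpace S] (μ : Measure S) [IsProbabilityMeasure μ]
        (X : Fin n → S → Rd d) (Y : Fin m → S → Rd d) (T : S → Rd d → Rd d),
        IsIIDSample μ X P → IsIIDSample μ Y Q → IsOneNNEstimator μ P X Y T →
        risk μ P T (∇ φ) ≤ ENNReal.ofReal (C * otRate d n m * Real.log n) := by
  obtain ⟨C₁, hC₁, hemp⟩ := exists_coupling_empirical hd hr hM
  obtain ⟨C₂, hC₂, hnn⟩ := exists_nearestNeighbor_bound hd hr hM
  obtain ⟨k, hvor⟩ := exists_voronoi_bound d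
  have hlog2 : 0 < Real.log 2 := Real.log_pos one_lt_two
  have hMr : 0 < M ^ r := by positivity
  refine ⟨20 * k * (β / α) * C₁ + (2 * (β / α) * k + 16 * (β / α) * (2 * (1 + M ^ r)) +
    2 * β ^ 2 * C₂) / Real.log 2, by positivity, ?_⟩
  rintro n m hn2 hm P Q φ hmod S _ μ _ X Y T hX hY ⟨p, W, -, hWm, hpo, hWo, hT⟩
  have := hmod.probP
  have := hmod.probQ
  have hn : 0 < n := by omega
  have hn' : (2 : ℝ) ≤ n := by exact_mod_cast hn2
  have hn0 : (0 : ℝ) < n := by linarith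
  have hlip := hmod.a2.norm_gradient_sub_le hβ hmod.a1 hα
  have hTm : Measurable (∇ φ) := by
    have : LipschitzWith (Real.toNNReal β) (∇ φ) := LipschitzWith.of_dist_le_mul fun x y => by
      rw [dist_eq_norm, dist_eq_norm, Real.coe_toNNReal _ hβ.le]; exact hlip x y
    exact this.continuous.measurable
  -- The transported sample has the law of `Y`, so the two-sample bound for a single law applies.
  have hTX : IsIIDSample μ (fun i ω => ∇ φ (X i ω)) Q := by
    rw [← hmod.map_gradient hr hα hβ]; exact hX.map hTm
  obtain ⟨B, hBm, hBi, hBc⟩ := hemp n m hn hm Q hmod.momentQ S μ _ _ hTX hY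
  obtain ⟨E, hEm, hE, hEc⟩ := hvor n hn2 P hmod.nonatomic S μ X hX
  have hNN := hnn n hn P hmod.momentP S μ X hX
  have hlog : 0 ≤ Real.log n := Real.log_nonneg (by linarith)
  set D : S → ℝ := fun ω => transportCost (fun i => ∇ φ (X i ω)) (fun j => Y j ω) (p ω) with hD
  set Z : S → ℝ := fun ω => meanFourth (fun i => ∇ φ (X i ω)) (fun j => Y j ω) with hZ
  have hpt : ∀ᵐ ω ∂μ, ∫⁻ z, ‖T ω z - ∇ φ z‖ₑ ^ 2 ∂P ≤
      ENNReal.ofReal (20 * k * (β / α) * Real.log n) * B ω +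
      (E.indicator (fun _ => ENNReal.ofReal (2 * (β / α) * n ^ 3)) ω +
      (ENNReal.ofReal (16 * (β / α) / n) * ENNReal.ofReal (Z ω) +
      ENNReal.ofReal (2 * β ^ 2) * ∫⁻ z, ⨅ i, ‖z - X i ω‖ₑ ^ 2 ∂P)) := by
    filter_upwards [hpo, hWo] with ω hp hW
    have hWω : ∀ i, MeasurableSet (W ω i) := fun i => measurable_prodMk_left (hWm i)
    have hstab := fun q (hq : IsCouplingMatrix q) =>
      stability_optimal_coupling hmod.a1 hmod.a2 hα hβ _ _ hp hq
    simp only [hT ω]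
    by_cases hω : ω ∈ E
    -- On the bad event, bound cell masses by `1` and compare with the uniform coupling.
    · refine (lintegral_oneNNMap_le hn hp.coupling hWω hW hlip zero_le_one fun i => ?_).trans ?_
      · rw [ENNReal.ofReal_one]; exact prob_le_one
      · rw [← add_assoc (E.indicator _ _), Set.indicator_of_mem hω]
        refine le_trans ?_ le_add_self
        refine add_le_add_left ?_ _
        rw [← ENNReal.ofReal_mul (by positivity), ← ENNReal.ofReal_add (by positivity)
          (mul_nonneg (by positivity) (meanFourth_nonneg _ _))]
        refine ENNReal.ofReal_le_ofReal ?_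
        have h1 := mul_le_mul_of_nonneg_left (hstab _ (isCouplingMatrix_uniform hn hm)) hn0.le
        have h2 := mul_le_mul_of_nonneg_left
          (mul_transportCost_uniform_le hn hm (fun i => ∇ φ (X i ω)) (fun j => Y j ω))
          (show 0 ≤ 2 * (β / α) by positivity)
        have e : 2 * (β / α) * ((n : ℝ) ^ 3 + 8 / n * Z ω) =
          2 * (β / α) * n ^ 3 + 16 * (β / α) / n * Z ω := by ring
        rw [← e]
        refine le_trans ?_ h2
        linarith
    · have hκ : (0 : ℝ) ≤ k * (10 * Real.log n / n) := by positivity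
      refine (lintegral_oneNNMap_le hn hp.coupling hWω hW hlip hκ fun i =>
        (measure_mono (hW.subset i)).trans (hEc ω hω i)).trans ?_
      rw [← add_assoc (E.indicator _ _)]
      refine (add_le_add ?_ le_rfl).trans (add_le_add le_rfl le_add_self)
      obtain ⟨γ, hγ, hγB⟩ := hBc ω
      refine le_trans ?_ (mul_le_mul_right hγB _)
      rw [← ENNReal.ofReal_mul (by positivity)]
      refine ENNReal.ofReal_le_ofReal ?_
      have h1 := mul_le_mul_of_nonneg_left (hstab _ hγ)
        (show 0 ≤ 2 * (k * (10 * Real.log n / n) * n) by positivity)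
      refine h1.trans (le_of_eq ?_)
      field_simp
      ring
  have hZm : Measurable fun ω => ENNReal.ofReal (Z ω) := by
    refine ENNReal.measurable_ofReal.comp (Finset.measurable_sum _ fun i _ =>
      Finset.measurable_sum _ fun j _ => ?_)
    exact (((hTX.measurable i).norm.pow_const 4).add ((hY.measurable j).norm.pow_const 4)).const_mul _
  have hIm : Measurable (E.indicator fun _ : S => ENNReal.ofReal (2 * (β / α) * n ^ 3)) :=
    measurable_const.indicator hEm
  have hrate : (n : ℝ) ^ (-(2 : ℝ) / d) ≤ otRate d n m := by
    rw [otRate]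
    have : (0 : ℝ) ≤ (m : ℝ) ^ (-(2 : ℝ) / d) := by positivity
    linarith
  have hinv : (n : ℝ)⁻¹ ≤ (n : ℝ) ^ (-(2 : ℝ) / d) := by
    rw [← Real.rpow_neg_one]
    refine Real.rpow_le_rpow_of_exponent_le (by linarith) ?_
    have hd' : (4 : ℝ) < d := by exact_mod_cast hd
    rw [neg_div, neg_le_neg_iff, div_le_one (by linarith)]
    linarith
  have hR0 : 0 ≤ otRate d n m := le_trans (by positivity) hrate
  rw [risk]
  calc _ ≤ ∫⁻ ω, _ ∂μ := lintegral_mono_ae hpt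
    _ ≤ ENNReal.ofReal (20 * k * (β / α) * Real.log n) * ENNReal.ofReal (C₁ * otRate d n m) +
      (ENNReal.ofReal (2 * (β / α) * n ^ 3) * ENNReal.ofReal (k * ((n : ℝ) ^ 4)⁻¹) +
      (ENNReal.ofReal (16 * (β / α) / n) * ENNReal.ofReal (2 * (1 + M ^ r)) +
      ENNReal.ofReal (2 * β ^ 2) * ENNReal.ofReal (C₂ * (n : ℝ) ^ (-(2 : ℝ) / d)))) := by
        rw [lintegral_add_left (hBm.const_mul _), lintegral_add_left hIm,
          lintegral_add_left (hZm.const_mul _), lintegral_const_mul _ hBm,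
          lintegral_const_mul _ hZm, lintegral_indicator_const hEm,
          lintegral_const_mul' _ _ ENNReal.ofReal_ne_top]
        gcongr
        exact lintegral_meanFourth_le hn hm hr hM hmod.momentQ hTX hY
    _ = ENNReal.ofReal (20 * k * (β / α) * Real.log n * (C₁ * otRate d n m) +
      (2 * (β / α) * n ^ 3 * (k * ((n : ℝ) ^ 4)⁻¹) +
      (16 * (β / α) / n * (2 * (1 + M ^ r)) + 2 * β ^ 2 * (C₂ * (n : ℝ) ^ (-(2 : ℝ) / d))))) := by
        have a1 : 0 ≤ 20 * k * (β / α) * Real.log n := by positivity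
        have a2 : 0 ≤ 2 * (β / α) * (n : ℝ) ^ 3 := by positivity
        have a3 : 0 ≤ 16 * (β / α) / (n : ℝ) := by positivity
        have a4 : 0 ≤ 2 * β ^ 2 := by positivity
        rw [← ENNReal.ofReal_mul a1, ← ENNReal.ofReal_mul a2, ← ENNReal.ofReal_mul a3,
          ← ENNReal.ofReal_mul a4, ← ENNReal.ofReal_add (by positivity) (by positivity),
          ← ENNReal.ofReal_add (by positivity) (by positivity),
          ← ENNReal.ofReal_add (by positivity) (by positivity)]
    _ ≤ _ := by
        refine ENNReal.ofReal_le_ofReal ?_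
        have hll : Real.log 2 ≤ Real.log n := Real.log_le_log two_pos hn'
        set A := 2 * (β / α) * k + 16 * (β / α) * (2 * (1 + M ^ r)) + 2 * β ^ 2 * C₂ with hA
        have hA0 : 0 ≤ A := by positivity
        have e1 : 2 * (β / α) * (n : ℝ) ^ 3 * (k * ((n : ℝ) ^ 4)⁻¹) = 2 * (β / α) * k * (n : ℝ)⁻¹ := by
          field_simp
        have e2 : 16 * (β / α) / (n : ℝ) * (2 * (1 + M ^ r)) =
          16 * (β / α) * (2 * (1 + M ^ r)) * (n : ℝ)⁻¹ := by ring
        rw [e1, e2]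
        have hinv' := hinv.trans hrate
        have b1 : 2 * (β / α) * k * (n : ℝ)⁻¹ ≤ 2 * (β / α) * k * otRate d n m := by gcongr
        have b2 : 16 * (β / α) * (2 * (1 + M ^ r)) * (n : ℝ)⁻¹ ≤
          16 * (β / α) * (2 * (1 + M ^ r)) * otRate d n m := by gcongr
        have b3 : 2 * β ^ 2 * (C₂ * (n : ℝ) ^ (-(2 : ℝ) / d)) ≤
          2 * β ^ 2 * (C₂ * otRate d n m) := by gcongr
        have b4 : A * otRate d n m ≤ A / Real.log 2 * otRate d n m * Real.log n := by
          have h1 : A / Real.log 2 * otRate d n m * Real.log 2 = A * otRate d n m := by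
            field_simp
          rw [← h1]
          gcongr
        rw [hA] at b4 ⊢
        linarith

end UpperBound

/-! ### Perturbed quadratic potentials and their semi-dual optimality. -/

section Potentials

variable {d : ℕ}

/-- A bump function which is linear with gradient `e` near the origin. -/
lemma exists_linear_bump (e : Rd d) : ∃ (g : Rd d → ℝ) (v : Rd d → Rd d) (L : ℝ), 0 < L ∧
    (∀ x, HasGradientAt g (v x) x) ∧ (∀ x y, ‖v x - v y‖ ≤ L * ‖x - y‖) ∧
    (∀ x, 1 / 2 ≤ ‖x‖ → v x = 0) ∧ ∀ x, ‖x‖ < 1 / 4 → v x = e := by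
  -- An outer radius strictly below `1 / 2` makes `g` vanish in a neighborhood of points of norm `1
  -- / 2`, so the gradient vanishes there too.
  let χ : ContDiffBump (0 : Rd d) := ⟨1 / 4, 3 / 8, by norm_num, by norm_num⟩
  set g : Rd d → ℝ := fun x => inner ℝ e x * χ x with hg
  have hgs : ContDiff ℝ 2 g := (contDiff_const.inner ℝ contDiff_id).mul χ.contDiff
  have hgc : HasCompactSupport g := χ.hasCompactSupport.mul_left
  have hdc : HasCompactSupport (fderiv ℝ g) := hgc.fderiv ℝ
  obtain ⟨C, hC⟩ := (hgs.fderiv_right (m := 1) (by norm_num)).lipschitzWith_of_hasCompactSupport hdc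
    (by norm_num)
  have hgd : Differentiable ℝ g := hgs.differentiable (by norm_num)
  refine ⟨g, ∇ g, C + 1, by positivity, fun x => (hgd x).hasGradientAt, fun x y => ?_, fun x hx => ?_,
    fun x hx => ?_⟩
  · rw [gradient, gradient, ← map_sub, LinearIsometryEquiv.norm_map, ← dist_eq_norm]
    refine (hC.dist_le_mul x y).trans ?_
    rw [dist_eq_norm]
    have := norm_nonneg (x - y)
    nlinarith
  · have h : g =ᶠ[nhds x] fun _ => 0 := by
      have ho : IsOpen {z : Rd d | 3 / 8 < ‖z‖} := isOpen_lt continuous_const continuous_norm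
      filter_upwards [ho.mem_nhds (show 3 / 8 < ‖x‖ by linarith)] with z hz
      have : χ z = 0 := χ.zero_of_le_dist (by rw [dist_zero_right]; exact le_of_lt hz)
      simp [hg, this]
    rw [h.gradient_eq, gradient_fun_const]
  · have h : g =ᶠ[nhds x] fun z => inner ℝ e z := by
      filter_upwards [Metric.isOpen_ball.mem_nhds (show x ∈ Metric.ball (0 : Rd d) (1 / 4) by simpa using hx)]
        with z hz
      have : χ z = 1 := χ.one_of_mem_closedBall (Metric.ball_subset_closedBall hz)
      simp [hg, this]
    rw [h.gradient_eq]
    refine HasGradientAt.gradient ?_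
    rw [hasGradientAt_iff_hasFDerivAt]
    exact (innerSL ℝ e).hasFDerivAt

/-- A sum of Lipschitz maps with disjoint supports. -/
lemma norm_sum_sub_sum_le {ι : Type*} [Fintype ι] [Nonempty ι] {w : ι → Rd d → Rd d} {K : ℝ}
    (hK : 0 ≤ K) (hw : ∀ i x y, ‖w i x - w i y‖ ≤ K * ‖x - y‖)
    (hdisj : ∀ x i j, i ≠ j → w i x = 0 ∨ w j x = 0) (x y : Rd d) :
    ‖∑ i, w i x - ∑ i, w i y‖ ≤ 2 * K * ‖x - y‖ := by
  have hex : ∀ z, ∃ i, ∀ j, j ≠ i → w j z = 0 := by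
    intro z
    by_cases h : ∃ i, w i z ≠ 0
    · obtain ⟨i, hi⟩ := h
      exact ⟨i, fun j hj => (hdisj z j i hj).resolve_right hi⟩
    · push Not at h
      exact ⟨Classical.arbitrary ι, fun j _ => h j⟩
  obtain ⟨i, hi⟩ := hex x
  obtain ⟨j, hj⟩ := hex y
  rw [Finset.sum_eq_single i (fun k _ hk => hi k hk) (by simp),
    Finset.sum_eq_single j (fun k _ hk => hj k hk) (by simp)]
  have hp : 0 ≤ K * ‖x - y‖ := by positivity
  by_cases hij : i = j
  · subst hij
    linarith [hw i x y]
  -- The inserted values `w i y` and `w j x` are both zero; the two differences cause the factor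
  -- `2`.
  · have e : w i x - w j y = (w i x - w i y) + (w j x - w j y) := by
      rw [hj i hij, hi j (Ne.symm hij)]; abel
    rw [e]
    refine (norm_add_le _ _).trans ?_
    linarith [hw i x y, hw j x y]

/-- Mean value inequality on the ball of radius `‖y - x‖`. The constant is `K` instead of the sharp
`K / 2`, which is why `conds_of_perturbation` asks for a margin of `2 * K`. -/
lemma abs_sub_inner_le_of_lipschitz_gradient {G : Rd d → ℝ} {w : Rd d → Rd d} {K : ℝ}
    (hK : 0 ≤ K) (hG : ∀ x, HasGradientAt G (w x) x) (hw : ∀ x y, ‖w x - w y‖ ≤ K * ‖x - y‖)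
    (x y : Rd d) : |G y - G x - inner ℝ (w x) (y - x)| ≤ K * ‖y - x‖ ^ 2 := by
  have h := (convex_closedBall x ‖y - x‖).norm_image_sub_le_of_norm_hasFDerivWithin_le'
    (f := G) (f' := fun z => InnerProductSpace.toDual ℝ (Rd d) (w z))
    (φ := InnerProductSpace.toDual ℝ (Rd d) (w x)) (C := K * ‖y - x‖)
    (fun z _ => (hG z).hasFDerivAt.hasFDerivWithinAt)
    (fun z hz => by
      rw [← map_sub, LinearIsometryEquiv.norm_map]
      refine (hw z x).trans ?_
      rw [Metric.mem_closedBall, dist_eq_norm] at hz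
      gcongr)
    (Metric.mem_closedBall_self (norm_nonneg _)) (y := y) (by simp [dist_eq_norm])
  rw [InnerProductSpace.toDual_apply_apply, Real.norm_eq_abs] at h
  refine h.trans (le_of_eq ?_)
  ring

/-- Apply the lower bound at the barycenter: the linear terms cancel and a positive quadratic term
survives. -/
lemma strictConvexOn_of_lower {φ : Rd d → ℝ} {w : Rd d → Rd d} {α : ℝ} (hα : 0 < α)
    (h : ∀ x y : Rd d, φ x + inner ℝ (w x) (y - x) + α / 2 * ‖y - x‖ ^ 2 ≤ φ y) :
    StrictConvexOn ℝ Set.univ φ := by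
  refine ⟨convex_univ, fun x _ y _ hxy a b ha hb hab => ?_⟩
  set z := a • x + b • y with hz
  have h1 := mul_le_mul_of_nonneg_left (h z x) ha.le
  have h2 := mul_le_mul_of_nonneg_left (h z y) hb.le
  have e0 : a • (x - z) + b • (y - z) = 0 := by
    rw [smul_sub, smul_sub, sub_add_sub_comm, ← add_smul, hab, one_smul, sub_self]
  have e1 : a * inner ℝ (w z) (x - z) + b * inner ℝ (w z) (y - z) = 0 := by
    rw [← inner_smul_right, ← inner_smul_right, ← inner_add_right, e0, inner_zero_right]
  have e2 : x - z = b • (x - y) := by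
    have : b = 1 - a := by linarith
    rw [hz, this]; module
  have hpos : 0 < ‖x - z‖ := by
    rw [e2, norm_pos_iff]
    exact smul_ne_zero hb.ne' (sub_ne_zero.2 hxy)
  have h3 : 0 < a * (α / 2 * ‖x - z‖ ^ 2) := by positivity
  have h4 : 0 ≤ b * (α / 2 * ‖y - z‖ ^ 2) := by positivity
  have e3 : a * φ z + b * φ z = φ z := by rw [← add_mul, hab, one_mul]
  simp only [smul_eq_mul]
  linarith

lemma conds_of_perturbation {α β κ K : ℝ} (hα : 0 < α) (hK : 0 ≤ K) (hlo : α ≤ κ - 2 * K)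
    (hhi : κ + 2 * K ≤ β) {G : Rd d → ℝ} {w : Rd d → Rd d}
    (hG : ∀ x, HasGradientAt G (w x) x) (hw : ∀ x y, ‖w x - w y‖ ≤ K * ‖x - y‖)
    {φ : Rd d → ℝ} (hφ : ∀ x, φ x = κ / 2 * ‖x‖ ^ 2 + G x) :
    CondA1 α φ ∧ CondA2 β φ ∧ StrictConvexOn ℝ Set.univ φ ∧ ∀ x, ∇ φ x = κ • x + w x := by
  have hgrad : ∀ x, HasGradientAt φ (κ • x + w x) x := by
    intro x
    have h1 : HasFDerivAt (fun x : Rd d => κ / 2 * ‖x‖ ^ 2)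
        ((κ / 2) • (2 • innerSL ℝ x)) x := (hasStrictFDerivAt_norm_sq x).hasFDerivAt.const_mul _
    have h2 := h1.add (hG x).hasFDerivAt
    rw [hasGradientAt_iff_hasFDerivAt]
    have e : φ = (fun x : Rd d => κ / 2 * ‖x‖ ^ 2) + G := funext hφ
    rw [e]
    refine h2.congr_fderiv ?_
    ext y
    simp
    ring
  have hgr : ∀ x, ∇ φ x = κ • x + w x := fun x => (hgrad x).gradient
  have hexp : ∀ x y : Rd d, φ y - (φ x + inner ℝ (∇ φ x) (y - x)) =
      κ / 2 * ‖y - x‖ ^ 2 + (G y - G x - inner ℝ (w x) (y - x)) := by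
    intro x y
    rw [hgr, hφ, hφ, inner_add_left, inner_smul_left, norm_sub_sq_real, inner_sub_right,
      real_inner_self_eq_norm_sq, real_inner_comm x y]
    simp only [conj_trivial]
    ring
  have hlower : ∀ x y : Rd d, φ x + inner ℝ (∇ φ x) (y - x) + α / 2 * ‖y - x‖ ^ 2 ≤ φ y := by
    intro x y
    have h1 := (abs_le.1 (abs_sub_inner_le_of_lipschitz_gradient hK hG hw x y)).1
    have h2 := hexp x y
    have h3 : α * ‖y - x‖ ^ 2 ≤ (κ - 2 * K) * ‖y - x‖ ^ 2 := by gcongr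
    linarith
  have hupper : ∀ x y : Rd d, φ y ≤ φ x + inner ℝ (∇ φ x) (y - x) + β / 2 * ‖y - x‖ ^ 2 := by
    intro x y
    have h1 := (abs_le.1 (abs_sub_inner_le_of_lipschitz_gradient hK hG hw x y)).2
    have h2 := hexp x y
    have h3 : (κ + 2 * K) * ‖y - x‖ ^ 2 ≤ β * ‖y - x‖ ^ 2 := by gcongr
    linarith
  have hsc := strictConvexOn_of_lower hα hlower
  have hwc : Continuous w := by
    have : LipschitzWith (Real.toNNReal K) w := LipschitzWith.of_dist_le_mul fun x y => by
      rw [dist_eq_norm, dist_eq_norm, Real.coe_toNNReal _ hK]; exact hw x y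
    exact this.continuous
  have hcd : ContDiff ℝ 1 φ := by
    rw [contDiff_one_iff_fderiv]
    refine ⟨fun x => (hgrad x).differentiableAt, ?_⟩
    have : fderiv ℝ φ = fun x => InnerProductSpace.toDual ℝ (Rd d) (κ • x + w x) :=
      funext fun x => (hgrad x).hasFDerivAt.fderiv
    rw [this]
    exact (InnerProductSpace.toDual ℝ (Rd d)).continuous.comp
      ((continuous_id.const_smul κ).add hwc)
  exact ⟨⟨hsc.convexOn, hcd, hlower⟩, ⟨hsc.convexOn, hcd, hupper⟩, hsc, hgr⟩

lemma measurable_fenchelConj (φ : Rd d → ℝ) : Measurable (fenchelConj φ) := by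
  refine LowerSemicontinuous.measurable (lowerSemicontinuous_iSup fun x => ?_)
  refine Continuous.lowerSemicontinuous (continuous_coe_real_ereal.comp ?_)
  fun_prop

lemma extIntegral_map {P : Measure (Rd d)} {T : Rd d → Rd d} (hT : Measurable T)
    {f : Rd d → EReal} (hf : Measurable f) :
    extIntegral (P.map T) f = extIntegral P fun x => f (T x) := by
  have hf' : Measurable fun y => -f y := continuous_neg.measurable.comp hf
  rw [extIntegral, extIntegral, lintegral_map hf.ereal_toENNReal hT,
    lintegral_map hf'.ereal_toENNReal hT]

/-- A convex potential minimizes the semi-dual functional for its own push-forward. -/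
lemma isSemidualMinimizer_map_gradient {P : Measure (Rd d)} {φ : Rd d → ℝ}
    (hlow : ∀ x y : Rd d, φ x + inner ℝ (∇ φ x) (y - x) ≤ φ y) (hT : Measurable (∇ φ))
    (hφ : Integrable φ P) (hin : Integrable (fun x => inner ℝ x (∇ φ x)) P) :
    IsSemidualMinimizer P (P.map (∇ φ)) φ := by
  refine ⟨hφ, fun ψ hψ => ?_⟩
  -- Fenchel–Young is an equality along the graph of the gradient, while any competitor `ψ`
  -- satisfies the inequality there.
  have hconj : ∀ x, fenchelConj φ (∇ φ x) = ((inner ℝ x (∇ φ x) - φ x : ℝ) : EReal) := by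
    intro x
    refine le_antisymm (iSup_le fun z => EReal.coe_le_coe_iff.2 ?_) (le_iSup_of_le x le_rfl)
    have := hlow x z
    rw [inner_sub_right, real_inner_comm, real_inner_comm x] at this
    linarith
  have h1 : semidual P (P.map (∇ φ)) φ = ((∫ x, inner ℝ x (∇ φ x) ∂P : ℝ) : EReal) := by
    rw [semidual, extIntegral_map hT (measurable_fenchelConj φ)]
    simp only [hconj]
    rw [extIntegral_coe (f := fun x => inner ℝ x (∇ φ x) - φ x) (hin.sub hφ), integral_sub hin hφ, ← EReal.coe_add]
    congr 1; ring
  have h2 : ((∫ x, (inner ℝ x (∇ φ x) - ψ x) ∂P : ℝ) : EReal) ≤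
      extIntegral (P.map (∇ φ)) (fenchelConj ψ) := by
    rw [extIntegral_map hT (measurable_fenchelConj ψ), 
      ← extIntegral_coe (f := fun x => inner ℝ x (∇ φ x) - ψ x) (hin.sub hψ)]
    exact extIntegral_mono fun x => le_iSup_of_le x le_rfl
  rw [h1]
  refine le_trans (le_of_eq ?_) (add_le_add_right h2 _)
  rw [integral_sub hin hψ, ← EReal.coe_add]
  congr 1; ring

end Potentials

/-! ### Assouad's lemma on a common latent space. -/

section Assouad

/-- Assouad's bound: if flipping one bit of the parameter `τ` leaves the data unchanged on an event of
probability at least `η`, then the worst-case risk is bounded below. -/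
lemma assouad_bound {ι Z Ω : Type*} [Fintype ι] [DecidableEq ι] [MeasurableSpace Z] (ρ : Measure Z)
    (D : (ι → Bool) → Z → Ω) (E : ι → Set Z) (hEm : ∀ j, MeasurableSet (E j))
    (hD : ∀ τ j, ∀ z ∈ E j, D (Function.update τ j (!τ j)) z = D τ z) (ℓ : ι → Bool → Ω → ℝ≥0∞)
    (hℓ : ∀ j b τ, Measurable fun z => ℓ j b (D τ z)) {s η R : ℝ≥0∞}
    (hs : ∀ j ω, s ≤ ℓ j false ω + ℓ j true ω) (hE : ∀ j, η ≤ ρ (E j))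
    (hR : ∀ τ, ∫⁻ z, ∑ j, ℓ j (τ j) (D τ z) ∂ρ ≤ R) : Fintype.card ι * (s * η) ≤ 2 * R := by
  set A : ι → (ι → Bool) → ℝ≥0∞ := fun j τ => ∫⁻ z, ℓ j (τ j) (D τ z) ∂ρ with hA
  -- On `E j` both parameters produce the same data, so their losses are taken at the same point and
  -- add up to at least `s`.
  have hpair : ∀ j τ, s * η ≤ A j τ + A j (Function.update τ j (!τ j)) := by
    intro j τ
    have hs' : ∀ ω, s ≤ ℓ j (τ j) ω + ℓ j (!τ j) ω := fun ω => by
      cases τ j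
      · exact hs j ω
      · rw [add_comm]; exact hs j ω
    calc s * η ≤ s * ρ (E j) := by gcongr; exact hE j
      _ = ∫⁻ _z in E j, s ∂ρ := by rw [setLIntegral_const]
      _ ≤ ∫⁻ z in E j, (ℓ j (τ j) (D τ z) + ℓ j (!τ j) (D τ z)) ∂ρ := lintegral_mono fun z => hs' _
      _ = ∫⁻ z in E j, ℓ j (τ j) (D τ z) ∂ρ + ∫⁻ z in E j, ℓ j (!τ j) (D τ z) ∂ρ :=
          lintegral_add_left (hℓ j _ τ) _
      _ ≤ _ := by
          refine add_le_add (setLIntegral_le_lintegral _ _) ?_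
          refine le_trans (le_of_eq ?_) (setLIntegral_le_lintegral (E j) _)
          refine setLIntegral_congr_fun (hEm j) fun z hz => ?_
          simp only [Function.update_self, hD τ j z hz]
  have hflip : ∀ j, Function.Involutive fun τ : ι → Bool => Function.update τ j (!τ j) := by
    intro j τ
    simp
  have hsumflip : ∀ j, ∑ τ, A j (Function.update τ j (!τ j)) = ∑ τ, A j τ := fun j =>
    Equiv.sum_comp (Function.Involutive.toPerm _ (hflip j)) (A j)
  have h1 : (Fintype.card (ι → Bool) : ℝ≥0∞) * (Fintype.card ι * (s * η)) ≤
      Fintype.card (ι → Bool) * (2 * R) := by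
    calc _ = ∑ _j : ι, ∑ _τ : ι → Bool, s * η := by
          simp only [Finset.sum_const, Finset.card_univ, nsmul_eq_mul]; ring
      _ ≤ ∑ j, ∑ τ, (A j τ + A j (Function.update τ j (!τ j))) :=
          Finset.sum_le_sum fun j _ => Finset.sum_le_sum fun τ _ => hpair j τ
      _ = 2 * ∑ τ, ∑ j, A j τ := by
          simp only [Finset.sum_add_distrib, hsumflip]
          rw [Finset.sum_comm, two_mul]
      _ = 2 * ∑ τ, ∫⁻ z, ∑ j, ℓ j (τ j) (D τ z) ∂ρ := by
          congr 1
          exact Finset.sum_congr rfl fun τ _ => (lintegral_finsetSum _ fun j _ => hℓ j _ τ).symm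
      _ ≤ 2 * ∑ _τ : ι → Bool, R := by gcongr with τ; exact hR τ
      _ = _ := by
          simp only [Finset.sum_const, Finset.card_univ, nsmul_eq_mul]; ring
  have h0 : (Fintype.card (ι → Bool) : ℝ≥0∞) ≠ 0 := Nat.cast_ne_zero.2 Fintype.card_ne_zero
  exact (ENNReal.mul_le_mul_iff_right h0 (ENNReal.natCast_ne_top _)).1 h1

end Assouad

/-! ### The latent variables: a random segment and a position on it. -/

section Latent

variable {ι : Type*} [Fintype ι] [MeasurableSpace ι]

/-- A uniform index together with an independent uniform variable in `[0, 1]`. -/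
noncomputable def segLatent (ι : Type*) [Fintype ι] [MeasurableSpace ι] : Measure (ι × ℝ) :=
  ((Fintype.card ι : ℝ≥0∞)⁻¹ • Measure.count).prod (volume.restrict (Set.Icc 0 1))

lemma isProbabilityMeasure_uniformCount [Nonempty ι] :
    IsProbabilityMeasure ((Fintype.card ι : ℝ≥0∞)⁻¹ • (Measure.count : Measure ι)) :=
  ⟨by
    simp only [Measure.smul_apply, Measure.count_univ, ENat.card_eq_coe_fintype_card, smul_eq_mul]
    exact ENNReal.inv_mul_cancel (Nat.cast_ne_zero.2 Fintype.card_ne_zero) (ENNReal.natCast_ne_top _)⟩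

lemma isProbabilityMeasure_restrict_unitInterval :
    IsProbabilityMeasure ((volume : Measure ℝ).restrict (Set.Icc 0 1)) := ⟨by simp⟩

instance [Nonempty ι] : IsProbabilityMeasure (segLatent ι) := by
  have := isProbabilityMeasure_uniformCount (ι := ι)
  have := isProbabilityMeasure_restrict_unitInterval
  unfold segLatent
  infer_instance

lemma lintegral_segLatent [MeasurableSingletonClass ι] {f : ι × ℝ → ℝ≥0∞} (hf : Measurable f) :
    ∫⁻ q, f q ∂(segLatent ι) =
      (Fintype.card ι : ℝ≥0∞)⁻¹ * ∑ i, ∫⁻ t in Set.Icc (0 : ℝ) 1, f (i, t) := by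
  rw [segLatent, lintegral_prod _ hf.aemeasurable, lintegral_smul_measure, lintegral_count,
    tsum_fintype, smul_eq_mul]

variable [Nonempty ι]

lemma ae_segLatent {p : ι × ℝ → Prop} (h : ∀ i, ∀ t ∈ Set.Icc (0 : ℝ) 1, p (i, t)) :
    ∀ᵐ q ∂(segLatent ι), p q := by
  have := isProbabilityMeasure_uniformCount (ι := ι)
  have h0 : segLatent ι (Set.univ ×ˢ (Set.Icc (0 : ℝ) 1)ᶜ) = 0 := by
    rw [segLatent, Measure.prod_prod, Measure.restrict_apply measurableSet_Icc.compl]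
    simp
  filter_upwards [measure_eq_zero_iff_ae_notMem.1 h0] with q hq
  refine h q.1 q.2 ?_
  by_contra hc
  exact hq ⟨Set.mem_univ _, hc⟩

variable [MeasurableSingletonClass ι]

lemma segLatent_index_ne (j : ι) :
    segLatent ι {q | q.1 ≠ j} = 1 - (Fintype.card ι : ℝ≥0∞)⁻¹ := by
  have := isProbabilityMeasure_uniformCount (ι := ι)
  have e : {q : ι × ℝ | q.1 ≠ j} = ({j}ᶜ : Set ι) ×ˢ (Set.univ : Set ℝ) := by
    ext q; simp
  rw [e, segLatent, Measure.prod_prod, prob_compl_eq_one_sub (measurableSet_singleton j)]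
  simp

/-- Bernoulli's inequality: `(1 - 1/J)^n ≥ 1 - n/J`. -/
lemma half_le_pi_segLatent {n : ℕ} (hn : 2 * n ≤ Fintype.card ι) (j : ι) :
    ENNReal.ofReal (1 / 2) ≤ (Measure.pi fun _ : Fin n => segLatent ι) {z | ∀ a, (z a).1 ≠ j} := by
  have e : {z : Fin n → ι × ℝ | ∀ a, (z a).1 ≠ j} = Set.univ.pi fun _ => {q | q.1 ≠ j} := by
    ext z; simp
  have hJ : (0 : ℝ) < Fintype.card ι := Nat.cast_pos.2 Fintype.card_pos
  have hJ1 : (1 : ℝ) ≤ Fintype.card ι := by exact_mod_cast Fintype.card_pos (α := ι)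
  have hinv : (Fintype.card ι : ℝ)⁻¹ ≤ 1 := inv_le_one_of_one_le₀ hJ1
  rw [e, Measure.pi_pi]
  simp only [segLatent_index_ne, Finset.prod_const, Finset.card_univ, Fintype.card_fin]
  have e2 : (1 : ℝ≥0∞) - (Fintype.card ι : ℝ≥0∞)⁻¹ =
      ENNReal.ofReal (1 + -(Fintype.card ι : ℝ)⁻¹) := by
    rw [← sub_eq_add_neg, ENNReal.ofReal_sub _ (by positivity), ENNReal.ofReal_inv_of_pos hJ]
    simp
  rw [e2, ← ENNReal.ofReal_pow (by linarith)]
  refine ENNReal.ofReal_le_ofReal ?_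
  refine le_trans ?_ (one_add_mul_le_pow (by linarith) n)
  have h2 : (2 : ℝ) * n ≤ Fintype.card ι := by exact_mod_cast hn
  have : (n : ℝ) * (Fintype.card ι : ℝ)⁻¹ ≤ 1 / 2 := by
    rw [← div_eq_mul_inv, div_le_iff₀ hJ]; linarith
  linarith

end Latent

/-! ### Measures on segments and the potentials that translate them. -/

section Segments

variable {d : ℕ} {ι : Type*}

/-- Points of the source segments; the `i`-th segment is shifted back by `u * a` if `τ i` holds. -/
noncomputable def segSource (c : ι → Rd d) (e : Rd d) (a u : ℝ) (τ : ι → Bool) (q : ι × ℝ) : Rd d :=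
  c q.1 + ((q.2 - u * (τ q.1).toNat) * a) • e

/-- Points of the target segments, the images of those of `segSource`. -/
noncomputable def segTarget (c : ι → Rd d) (e : Rd d) (a u κ : ℝ) (τ : ι → Bool) (q : ι × ℝ) : Rd d :=
  κ • (c q.1 + ((q.2 + (1 / 2 - u) * (τ q.1).toNat) * a) • e)

lemma toNat_cast_mem (b : Bool) : (0 : ℝ) ≤ b.toNat ∧ (b.toNat : ℝ) ≤ 1 := by
  cases b <;> simp

lemma norm_segSource_sub_le {c : ι → Rd d} {e : Rd d} (he : ‖e‖ = 1) {a u : ℝ} (ha : 0 ≤ a)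
    (hu0 : 0 ≤ u) (hu1 : u ≤ 1 / 2) (τ : ι → Bool) (i : ι) {t : ℝ} (ht : t ∈ Set.Icc (0 : ℝ) 1) :
    ‖segSource c e a u τ (i, t) - c i‖ ≤ a := by
  have h1 := toNat_cast_mem (τ i)
  have h2 : u * ((τ i).toNat : ℝ) ≤ 1 / 2 := by nlinarith
  have h3 : 0 ≤ u * ((τ i).toNat : ℝ) := by nlinarith
  rw [segSource, add_sub_cancel_left, norm_smul, he, mul_one, Real.norm_eq_abs, abs_mul,
    abs_of_nonneg ha]
  refine mul_le_of_le_one_left ha ?_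
  rw [abs_le]
  constructor <;> linarith [ht.1, ht.2]

lemma norm_segTarget_le {c : ι → Rd d} {e : Rd d} (he : ‖e‖ = 1) {a u κ : ℝ} (ha : 0 ≤ a)
    (hκ : 0 ≤ κ) (hu0 : 0 ≤ u) (hu1 : u ≤ 1 / 2) (τ : ι → Bool) (i : ι) {t : ℝ}
    (ht : t ∈ Set.Icc (0 : ℝ) 1) :
    ‖segTarget c e a u κ τ (i, t)‖ ≤ κ * (‖c i‖ + 2 * a) := by
  have h1 := toNat_cast_mem (τ i)
  have h2 : (1 / 2 - u) * ((τ i).toNat : ℝ) ≤ 1 / 2 := by nlinarith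
  have h3 : 0 ≤ (1 / 2 - u) * ((τ i).toNat : ℝ) := mul_nonneg (by linarith) h1.1
  rw [segTarget, norm_smul, Real.norm_of_nonneg hκ]
  refine mul_le_mul_of_nonneg_left ((norm_add_le _ _).trans ?_) hκ
  rw [norm_smul, he, mul_one, Real.norm_eq_abs, abs_mul, abs_of_nonneg ha]
  refine add_le_add le_rfl (mul_le_mul_of_nonneg_right ?_ ha)
  rw [abs_le]
  constructor <;> linarith [ht.1, ht.2]

/-- The perturbed potentials, whose gradients translate the segments. -/
lemma exists_segPotential [Fintype ι] [Nonempty ι] {c : ι → Rd d} {e : Rd d} {h : ℝ}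
    (hh : 0 < h)
    (hsep : ∀ i j, i ≠ j → h ≤ ‖c i - c j‖) {g : Rd d → ℝ} {v : Rd d → Rd d} {L : ℝ} (hL : 0 < L)
    (hg : ∀ x, HasGradientAt g (v x) x) (hv : ∀ x y, ‖v x - v y‖ ≤ L * ‖x - y‖)
    (hv0 : ∀ x, 1 / 2 ≤ ‖x‖ → v x = 0) (hv1 : ∀ x, ‖x‖ < 1 / 4 → v x = e)
    {α β κ b : ℝ} (hα : 0 < α) (hb : 0 ≤ b) (hlo : α ≤ κ - 4 * (b * L / h))
    (hhi : κ + 4 * (b * L / h) ≤ β) (τ : ι → Bool) :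
    ∃ φ : Rd d → ℝ, CondA1 α φ ∧ CondA2 β φ ∧ StrictConvexOn ℝ Set.univ φ ∧
      ∀ i x, ‖x - c i‖ < h / 4 → ∇ φ x = κ • x + (b * (τ i).toNat) • e := by
  set w : ι → Rd d → Rd d := fun i x => (b * (τ i).toNat) • v (h⁻¹ • (x - c i)) with hw
  -- Bumps rescaled to width `h`: translation `b` near the centers, gradient Lipschitz constant `b *
  -- L / h`, and disjoint gradient supports because the centers are `h`-separated.
  set G : Rd d → ℝ := fun x => ∑ i, b * (τ i).toNat * h * g (h⁻¹ • (x - c i)) with hG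
  have hscale : ∀ x : Rd d, ‖h⁻¹ • x‖ = ‖x‖ / h := fun x => by
    rw [norm_smul, norm_inv, Real.norm_of_nonneg hh.le, inv_mul_eq_div]
  have hGw : ∀ x, HasGradientAt G (∑ i, w i x) x := by
    intro x
    rw [hasGradientAt_iff_hasFDerivAt, map_sum]
    refine HasFDerivAt.fun_sum fun i _ => ?_
    have h1 : HasFDerivAt (fun x : Rd d => h⁻¹ • (x - c i)) (h⁻¹ • ContinuousLinearMap.id ℝ (Rd d)) x :=
      ((hasFDerivAt_id x).sub_const (c i)).const_smul h⁻¹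
    have h2 := ((hg (h⁻¹ • (x - c i))).hasFDerivAt.comp x h1).const_mul (b * (τ i).toNat * h)
    refine h2.congr_fderiv ?_
    ext y
    simp only [hw, smul_apply, ContinuousLinearMap.comp_apply,
      ContinuousLinearMap.id_apply, InnerProductSpace.toDual_apply_apply, inner_smul_left,
      inner_smul_right, smul_eq_mul, conj_trivial]
    field_simp
  have hwz : ∀ i x, h / 2 ≤ ‖x - c i‖ → w i x = 0 := by
    intro i x hx
    simp only [hw]
    rw [hv0, smul_zero]
    rw [hscale, le_div_iff₀ hh]; linarith
  have hK : 0 ≤ b * L / h := by positivity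
  have hwl : ∀ i x y, ‖w i x - w i y‖ ≤ b * L / h * ‖x - y‖ := by
    intro i x y
    simp only [hw]
    rw [← smul_sub, norm_smul, Real.norm_of_nonneg (mul_nonneg hb (toNat_cast_mem _).1)]
    have h1 := hv (h⁻¹ • (x - c i)) (h⁻¹ • (y - c i))
    rw [← smul_sub, sub_sub_sub_cancel_right, hscale] at h1
    calc _ ≤ b * 1 * (L * (‖x - y‖ / h)) := by
          gcongr
          exact (toNat_cast_mem _).2
      _ = _ := by ring
  have hdisj : ∀ x i j, i ≠ j → w i x = 0 ∨ w j x = 0 := by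
    intro x i j hij
    rcases le_or_gt (h / 2) ‖x - c i‖ with h1 | h1
    · exact Or.inl (hwz i x h1)
    · refine Or.inr (hwz j x ?_)
      have h2 : c i - c j = (x - c j) - (x - c i) := by abel
      have h3 := norm_sub_le (x - c j) (x - c i)
      rw [← h2] at h3
      linarith [hsep i j hij]
  obtain ⟨h1, h2, h3, h4⟩ := conds_of_perturbation (φ := fun x => κ / 2 * ‖x‖ ^ 2 + G x) hα
    (show 0 ≤ 2 * (b * L / h) by positivity) (show α ≤ κ - 2 * (2 * (b * L / h)) by linarith)
    (show κ + 2 * (2 * (b * L / h)) ≤ β by linarith) hGw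
    (norm_sum_sub_sum_le hK hwl hdisj) fun x => rfl
  refine ⟨_, h1, h2, h3, fun i x hx => ?_⟩
  rw [h4, Finset.sum_eq_single i]
  · simp only [hw]
    rw [hv1]
    rw [hscale, div_lt_iff₀ hh]; linarith
  · intro j _ hj
    refine hwz j x ?_
    have h5 : c i - c j = (x - c j) - (x - c i) := by abel
    have h6 := norm_sub_le (x - c j) (x - c i)
    rw [← h5] at h6
    linarith [hsep i j (Ne.symm hj)]
  · simp

variable [Fintype ι] [MeasurableSpace ι]

lemma measurable_segSource [MeasurableSingletonClass ι] (c : ι → Rd d) (e : Rd d) (a u : ℝ) (τ : ι → Bool) :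
    Measurable (segSource c e a u τ) :=
  measurable_from_prod_countable_right fun i => by
    simp only [segSource]; fun_prop

lemma measurable_segTarget [MeasurableSingletonClass ι] (c : ι → Rd d) (e : Rd d) (a u κ : ℝ) (τ : ι → Bool) :
    Measurable (segTarget c e a u κ τ) :=
  measurable_from_prod_countable_right fun i => by
    simp only [segTarget]; fun_prop

variable [Nonempty ι]

lemma lintegral_rpow_map_segLatent_le {f : ι × ℝ → Rd d} (hf : Measurable f) {r M : ℝ} (hr : 0 ≤ r)
    (h : ∀ i, ∀ t ∈ Set.Icc (0 : ℝ) 1, ‖f (i, t)‖ ≤ M) :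
    ∫⁻ x, ‖x‖ₑ ^ r ∂((segLatent ι).map f) ≤ ENNReal.ofReal (M ^ r) := by
  rw [lintegral_map (by fun_prop) hf]
  calc _ ≤ ∫⁻ _q, ENNReal.ofReal (M ^ r) ∂(segLatent ι) := by
        refine lintegral_mono_ae (ae_segLatent fun i t ht => ?_)
        rw [← ofReal_norm, ENNReal.ofReal_rpow_of_nonneg (norm_nonneg _) hr]
        exact ENNReal.ofReal_le_ofReal (Real.rpow_le_rpow (norm_nonneg _) (h i t ht) hr)
    _ = _ := by simp

lemma integrable_map_segLatent {f : ι × ℝ → Rd d} (hf : Measurable f) {M : ℝ}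
    (h : ∀ i, ∀ t ∈ Set.Icc (0 : ℝ) 1, ‖f (i, t)‖ ≤ M) {ψ : Rd d → ℝ} (hψ : Continuous ψ) :
    Integrable ψ ((segLatent ι).map f) := by
  rw [integrable_map_measure hψ.aestronglyMeasurable hf.aemeasurable]
  obtain ⟨C, hC⟩ := (isCompact_closedBall (0 : Rd d) M).exists_bound_of_continuousOn hψ.continuousOn
  refine Integrable.of_bound (hψ.measurable.comp hf).aestronglyMeasurable C
    (ae_segLatent fun i t ht => hC _ ?_)
  rw [mem_closedBall_zero_iff]
  exact h i t ht

/-- All source points lie within `h / 4` of a center, where the gradient is explicit and adds `κ * a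
/ 2` along `e`. It sends the source segment to the target segment for every `u`, since the target
shift `1 / 2 - u` makes up the difference. -/
lemma inModel_seg [MeasurableSingletonClass ι] {c : ι → Rd d} {e : Rd d} (he : ‖e‖ = 1) {h a u α β κ r M : ℝ} (ha : 0 < a)
    (hah : a < h / 4) (hu0 : 0 ≤ u) (hu1 : u ≤ 1 / 2) (hα : 0 < α) (hβ : 0 < β) (hκ : 0 ≤ κ)
    (hr : 0 ≤ r)
    (hcM : ∀ i, ‖c i‖ + a ≤ M) (hcM' : ∀ i, κ * (‖c i‖ + 2 * a) ≤ M) {τ : ι → Bool} {φ : Rd d → ℝ}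
    (h1 : CondA1 α φ) (h2 : CondA2 β φ) (h3 : StrictConvexOn ℝ Set.univ φ)
    (h4 : ∀ i x, ‖x - c i‖ < h / 4 → ∇ φ x = κ • x + (κ * a / 2 * (τ i).toNat) • e) :
    InModel r M α β ((segLatent ι).map (segSource c e a u τ))
      ((segLatent ι).map (segTarget c e a u κ τ)) φ := by
  have hsm := measurable_segSource c e a u τ
  have htm := measurable_segTarget c e a u κ τ
  have hM : 0 ≤ M := le_trans (by positivity) (hcM (Classical.arbitrary ι))
  have hlip := h2.norm_gradient_sub_le hβ h1 hα
  have hTc : Continuous (∇ φ) := by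
    have : LipschitzWith (Real.toNNReal β) (∇ φ) := LipschitzWith.of_dist_le_mul fun x y => by
      rw [dist_eq_norm, dist_eq_norm, Real.coe_toNNReal _ hβ.le]; exact hlip x y
    exact this.continuous
  have hsM : ∀ i, ∀ t ∈ Set.Icc (0 : ℝ) 1, ‖segSource c e a u τ (i, t)‖ ≤ M := by
    intro i t ht
    have h5 := norm_segSource_sub_le (c := c) he ha.le hu0 hu1 τ i ht
    have h6 := norm_sub_norm_le (segSource c e a u τ (i, t)) (c i)
    linarith [hcM i]
  have hmap : ((segLatent ι).map (segSource c e a u τ)).map (∇ φ) =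
      (segLatent ι).map (segTarget c e a u κ τ) := by
    rw [Measure.map_map hTc.measurable hsm]
    refine Measure.map_congr (ae_segLatent fun i t ht => ?_)
    have h5 := norm_segSource_sub_le (c := c) he ha.le hu0 hu1 τ i ht
    rw [Function.comp_apply, h4 i _ (h5.trans_lt hah), segSource, segTarget]
    simp only
    module
  refine ⟨Measure.isProbabilityMeasure_map hsm.aemeasurable,
    Measure.isProbabilityMeasure_map htm.aemeasurable,
    lintegral_rpow_map_segLatent_le hsm hr hsM,
    lintegral_rpow_map_segLatent_le htm hr fun i t ht =>
      (norm_segTarget_le he ha.le hκ hu0 hu1 τ i ht).trans (hcM' i), fun x => ?_,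
    ⟨h3, h1.contDiff.differentiable (by norm_num), ?_⟩, h1, h2⟩
  · rw [Measure.map_apply hsm (measurableSet_singleton x), segLatent,
      Measure.measure_prod_null (hsm (measurableSet_singleton x))]
    refine Filter.Eventually.of_forall fun i => ?_
    refine Set.Subsingleton.measure_zero (fun s hs t ht => ?_) _
    have h5 : segSource c e a u τ (i, s) = segSource c e a u τ (i, t) := hs.trans ht.symm
    have he0 : e ≠ 0 := by rw [← norm_ne_zero_iff, he]; exact one_ne_zero
    simp only [segSource, add_right_inj] at h5
    have h6 := smul_left_injective ℝ he0 h5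
    have h7 := mul_right_cancel₀ ha.ne' h6
    linarith
  · rw [← hmap]
    refine isSemidualMinimizer_map_gradient (fun x y => ?_) hTc.measurable
      (integrable_map_segLatent hsm hsM h1.contDiff.continuous)
      (integrable_map_segLatent hsm hsM (continuous_id.inner hTc))
    have h5 := h1.lower x y
    have h6 : 0 ≤ α / 2 * ‖y - x‖ ^ 2 := by positivity
    linarith

end Segments

/-! ### Reduction of the minimax risk to Assouad's lemma. -/

section LowerBound

/-- A unit segment moved back by at most half its length still covers `[0, 1/2]`. On this common
half the losses for both bit values can be compared, although the source measure may depend on the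
bit. -/
lemma lintegral_half_le_shift (f : ℝ → ℝ≥0∞) {s : ℝ} (hs0 : 0 ≤ s) (hs1 : s ≤ 1 / 2) :
    ∫⁻ t in Set.Icc (0 : ℝ) (1 / 2), f t ≤ ∫⁻ t in Set.Icc (0 : ℝ) 1, f (t - s) := by
  rw [← lintegral_indicator measurableSet_Icc, ← lintegral_indicator measurableSet_Icc,
    ← lintegral_sub_right_eq_self _ s]
  refine lintegral_mono fun t => ?_
  by_cases ht : t - s ∈ Set.Icc (0 : ℝ) (1 / 2)
  · have ht' : t ∈ Set.Icc (0 : ℝ) 1 := ⟨by linarith [ht.1], by linarith [ht.2]⟩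
    rw [Set.indicator_of_mem ht, Set.indicator_of_mem ht']
  · rw [Set.indicator_of_notMem ht]
    exact zero_le

lemma ofReal_half_sq_le {E : Type*} [NormedAddCommGroup E] (x y z : E) :
    ENNReal.ofReal (‖y - z‖ ^ 2 / 2) ≤ ‖x - y‖ₑ ^ 2 + ‖x - z‖ₑ ^ 2 := by
  simp only [← ofReal_norm]
  rw [← ENNReal.ofReal_pow (norm_nonneg _), ← ENNReal.ofReal_pow (norm_nonneg _),
    ← ENNReal.ofReal_add (by positivity) (by positivity)]
  refine ENNReal.ofReal_le_ofReal ?_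
  have h1 : ‖y - z‖ ≤ ‖x - y‖ + ‖x - z‖ := by
    rw [← norm_neg (x - y)]
    refine le_trans (le_of_eq ?_) (norm_add_le _ _)
    congr 1; abel
  nlinarith [norm_nonneg (y - z), sq_nonneg (‖x - y‖ - ‖x - z‖)]

lemma ofReal_le_lintegral_half_add {E : Type*} [NormedAddCommGroup E] {f y z : ℝ → E} {δ : ℝ}
    (hf : Measurable fun t => ‖f t - y t‖ₑ ^ 2) (hδ : ∀ t, ‖y t - z t‖ = δ) :
    ENNReal.ofReal (δ ^ 2 / 2) * ENNReal.ofReal (1 / 2) ≤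
      (∫⁻ t in Set.Icc (0 : ℝ) (1 / 2), ‖f t - y t‖ₑ ^ 2) +
        ∫⁻ t in Set.Icc (0 : ℝ) (1 / 2), ‖f t - z t‖ₑ ^ 2 := by
  have hvol : volume (Set.Icc (0 : ℝ) (1 / 2)) = ENNReal.ofReal (1 / 2) := by
    rw [Real.volume_Icc, sub_zero]
  rw [← lintegral_add_left hf, ← hvol, ← setLIntegral_const]
  refine lintegral_mono fun t => ?_
  rw [← hδ t]
  exact ofReal_half_sq_le _ _ _

variable {d : ℕ} {ι : Type*} [Fintype ι]

/-- The error of the map `f` on the `j`-th segment, for the value `b` of the `j`-th bit. -/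
noncomputable def segLoss (c : ι → Rd d) (e : Rd d) (a κ δ : ℝ) (f : Rd d → Rd d) (j : ι) (b : Bool) :
    ℝ≥0∞ :=
  (Fintype.card ι : ℝ≥0∞)⁻¹ * ∫⁻ t in Set.Icc (0 : ℝ) (1 / 2),
    ‖f (c j + (t * a) • e) - (κ • (c j + (t * a) • e) + (δ * b.toNat) • e)‖ₑ ^ 2

lemma measurable_segLoss {Ω : Type*} [MeasurableSpace Ω] (c : ι → Rd d) (e : Rd d) (a κ δ : ℝ)
    {T : Ω → Rd d → Rd d} (hT : Measurable (Function.uncurry T)) (j : ι) (b : Bool) :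
    Measurable fun ω => segLoss c e a κ δ (T ω) j b := by
  have h2 : Measurable fun q : Ω × ℝ => c j + (q.2 * a) • e := by fun_prop
  have h1 : Measurable fun q : Ω × ℝ => T q.1 (c j + (q.2 * a) • e) :=
    hT.comp (measurable_fst.prodMk h2)
  have h3 : Measurable fun q : Ω × ℝ => ‖T q.1 (c j + (q.2 * a) • e) -
      (κ • (c j + (q.2 * a) • e) + (δ * b.toNat) • e)‖ₑ ^ 2 :=
    (h1.sub ((h2.const_smul κ).add_const _)).enorm.pow_const 2
  exact (Measurable.lintegral_prod_right' h3).const_mul _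

lemma le_segLoss_add (c : ι → Rd d) {e : Rd d} (he : ‖e‖ = 1) (a κ : ℝ) {δ : ℝ} (hδ : 0 ≤ δ)
    {f : Rd d → Rd d} (hf : Measurable f) (j : ι) :
    (Fintype.card ι : ℝ≥0∞)⁻¹ * (ENNReal.ofReal (δ ^ 2 / 2) * ENNReal.ofReal (1 / 2)) ≤
      segLoss c e a κ δ f j false + segLoss c e a κ δ f j true := by
  unfold segLoss
  rw [← mul_add]
  refine mul_le_mul_right (ofReal_le_lintegral_half_add ?_ fun t => ?_) _
  · fun_prop
  · simp [norm_smul, he, abs_of_nonneg hδ]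

variable [MeasurableSpace ι]

lemma lintegral_pi_prod_map_segLatent [Nonempty ι] {f g : ι × ℝ → Rd d} (hf : Measurable f)
    (hg : Measurable g) {n m : ℕ} {F : (Fin n → Rd d) × (Fin m → Rd d) → ℝ≥0∞} (hF : Measurable F) :
    ∫⁻ ω, F ω ∂((Measure.pi fun _ : Fin n => (segLatent ι).map f).prod
        (Measure.pi fun _ : Fin m => (segLatent ι).map g)) =
      ∫⁻ z, F (fun k => f (z.1 k), fun k => g (z.2 k))
        ∂((Measure.pi fun _ : Fin n => segLatent ι).prod (Measure.pi fun _ : Fin m => segLatent ι)) := by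
  have : IsProbabilityMeasure ((segLatent ι).map f) := Measure.isProbabilityMeasure_map hf.aemeasurable
  have : IsProbabilityMeasure ((segLatent ι).map g) := Measure.isProbabilityMeasure_map hg.aemeasurable
  have h1 := measurePreserving_pi (fun _ : Fin n => segLatent ι) (fun _ => (segLatent ι).map f)
    fun _ => hf.measurePreserving (segLatent ι)
  have h2 := measurePreserving_pi (fun _ : Fin m => segLatent ι) (fun _ => (segLatent ι).map g)
    fun _ => hg.measurePreserving (segLatent ι)
  exact ((h1.prod h2).lintegral_comp hF).symm

variable [MeasurableSingletonClass ι]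

lemma sum_lintegral_le_map_segSource (c : ι → Rd d) (e : Rd d) {a u : ℝ} (hu0 : 0 ≤ u)
    (hu1 : u ≤ 1 / 2) (τ : ι → Bool) {f : Rd d → ℝ≥0∞} (hf : Measurable f) :
    ∑ j, (Fintype.card ι : ℝ≥0∞)⁻¹ * ∫⁻ t in Set.Icc (0 : ℝ) (1 / 2), f (c j + (t * a) • e) ≤
      ∫⁻ x, f x ∂(segLatent ι).map (segSource c e a u τ) := by
  rw [lintegral_map hf (measurable_segSource c e a u τ),
    lintegral_segLatent (f := fun q => f (segSource c e a u τ q))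
      (hf.comp (measurable_segSource c e a u τ)), ← Finset.mul_sum]
  refine mul_le_mul_right (Finset.sum_le_sum fun j _ => ?_) _
  refine lintegral_half_le_shift (fun t => f (c j + (t * a) • e)) (s := u * (τ j).toNat)
    (mul_nonneg hu0 (toNat_cast_mem _).1) ?_
  nlinarith [(toNat_cast_mem (τ j)).1, (toNat_cast_mem (τ j)).2]

/-- Decouples the loss: each summand on the left depends on `τ` only through its own bit, as
`assouad_bound` requires. -/
lemma sum_segLoss_le {c : ι → Rd d} {e : Rd d} (he : ‖e‖ = 1) {h a u κ δ : ℝ} (ha : 0 ≤ a)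
    (hah : a < h / 4) (hu0 : 0 ≤ u) (hu1 : u ≤ 1 / 2) (τ : ι → Bool) {f f₀ : Rd d → Rd d}
    (hf : Measurable f)
    (hf₀m : Measurable f₀) (hf₀ : ∀ i x, ‖x - c i‖ < h / 4 → f₀ x = κ • x + (δ * (τ i).toNat) • e) :
    ∑ j, segLoss c e a κ δ f j (τ j) ≤
      ∫⁻ x, ‖f x - f₀ x‖ₑ ^ 2 ∂(segLatent ι).map (segSource c e a u τ) := by
  refine le_trans (le_of_eq ?_) (sum_lintegral_le_map_segSource c e hu0 hu1 τ
    ((hf.sub hf₀m).enorm.pow_const 2))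
  refine Finset.sum_congr rfl fun j _ => ?_
  unfold segLoss
  congr 1
  refine setLIntegral_congr_fun measurableSet_Icc fun t ht => ?_
  have h1 : ‖c j + (t * a) • e - c j‖ < h / 4 := by
    rw [add_sub_cancel_left, norm_smul, he, mul_one, Real.norm_eq_abs,
      abs_of_nonneg (mul_nonneg ht.1 ha)]
    nlinarith [ht.2]
  simp only [hf₀ j _ h1]

variable [Nonempty ι]

/-- If the latent samples avoid the index `j`, then flipping the `j`-th bit does not matter. -/
lemma exists_event_update (c : ι → Rd d) (e : Rd d) (a κ : ℝ) {u : ℝ} {n m : ℕ} [DecidableEq ι]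
    (hu : u = 1 / 2 ∧ 2 * n ≤ Fintype.card ι ∨ u = 0 ∧ 2 * m ≤ Fintype.card ι) (j : ι) :
    ∃ E : Set ((Fin n → ι × ℝ) × (Fin m → ι × ℝ)), MeasurableSet E ∧
      (∀ (τ : ι → Bool), ∀ z ∈ E,
        (fun k => segSource c e a u (Function.update τ j (!τ j)) (z.1 k)) =
          (fun k => segSource c e a u τ (z.1 k)) ∧
        (fun k => segTarget c e a u κ (Function.update τ j (!τ j)) (z.2 k)) =
          (fun k => segTarget c e a u κ τ (z.2 k))) ∧
      ENNReal.ofReal (1 / 2) ≤ ((Measure.pi fun _ : Fin n => segLatent ι).prod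
        (Measure.pi fun _ : Fin m => segLatent ι)) E := by
  have hmeas : ∀ n : ℕ, MeasurableSet {z : Fin n → ι × ℝ | ∀ k, (z k).1 ≠ j} := fun n => by
    have h1 : {z : Fin n → ι × ℝ | ∀ k, (z k).1 ≠ j} = ⋂ k, (fun z => (z k).1) ⁻¹' {j}ᶜ := by
      ext z; simp
    rw [h1]
    exact MeasurableSet.iInter fun k =>
      (measurable_fst.comp (measurable_pi_apply k)) (measurableSet_singleton j).compl
  -- For `u = 1/2` the target is independent of the bits, for `u = 0` the source is; only the other
  -- sample has to avoid segment `j`.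
  rcases hu with ⟨rfl, hn⟩ | ⟨rfl, hm⟩
  · refine ⟨{z | ∀ k, (z k).1 ≠ j} ×ˢ Set.univ, (hmeas n).prod MeasurableSet.univ,
      fun τ z hz => ⟨?_, ?_⟩, ?_⟩
    · funext k
      simp only [segSource, Function.update_of_ne (hz.1 k)]
    · funext k
      simp only [segTarget, sub_self, zero_mul]
    · rw [Measure.prod_prod, measure_univ, mul_one]
      exact half_le_pi_segLatent hn j
  · refine ⟨Set.univ ×ˢ {z | ∀ k, (z k).1 ≠ j}, MeasurableSet.univ.prod (hmeas m),
      fun τ z hz => ⟨?_, ?_⟩, ?_⟩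
    · funext k
      simp only [segSource, zero_mul]
    · funext k
      simp only [segTarget, Function.update_of_ne (hz.2 k)]
    · rw [Measure.prod_prod, measure_univ, one_mul]
      exact half_le_pi_segLatent hm j

lemma lintegral_sum_segLoss_le_risk {c : ι → Rd d} {e : Rd d} (he : ‖e‖ = 1) {h a u κ δ : ℝ}
    (ha : 0 ≤ a) (hah : a < h / 4) (hu0 : 0 ≤ u) (hu1 : u ≤ 1 / 2) (τ : ι → Bool) {n m : ℕ}
    {T : (Fin n → Rd d) × (Fin m → Rd d) → Rd d → Rd d} (hT : Measurable (Function.uncurry T))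
    {f₀ : Rd d → Rd d} (hf₀m : Measurable f₀)
    (hf₀ : ∀ i x, ‖x - c i‖ < h / 4 → f₀ x = κ • x + (δ * (τ i).toNat) • e) :
    ∫⁻ z, ∑ j, segLoss c e a κ δ
        (T (fun k => segSource c e a u τ (z.1 k), fun k => segTarget c e a u κ τ (z.2 k))) j (τ j)
        ∂((Measure.pi fun _ : Fin n => segLatent ι).prod (Measure.pi fun _ : Fin m => segLatent ι)) ≤
      risk ((Measure.pi fun _ : Fin n => (segLatent ι).map (segSource c e a u τ)).prod
        (Measure.pi fun _ : Fin m => (segLatent ι).map (segTarget c e a u κ τ)))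
        ((segLatent ι).map (segSource c e a u τ)) T f₀ := by
  have hFm : Measurable fun q : ((Fin n → Rd d) × (Fin m → Rd d)) × Rd d =>
      ‖T q.1 q.2 - f₀ q.2‖ₑ ^ 2 :=
    (hT.sub (hf₀m.comp measurable_snd)).enorm.pow_const 2
  have hP : IsProbabilityMeasure ((segLatent ι).map (segSource c e a u τ)) :=
    Measure.isProbabilityMeasure_map (measurable_segSource c e a u τ).aemeasurable
  have hFi : Measurable fun ω => ∫⁻ x, ‖T ω x - f₀ x‖ₑ ^ 2 ∂(segLatent ι).map (segSource c e a u τ) :=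
    Measurable.lintegral_prod_right' hFm
  have h1 := lintegral_pi_prod_map_segLatent (measurable_segSource c e a u τ)
    (measurable_segTarget c e a u κ τ) hFi
  have h2 : ∀ ω, ∑ j, segLoss c e a κ δ (T ω) j (τ j) ≤
      ∫⁻ x, ‖T ω x - f₀ x‖ₑ ^ 2 ∂(segLatent ι).map (segSource c e a u τ) := fun ω =>
    sum_segLoss_le he ha hah hu0 hu1 τ (hT.comp measurable_prodMk_left) hf₀m hf₀
  unfold risk
  rw [h1]
  exact lintegral_mono fun z => h2 _

/-- The lower bound from a family of separated segments. -/
lemma ofReal_le_otMinimaxRisk_of_seg {c : ι → Rd d} {e : Rd d} (he : ‖e‖ = 1)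
    {h a u α β κ r M : ℝ} (ha : 0 < a) (hah : a < h / 4)
    (hα : 0 < α) (hβ : 0 < β) (hκ : 0 ≤ κ) (hr : 0 ≤ r) (hcM : ∀ i, ‖c i‖ + a ≤ M)
    (hcM' : ∀ i, κ * (‖c i‖ + 2 * a) ≤ M)
    (hφ : ∀ τ : ι → Bool, ∃ φ : Rd d → ℝ, CondA1 α φ ∧ CondA2 β φ ∧ StrictConvexOn ℝ Set.univ φ ∧
      ∀ i x, ‖x - c i‖ < h / 4 → ∇ φ x = κ • x + (κ * a / 2 * (τ i).toNat) • e)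
    {n m : ℕ} (hu : u = 1 / 2 ∧ 2 * n ≤ Fintype.card ι ∨ u = 0 ∧ 2 * m ≤ Fintype.card ι) :
    ENNReal.ofReal ((κ * a / 2) ^ 2 / 16) ≤ otMinimaxRisk d n m r M α β := by
  classical
  have hu0 : 0 ≤ u := by rcases hu with ⟨rfl, -⟩ | ⟨rfl, -⟩ <;> norm_num
  have hu1 : u ≤ 1 / 2 := by rcases hu with ⟨rfl, -⟩ | ⟨rfl, -⟩ <;> norm_num
  refine le_iInf₂ fun T hT => ?_
  set R := ⨆ (P : Measure (Rd d)) (Q : Measure (Rd d)) (φ : Rd d → ℝ) (_ : InModel r M α β P Q φ),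
      risk ((Measure.pi fun _ : Fin n => P).prod (Measure.pi fun _ : Fin m => Q)) P T (∇ φ) with hRdef
  choose φ hφ1 hφ2 hφ3 hφ4 using hφ
  have hmodel := fun τ => inModel_seg he ha hah hu0 hu1 hα hβ hκ hr hcM hcM' (hφ1 τ) (hφ2 τ)
    (hφ3 τ) (hφ4 τ)
  have hrisk : ∀ τ, risk _ _ T (∇ (φ τ)) ≤ R := fun τ =>
    le_iSup_of_le _ (le_iSup_of_le _ (le_iSup_of_le _ (le_iSup_of_le (hmodel τ) le_rfl)))
  clear_value R
  choose E hEm hEup hE using exists_event_update (n := n) (m := m) c e a κ hu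
  set δ := κ * a / 2 with hδ
  have hδ0 : 0 ≤ δ := by positivity
  let D : (ι → Bool) → (Fin n → ι × ℝ) × (Fin m → ι × ℝ) → (Fin n → Rd d) × (Fin m → Rd d) :=
    fun τ z => (fun k => segSource c e a u τ (z.1 k), fun k => segTarget c e a u κ τ (z.2 k))
  have hDm : ∀ τ, Measurable (D τ) := fun τ => by
    have h1 := measurable_segSource c e a u τ
    have h2 := measurable_segTarget c e a u κ τ
    refine Measurable.prodMk ?_ ?_
    · exact measurable_pi_lambda _ fun k => h1.comp ((measurable_pi_apply k).comp measurable_fst)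
    · exact measurable_pi_lambda _ fun k => h2.comp ((measurable_pi_apply k).comp measurable_snd)
  have key := assouad_bound ((Measure.pi fun _ : Fin n => segLatent ι).prod
    (Measure.pi fun _ : Fin m => segLatent ι)) D E hEm
    (fun τ j z hz => Prod.ext (hEup j τ z hz).1 (hEup j τ z hz).2)
    (fun j b ω => segLoss c e a κ δ (T ω) j b)
    (fun j b τ => (measurable_segLoss c e a κ δ hT j b).comp (hDm τ))
    (s := (Fintype.card ι : ℝ≥0∞)⁻¹ * (ENNReal.ofReal (δ ^ 2 / 2) * ENNReal.ofReal (1 / 2)))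
    (η := ENNReal.ofReal (1 / 2)) (R := R) ?_ hE ?_
  -- The number of segments cancels and Assouad's bound reads `δ² / 8 ≤ 2 * R`.
  · have hJ0 : (Fintype.card ι : ℝ≥0∞) ≠ 0 := Nat.cast_ne_zero.2 Fintype.card_ne_zero
    rw [mul_assoc, ← mul_assoc, ENNReal.mul_inv_cancel hJ0 (ENNReal.natCast_ne_top _), one_mul,
      ← ENNReal.ofReal_mul (by positivity), ← ENNReal.ofReal_mul (by positivity)] at key
    refine (ENNReal.mul_le_mul_iff_right (a := 2) (by norm_num) (by norm_num)).1 (le_trans ?_ key)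
    rw [show (2 : ℝ≥0∞) = ENNReal.ofReal 2 by norm_num, ← ENNReal.ofReal_mul (by norm_num)]
    refine ENNReal.ofReal_le_ofReal (le_of_eq ?_)
    ring
  · exact fun j ω => le_segLoss_add c he a κ hδ0 (hT.comp measurable_prodMk_left) j
  · intro τ
    have hgm : Measurable (∇ (φ τ)) := by
      have h1 : Continuous (∇ (φ τ)) := by
        unfold gradient
        exact (LinearIsometryEquiv.continuous _).comp ((hφ1 τ).contDiff.continuous_fderiv one_ne_zero)
      exact h1.measurable
    exact (lintegral_sum_segLoss_le_risk he ha.le hah hu0 hu1 τ hT hgm (hφ4 τ)).trans (hrisk τ)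

end LowerBound

/-! ### Segment centers on a grid, and the choice of constants. -/

section Grid

lemma exists_grid (d : ℕ) {k : ℕ} (hk : 0 < k) {s : ℝ} (hs : 0 ≤ s) :
    ∃ c : (Fin d → Fin k) → Rd d, (∀ i, ‖c i‖ ≤ d * s) ∧ ∀ i j, i ≠ j → s / k ≤ ‖c i - c j‖ := by
  have hk' : (0 : ℝ) < k := Nat.cast_pos.2 hk
  refine ⟨fun i => WithLp.toLp 2 fun l => s / k * (i l : ℕ), fun i => ?_, fun i j hij => ?_⟩
  · rw [EuclideanSpace.norm_eq]
    refine Real.sqrt_le_iff.2 ⟨by positivity, ?_⟩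
    have h1 : ∀ l, ‖s / k * ((i l : ℕ) : ℝ)‖ ^ 2 ≤ s ^ 2 := fun l => by
      rw [Real.norm_of_nonneg (by positivity)]
      have h2 : ((i l : ℕ) : ℝ) ≤ k := Nat.cast_le.2 (i l).2.le
      have h3 : s / k * ((i l : ℕ) : ℝ) ≤ s / k * k := by gcongr
      rw [div_mul_cancel₀ _ hk'.ne'] at h3
      gcongr
    calc _ ≤ ∑ _l : Fin d, s ^ 2 := Finset.sum_le_sum fun l _ => h1 l
      _ = (d : ℝ) * s ^ 2 := by simp
      _ ≤ (d * s) ^ 2 := by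
          rw [mul_pow]
          gcongr
          exact_mod_cast Nat.le_self_pow two_ne_zero d
  · obtain ⟨l, hl⟩ := Function.ne_iff.1 hij
    refine le_trans ?_ (PiLp.norm_apply_le _ l)
    have h1 : (1 : ℝ) ≤ |((i l : ℕ) : ℝ) - ((j l : ℕ) : ℝ)| := by
      have h2 : ((i l : ℕ) : ℤ) - ((j l : ℕ) : ℤ) ≠ 0 := by
        rw [sub_ne_zero]
        exact fun h => hl (Fin.ext (by exact_mod_cast h))
      exact_mod_cast Int.one_le_abs h2
    simp only [PiLp.sub_apply]
    rw [← mul_sub, norm_mul, Real.norm_of_nonneg (by positivity), Real.norm_eq_abs]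
    nlinarith [div_nonneg hs hk'.le]

/-- Take `k = 2 * ⌈N^(1/d)⌉`: the factor `2` yields `k^d ≥ 2N`, and the ceiling at most doubles
since `N ≥ 1`. -/
lemma exists_grid_size {d : ℕ} (hd : 0 < d) {N : ℕ} (hN : 1 ≤ N) :
    ∃ k : ℕ, 0 < k ∧ 2 * N ≤ k ^ d ∧ (k : ℝ) ≤ 4 * (N : ℝ) ^ ((d : ℝ)⁻¹) := by
  set x : ℝ := (N : ℝ) ^ ((d : ℝ)⁻¹) with hx
  have hN' : (1 : ℝ) ≤ N := Nat.one_le_cast.2 hN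
  have hx1 : 1 ≤ x := Real.one_le_rpow hN' (by positivity)
  have hxd : x ^ d = N := Real.rpow_inv_natCast_pow (by positivity) hd.ne'
  have hk : x ≤ ⌈x⌉₊ := Nat.le_ceil x
  have h1 : (⌈x⌉₊ : ℝ) < x + 1 := Nat.ceil_lt_add_one (by linarith)
  refine ⟨2 * ⌈x⌉₊, ?_, ?_, ?_⟩
  · have : 0 < ⌈x⌉₊ := Nat.ceil_pos.2 (by linarith)
    omega
  · rw [mul_pow]
    refine Nat.mul_le_mul (Nat.le_self_pow hd.ne' 2) ?_
    have h2 : (N : ℝ) ≤ (⌈x⌉₊ : ℝ) ^ d := by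
      rw [← hxd]; gcongr
    exact_mod_cast h2
  · push_cast
    linarith

/-- The minimax lower bound in terms of the size of one of the two samples. -/
lemma exists_const_le_otMinimaxRisk {d : ℕ} (hd : 0 < d) {r M α β : ℝ} (hr : 0 ≤ r) (hM : 0 < M)
    (hα : 0 < α) (hαβ : α < β) : ∃ c : ℝ, 0 < c ∧ ∀ n m N : ℕ, 1 ≤ N → (N = n ∨ N = m) →
      ENNReal.ofReal (c * (N : ℝ) ^ (-(2 : ℝ) / (d : ℝ))) ≤ otMinimaxRisk d n m r M α β := by
  set e : Rd d := EuclideanSpace.single ⟨0, hd⟩ 1 with he_def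
  have he : ‖e‖ = 1 := by simp [he_def]
  obtain ⟨g, v, L, hL, hg, hv, hv0, hv1⟩ := exists_linear_bump e
  clear_value e
  set κ : ℝ := (α + β) / 2 with hκ_def
  have hκ : 0 < κ := by linarith
  -- The first bound keeps segments short (`a ≤ h / 8`); the second keeps the curvature perturbation
  -- `4 * ε * L` within `(β - α) / 2`, the room around the midpoint `κ`.
  set ε : ℝ := min (κ / 16) ((β - α) / (8 * L)) with hε_def
  have hε : 0 < ε := lt_min (by positivity) (div_pos (by linarith) (by positivity))
  have hε1 : ε ≤ κ / 16 := min_le_left _ _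
  have hε2 : ε * L ≤ (β - α) / 8 := by
    have h1 : ε ≤ (β - α) / (8 * L) := min_le_right _ _
    rw [le_div_iff₀ (by positivity)] at h1
    linarith
  clear_value ε
  -- Small enough that source and target segments both lie in the ball of radius `M`, which gives
  -- the moment bounds.
  set s : ℝ := M / ((d + 1) * (1 + κ)) with hs_def
  have hs : 0 < s := by positivity
  have hsM : (d + 1) * s * (1 + κ) = M := by
    rw [hs_def]; field_simp
  clear_value s
  refine ⟨ε ^ 2 * s ^ 2 / 256, by positivity, fun n m N hN hNnm => ?_⟩
  obtain ⟨k, hk, hkN, hkx⟩ := exists_grid_size hd hN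
  obtain ⟨c, hc, hsep⟩ := exists_grid d hk hs.le
  have hk' : (1 : ℝ) ≤ k := Nat.one_le_cast.2 hk
  set h : ℝ := s / k with hh_def
  have hh : 0 < h := by positivity
  have hhs : h ≤ s := div_le_self hs.le hk'
  -- Chosen so that the translation `κ * a / 2` equals `ε * h`, of order `N^(-1/d)`.
  set a : ℝ := 2 * ε * h / κ with ha_def
  have ha : 0 < a := by positivity
  have ha8 : a ≤ h / 8 := by
    rw [ha_def, div_le_iff₀ hκ]
    nlinarith
  have hb : κ * a / 2 = ε * h := by
    rw [ha_def]; field_simp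
  have hbL : κ * a / 2 * L / h = ε * L := by
    rw [hb]; field_simp
  have hcard : Fintype.card (Fin d → Fin k) = k ^ d := by simp
  have hcs : ∀ i, ‖c i‖ + 2 * a ≤ (d + 1) * s := fun i => by linarith [hc i]
  have hds : 0 < (d + 1) * s := by positivity
  have hk0 : Nonempty (Fin k) := ⟨⟨0, hk⟩⟩
  have hu : ∃ u : ℝ, u = 1 / 2 ∧ 2 * n ≤ Fintype.card (Fin d → Fin k) ∨
      u = 0 ∧ 2 * m ≤ Fintype.card (Fin d → Fin k) := by
    rcases hNnm with rfl | rfl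
    · exact ⟨_, Or.inl ⟨rfl, hcard ▸ hkN⟩⟩
    · exact ⟨_, Or.inr ⟨rfl, hcard ▸ hkN⟩⟩
  obtain ⟨u, hu⟩ := hu
  refine le_trans (ENNReal.ofReal_le_ofReal ?_) (ofReal_le_otMinimaxRisk_of_seg (c := c) he ha
    (by linarith) hα (hα.trans hαβ) hκ.le hr (fun i => by nlinarith [hcs i]) (fun i => ?_)
    (exists_segPotential hh hsep hL hg hv hv0 hv1 hα (by positivity) (by rw [hbL]; linarith)
      (by rw [hbL]; linarith)) hu)
  · rw [hb]
    have hx0 : (0 : ℝ) < (N : ℝ) ^ ((d : ℝ)⁻¹) := by positivity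
    have hrate : (N : ℝ) ^ (-(2 : ℝ) / (d : ℝ)) = (((N : ℝ) ^ ((d : ℝ)⁻¹)) ^ 2)⁻¹ := by
      rw [← Real.rpow_natCast, ← Real.rpow_mul (by positivity), ← Real.rpow_neg (by positivity)]
      congr 1; push_cast; ring
    rw [hrate, hh_def]
    have hk2 : (k : ℝ) ^ 2 ≤ 16 * ((N : ℝ) ^ ((d : ℝ)⁻¹)) ^ 2 := by
      calc (k : ℝ) ^ 2 ≤ (4 * (N : ℝ) ^ ((d : ℝ)⁻¹)) ^ 2 := by gcongr
        _ = _ := by ring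
    calc ε ^ 2 * s ^ 2 / 256 * (((N : ℝ) ^ ((d : ℝ)⁻¹)) ^ 2)⁻¹
        = ε ^ 2 * s ^ 2 / 16 * (16 * ((N : ℝ) ^ ((d : ℝ)⁻¹)) ^ 2)⁻¹ := by
          rw [mul_inv]; ring
      _ ≤ ε ^ 2 * s ^ 2 / 16 * ((k : ℝ) ^ 2)⁻¹ := by gcongr
      _ = (ε * (s / k)) ^ 2 / 16 := by field_simp
  · calc κ * (‖c i‖ + 2 * a) ≤ κ * ((d + 1) * s) := by gcongr; exact hcs i
      _ ≤ M := by nlinarith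

/-- The larger of the two terms is at least half of their sum. -/
lemma exists_const_otRate_le_otMinimaxRisk {d : ℕ} (hd : 0 < d) {r M α β : ℝ} (hr : 0 ≤ r)
    (hM : 0 < M) (hα : 0 < α) (hαβ : α < β) : ∃ c : ℝ, 0 < c ∧ ∀ n m : ℕ, 1 ≤ n → 1 ≤ m →
      ENNReal.ofReal (c * otRate d n m) ≤ otMinimaxRisk d n m r M α β := by
  obtain ⟨c, hc, h⟩ := exists_const_le_otMinimaxRisk hd hr hM hα hαβ
  refine ⟨c / 2, by positivity, fun n m hn hm => ?_⟩
  have h1 := h n m n hn (Or.inl rfl)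
  have h2 := h n m m hm (Or.inr rfl)
  unfold otRate
  rcases le_total ((n : ℝ) ^ (-(2 : ℝ) / (d : ℝ))) ((m : ℝ) ^ (-(2 : ℝ) / (d : ℝ))) with h3 | h3
  · exact le_trans (ENNReal.ofReal_le_ofReal (by nlinarith)) h2
  · exact le_trans (ENNReal.ofReal_le_ofReal (by nlinarith)) h1

end Grid

theorem mainTheorem9 (d : ℕ) (hd : 4 < d) (r M α β : ℝ) (hr : 4 < r) (hM : 0 < M)
    (hα : 0 < α) (hβ : 0 < β) :
    (∃ C : ℝ, 0 < C ∧ ∀ n m : ℕ, 2 ≤ n → 1 ≤ m →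
      ∀ (P Q : Measure (Rd d)) (φ : Rd d → ℝ), InModel r M α β P Q φ →
      ∀ (S : Type*) [MeasurableSpace S] (μ : Measure S) [IsProbabilityMeasure μ]
        (X : Fin n → S → Rd d) (Y : Fin m → S → Rd d) (T : S → Rd d → Rd d),
        IsIIDSample μ X P → IsIIDSample μ Y Q → IsOneNNEstimator μ P X Y T →
        risk μ P T (∇ φ) ≤ ENNReal.ofReal (C * otRate d n m * Real.log n)) ∧
    (α < β → ∃ c : ℝ, 0 < c ∧ ∀ n m : ℕ, 1 ≤ n → 1 ≤ m →
      ENNReal.ofReal (c * otRate d n m) ≤ otMinimaxRisk d n m r M α β) :=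
  ⟨oneNN_risk_le hd hr hM hα hβ, fun hαβ =>
    exists_const_otRate_le_otMinimaxRisk (by omega) (by linarith) hM hα hαβ⟩
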